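/- Let $\Bbbk$ be a field of characteristic $0$ and write $\otimes=\otimes_\Bbbk$. **Quivers.** Let $Q$ be a quiver with finite vertex set $I$ and finite arrow set; an arrow $a$ goes from its tail $t(a)$ to its head $h(a)$. Its double $\bar Q$ is obtained by adding an arrow $a^*:h(a)\to t(a)$ for each $a\in Q$, and one sets $(a^*)^*=a$, so that $*$ is an involution on $\bar Q$. The path algebra $\Bbbk\bar Q$ has generators $e_s$ ($s\in I$) and $a\in\bar Q$, with relations $e_se_{s'}=\delta_{ss'}e_s$, $\sum_s e_s=1$, $a=e_{t(a)}ae_{h(a)}$. Let $A_Q$ be the universal localisation of $\Bbbk\bar Q$ at the set $\{1+aa^*\mid a\in\bar Q\}$; it is an algebra over $B=\bigoplus_{s\in I}\Bbbk e_s$. **Quasi-Hamiltonian algebras.** A $B$-linear double bracket on a $B$-algebra $A$ is a $\Bbbk$-bilinear map $\{\!\{-,-\}\!\}:A\times A\to A\otimes A$, vanishing if one entry is in $B$, such that $\{\!\{a,b\}\!\}=-\{\!\{b,a\}\!\}^\circ$, where $\circ$ swaps the two tensor factors, and $\{\!\{a,bc\}\!\}=\{\!\{a,b\}\!\}(1\otimes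 c)+(b\otimes 1)\{\!\{a,c\}\!\}$. With $\tau(x\otimes y\otimes z)=z\otimes x\otimes y$ and $d=d'\otimes d''$ (Sweedler notation), its triple bracket is $$\{\!\{a,b,c\}\!\}=\{\!\{a,\{\!\{b,c\}\!\}'\}\!\}\otimes\{\!\{b,c\}\!\}''+\tau\big(\{\!\{b,\{\!\{c,a\}\!\}'\}\!\}\otimes\{\!\{c,a\}\!\}''\big)+\tau^2\big(\{\!\{c,\{\!\{a,b\}\!\}'\}\!\}\otimes\{\!\{a,b\}\!\}''\big).$$ The double bracket is quasi-Poisson if for all $a,b,c\in A$ $$\begin{aligned}\{\!\{a,b,c\}\!\}=\tfrac14\sum_{s\in I}\big(&ce_sa\otimes e_sb\otimes e_s-ce_sa\otimes e_s\otimes be_s-ce_s\otimes ae_sb\otimes e_s+ce_s\otimes ae_s\otimes be_s\\&-e_sa\otimes e_sb\otimes e_sc+e_sa\otimes e_s\otimes be_sc+e_s\otimes ae_sb\otimes e_sc-e_s\otimes ae_s\otimes be_sc\big).\end{aligned}$$ A multiplicative moment map is an invertible element $\Phi=\sum_s\Phi_s$ with $\Phi_s\in e_sAe_s$ and $\{\!\{\Phi_s,a\}\!\}=\frac12(ae_s\otimes\Phi_s-e_s\otimes\Phi_sa+a\Phi_s\otimes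 e_s-\Phi_s\otimes e_sa)$ for all $s\in I$, $a\in A$. A quasi-Hamiltonian algebra over $B$ is a triple $(A,\{\!\{-,-\}\!\},\Phi)$ of a $B$-algebra, a $B$-linear double quasi-Poisson bracket and a multiplicative moment map. An isomorphism of quasi-Hamiltonian algebras over $B$ is an isomorphism of $B$-algebras $\psi$ with $\{\!\{\psi(a),\psi(b)\}\!\}=(\psi\otimes\psi)\{\!\{a,b\}\!\}$ for all $a,b$, which maps the multiplicative moment map to the multiplicative moment map. **Van den Bergh's structure.** For each $s\in I$ choose a total ordering $<_s$ on $T_s=\{a\in\bar Q\mid t(a)=s\}$. Put $o_s(a,b)=1$ if $a,b\in T_s$ and $a<_sb$, $o_s(a,b)=-1$ if $a,b\in T_s$ and $b<_sa$, and $o_s(a,b)=0$ otherwise. Consider the $B$-linear double bracket on $A_Q$ with $$\{\!\{a,a\}\!\}=\tfrac12o_{t(a)}(a,a^*)\big(a^2\otimes e_{t(a)}-e_{h(a)}\otimes a^2\big)\qquad(a\in\bar Q),$$ $$\{\!\{a,a^*\}\!\}=e_{h(a)}\otimes e_{t(a)}+\tfrac12a^*a\otimes e_{t(a)}+\tfrac12e_{h(a)}\otimes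 aa^*+\tfrac12o_{t(a)}(a,a^*)(a^*\otimes a-a\otimes a^*)\qquad(a\in Q),$$ $$\{\!\{b,c\}\!\}=-\tfrac12o_{t(b)}(b,c)\,b\otimes c-\tfrac12o_{h(b)}(b^*,c^*)\,c\otimes b+\tfrac12o_{t(b)}(b,c^*)\,cb\otimes e_{t(b)}+\tfrac12o_{h(b)}(b^*,c)\,e_{h(b)}\otimes bc$$ for $b,c\in\bar Q$ with $c\neq b,b^*$, and the element $\Phi=\sum_{s\in I}\Phi_s$, where $$\Phi_s=\prod^{\longrightarrow}_{a\in T_s}(e_s+aa^*)^{\epsilon(a)}$$ is the product in $e_sA_Qe_s$ in increasing order for $<_s$, with $\epsilon(a)=1$ if $a\in Q$ and $\epsilon(a)=-1$ if $a\in\bar Q\setminus Q$. **Theorem.** For every finite quiver $Q$ and every choice of orderings there is exactly one $B$-linear double bracket on $A_Q$ with these values, and $(A_Q,\{\!\{-,-\}\!\},\Phi)$ is a quasi-Hamiltonian algebra over $B$. Up to isomorphism of quasi-Hamiltonian algebras over $B$ it depends only on $Q$ seen as an undirected graph: if $Q_1$ and $Q_2$ are finite quivers with the same vertex set $I$, and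 if there is a bijection between their arrows that preserves the unordered pair of end points of every arrow, then for all choices of orderings for $Q_1$ and for $Q_2$ the quasi-Hamiltonian algebras $(A_{Q_1},\{\!\{-,-\}\!\}_1,\Phi_1)$ and $(A_{Q_2},\{\!\{-,-\}\!\}_2,\Phi_2)$ are isomorphic over $B$. -/

import Mathlib

open scoped TensorProduct

namespace VdB

noncomputable section

universe u v w z

/-! ### Quivers, their doubles, and the underlying undirected graph -/

/-- A quiver with vertex set `I` and arrow set `E`; the arrow `a` goes from its tail `t a`
to its head `h a`. -/
structure FinQuiver (I : Type u) (E : Type v) where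
  t : E → I
  h : E → I

namespace FinQuiver

variable {I : Type u} {E : Type v}

/-- The double quiver: `Sum.inl a` is the arrow `a`, and `Sum.inr a` is the opposite
arrow `a^* : h a ⟶ t a`. -/
def double (Q : FinQuiver I E) : FinQuiver I (E ⊕ E) where
  t := Sum.elim Q.t Q.h
  h := Sum.elim Q.h Q.t

/-- The unordered pair of end points of an arrow. -/
def ends (Q : FinQuiver I E) (a : E) : Sym2 I := s(Q.t a, Q.h a)

/-- Two quivers on the same vertex set have the same underlying undirected (multi)graph:
there is a bijection between their arrows which preserves unordered end points. -/
def SameGraph {E' : Type w} (Q : FinQuiver I E) (Q' : FinQuiver I E') : Prop :=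
  ∃ τ : E ≃ E', ∀ a : E, Q'.ends (τ a) = Q.ends a

/-- The set `T_s` of arrows of the double quiver with tail `s`. -/
abbrev T (Q : FinQuiver I E) (s : I) : Type v := {a : E ⊕ E // Q.double.t a = s}

/-- A choice of a total ordering `<_s` on `T_s` for each vertex `s`. -/
abbrev Ordering (Q : FinQuiver I E) : Type (max u v) := ∀ s : I, LinearOrder (Q.T s)

/-- The ordering function `o_s(a, b)`: it is `1` if `a <_s b`, `-1` if `b <_s a`, and `0`
otherwise (that is, if `a = b`, or if `a` or `b` does not have tail `s`). -/
def ordFun [DecidableEq I] (Q : FinQuiver I E) (o : Q.Ordering) (s : I) (a b : E ⊕ E) : ℤ :=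
  if hab : Q.double.t a = s ∧ Q.double.t b = s then
    letI := o s
    if (⟨a, hab.1⟩ : Q.T s) < ⟨b, hab.2⟩ then 1
    else if (⟨b, hab.2⟩ : Q.T s) < ⟨a, hab.1⟩ then -1
    else 0
  else 0

/-- The elements of `T_s`, listed increasingly for `<_s`. -/
def sortedT [DecidableEq I] [Fintype E] (Q : FinQuiver I E) (o : Q.Ordering) (s : I) :
    List (Q.T s) :=
  letI := o s
  (Finset.univ : Finset (Q.T s)).sort (· ≤ ·)

end FinQuiver

/-! ### Path algebras -/

section PathAlgebra

variable (k : Type z) [Field k] {I : Type u} {E : Type v} [Fintype I] [DecidableEq I]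

/-- Relations of the path algebra on the generators `e_s` (`s` a vertex) and `a` (an arrow).
Paths are read from left to right. -/
inductive PathRel (Q : FinQuiver I E) : FreeAlgebra k (I ⊕ E) → FreeAlgebra k (I ⊕ E) → Prop
  | idem (s : I) : PathRel Q
      (FreeAlgebra.ι k (Sum.inl s) * FreeAlgebra.ι k (Sum.inl s)) (FreeAlgebra.ι k (Sum.inl s))
  | orth (s s' : I) (hs : s ≠ s') : PathRel Q
      (FreeAlgebra.ι k (Sum.inl s) * FreeAlgebra.ι k (Sum.inl s')) 0
  | one : PathRel Q (∑ s : I, FreeAlgebra.ι k (Sum.inl s)) 1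
  | arrow (a : E) : PathRel Q
      (FreeAlgebra.ι k (Sum.inl (Q.t a)) * FreeAlgebra.ι k (Sum.inr a) *
        FreeAlgebra.ι k (Sum.inl (Q.h a)))
      (FreeAlgebra.ι k (Sum.inr a))

/-- The path algebra of a quiver with finitely many vertices. -/
def PathAlgebra (Q : FinQuiver I E) : Type _ := RingQuot (PathRel k Q)

instance (Q : FinQuiver I E) : Ring (PathAlgebra k Q) :=
  inferInstanceAs (Ring (RingQuot (PathRel k Q)))

instance (Q : FinQuiver I E) : Algebra k (PathAlgebra k Q) :=
  inferInstanceAs (Algebra k (RingQuot (PathRel k Q)))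

/-- The idempotent attached to the vertex `s`. -/
def PathAlgebra.idem (Q : FinQuiver I E) (s : I) : PathAlgebra k Q :=
  RingQuot.mkAlgHom k (PathRel k Q) (FreeAlgebra.ι k (Sum.inl s))

/-- The arrow `a`, as an element of the path algebra. -/
def PathAlgebra.arrow (Q : FinQuiver I E) (a : E) : PathAlgebra k Q :=
  RingQuot.mkAlgHom k (PathRel k Q) (FreeAlgebra.ι k (Sum.inr a))

end PathAlgebra

/-! ### Universal localisation -/

section UnivLoc

variable (k : Type z) [Field k] {R : Type u} [Ring R] [Algebra k R] {ι : Type v}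

/-- Relations which say that the generators indexed by `R` form a homomorphic image of the
`k`-algebra `R`, and that the generator indexed by `i : ι` is a two-sided inverse of the image
of `f i`. -/
inductive UnivLocRel (f : ι → R) : FreeAlgebra k (R ⊕ ι) → FreeAlgebra k (R ⊕ ι) → Prop
  | add (x y : R) : UnivLocRel f (FreeAlgebra.ι k (Sum.inl (x + y)))
      (FreeAlgebra.ι k (Sum.inl x) + FreeAlgebra.ι k (Sum.inl y))
  | mul (x y : R) : UnivLocRel f (FreeAlgebra.ι k (Sum.inl (x * y)))
      (FreeAlgebra.ι k (Sum.inl x) * FreeAlgebra.ι k (Sum.inl y))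
  | scalar (c : k) : UnivLocRel f (FreeAlgebra.ι k (Sum.inl (algebraMap k R c)))
      (algebraMap k _ c)
  | mul_inv (i : ι) : UnivLocRel f
      (FreeAlgebra.ι k (Sum.inl (f i)) * FreeAlgebra.ι k (Sum.inr i)) 1
  | inv_mul (i : ι) : UnivLocRel f
      (FreeAlgebra.ι k (Sum.inr i) * FreeAlgebra.ι k (Sum.inl (f i))) 1

/-- The universal localisation of the `k`-algebra `R` at the family `f` of its elements. -/
def UnivLoc (f : ι → R) : Type _ := RingQuot (UnivLocRel k f)

instance (f : ι → R) : Ring (UnivLoc k f) :=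
  inferInstanceAs (Ring (RingQuot (UnivLocRel k f)))

instance (f : ι → R) : Algebra k (UnivLoc k f) :=
  inferInstanceAs (Algebra k (RingQuot (UnivLocRel k f)))

/-- The canonical map from `R` to its localisation. -/
def UnivLoc.of (f : ι → R) (x : R) : UnivLoc k f :=
  RingQuot.mkAlgHom k (UnivLocRel k f) (FreeAlgebra.ι k (Sum.inl x))

/-- The inverse of `f i` in the localisation. -/
def UnivLoc.inv (f : ι → R) (i : ι) : UnivLoc k f :=
  RingQuot.mkAlgHom k (UnivLocRel k f) (FreeAlgebra.ι k (Sum.inr i))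

end UnivLoc

/-! ### Double brackets and quasi-Hamiltonian algebras

Here `A` is a `k`-algebra, `e` is a finite family of elements of `A` (orthogonal idempotents with
sum `1` in the applications), and `B` is the span of the `e s`. -/

section DoubleBracket

variable {k : Type z} [Field k] {A : Type u} [Ring A] [Algebra k A] {I : Type v}

/-- A double bracket: a `k`-bilinear map `A × A → A ⊗ A` with cyclic antisymmetry and the right
derivation rule for the outer bimodule structure `x d y = x d' ⊗ d'' y`, which is written
through the product of the algebra `A ⊗ A`. -/
structure IsDoubleBracket (br : A →ₗ[k] A →ₗ[k] A ⊗[k] A) : Prop where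
  antisymm : ∀ a b : A, br a b = - TensorProduct.comm k A A (br b a)
  deriv : ∀ a b c : A,
    br a (b * c) = br a b * ((1 : A) ⊗ₜ[k] c) + (b ⊗ₜ[k] (1 : A)) * br a c

/-- `B`-linearity: the bracket vanishes if one of its entries is in the span of the `e s`. -/
def IsBLinear (e : I → A) (br : A →ₗ[k] A →ₗ[k] A ⊗[k] A) : Prop :=
  ∀ (s : I) (a : A), br (e s) a = 0 ∧ br a (e s) = 0

/-- The cyclic permutation `a₁ ⊗ a₂ ⊗ a₃ ↦ a₃ ⊗ a₁ ⊗ a₂`. -/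
def tau : A ⊗[k] A ⊗[k] A →ₗ[k] A ⊗[k] A ⊗[k] A :=
  (TensorProduct.assoc k A A A).symm.toLinearMap ∘ₗ
    (TensorProduct.comm k (A ⊗[k] A) A).toLinearMap

/-- The triple bracket associated with a double bracket. The linear map
`(br a).rTensor A` sends `x ⊗ y` to `{{a, x}} ⊗ y`. -/
def tripleBracket (br : A →ₗ[k] A →ₗ[k] A ⊗[k] A) (a b c : A) : A ⊗[k] A ⊗[k] A :=
  (br a).rTensor A (br b c) + tau ((br b).rTensor A (br c a)) +
    tau (tau ((br c).rTensor A (br a b)))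

/-- A (`B`-linear) double quasi-Poisson bracket. -/
structure IsDoubleQuasiPoisson [Fintype I] (e : I → A)
    (br : A →ₗ[k] A →ₗ[k] A ⊗[k] A) : Prop where
  isDoubleBracket : IsDoubleBracket br
  isBLinear : IsBLinear e br
  triple : ∀ a b c : A, tripleBracket br a b c = (1 / 4 : k) • ∑ s : I,
    ((c * e s * a) ⊗ₜ[k] (e s * b) ⊗ₜ[k] (e s)
      - (c * e s * a) ⊗ₜ[k] (e s) ⊗ₜ[k] (b * e s)
      - (c * e s) ⊗ₜ[k] (a * e s * b) ⊗ₜ[k] (e s)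
      + (c * e s) ⊗ₜ[k] (a * e s) ⊗ₜ[k] (b * e s)
      - (e s * a) ⊗ₜ[k] (e s * b) ⊗ₜ[k] (e s * c)
      + (e s * a) ⊗ₜ[k] (e s) ⊗ₜ[k] (b * e s * c)
      + (e s) ⊗ₜ[k] (a * e s * b) ⊗ₜ[k] (e s * c)
      - (e s) ⊗ₜ[k] (a * e s) ⊗ₜ[k] (b * e s * c))

/-- The element `∑ s, Φ s` is a multiplicative moment map with components `Φ s ∈ e_s A e_s`. -/
structure IsMultMomentMap [Fintype I] (e : I → A)
    (br : A →ₗ[k] A →ₗ[k] A ⊗[k] A) (Φ : I → A) : Prop where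
  mem : ∀ s : I, e s * Φ s * e s = Φ s
  isUnit : IsUnit (∑ s : I, Φ s)
  mult : ∀ (s : I) (a : A), br (Φ s) a = (1 / 2 : k) •
    ((a * e s) ⊗ₜ[k] Φ s - e s ⊗ₜ[k] (Φ s * a) + (a * Φ s) ⊗ₜ[k] e s - Φ s ⊗ₜ[k] (e s * a))

/-- The triple `(A, br, ∑ s, Φ s)` is a quasi-Hamiltonian algebra over `B`. -/
structure IsQuasiHamiltonian [Fintype I] (e : I → A)
    (br : A →ₗ[k] A →ₗ[k] A ⊗[k] A) (Φ : I → A) : Prop where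
  quasiPoisson : IsDoubleQuasiPoisson e br
  moment : IsMultMomentMap e br Φ

end DoubleBracket

/-- Isomorphisms between two quasi-Hamiltonian algebras over `B`: isomorphisms of `B`-algebras
which preserve the double brackets and the multiplicative moment maps. -/
structure IsQHIso {k : Type z} [Field k] {I : Type v} [Fintype I]
    {A : Type u} [Ring A] [Algebra k A] {A' : Type w} [Ring A'] [Algebra k A']
    (e : I → A) (br : A →ₗ[k] A →ₗ[k] A ⊗[k] A) (Φ : I → A)
    (e' : I → A') (br' : A' →ₗ[k] A' →ₗ[k] A' ⊗[k] A') (Φ' : I → A')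
    (ψ : A ≃ₐ[k] A') : Prop where
  map_idem : ∀ s : I, ψ (e s) = e' s
  map_bracket : ∀ a b : A,
    br' (ψ a) (ψ b) = TensorProduct.map ψ.toLinearMap ψ.toLinearMap (br a b)
  map_moment : ψ (∑ s : I, Φ s) = ∑ s : I, Φ' s

/-! ### Van den Bergh's structure on the localised path algebra of a double quiver -/

section Quivers

variable (k : Type z) [Field k] {I : Type u} {E : Type v} [Fintype I] [DecidableEq I]

/-- The elements `1 + a a^*` of the path algebra of the double quiver. -/
def locFamily (Q : FinQuiver I E) (a : E ⊕ E) : PathAlgebra k Q.double :=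
  1 + PathAlgebra.arrow k Q.double a * PathAlgebra.arrow k Q.double a.swap

/-- The algebra `A_Q`: the universal localisation of the path algebra of the double quiver at the
elements `1 + a a^*`, for all arrows `a` of the double quiver. -/
abbrev AQ (Q : FinQuiver I E) : Type _ := UnivLoc k (locFamily k Q)

/-- The idempotent `e_s` in `A_Q`. -/
def idem (Q : FinQuiver I E) (s : I) : AQ k Q :=
  UnivLoc.of k (locFamily k Q) (PathAlgebra.idem k Q.double s)

/-- The arrow `a` of the double quiver in `A_Q`; the arrow `a^*` is `arr k Q a.swap`. -/
def arr (Q : FinQuiver I E) (a : E ⊕ E) : AQ k Q :=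
  UnivLoc.of k (locFamily k Q) (PathAlgebra.arrow k Q.double a)

/-- The factor `(e_s + a a^*)^{ε(a)}` of `Φ_s`, where `ε(a) = 1` for an arrow of `Q` and
`ε(a) = -1` for an arrow `a^*`. The inverse is the one in the algebra `e_s A_Q e_s`, which is
`e_s (1 + a a^*)⁻¹ e_s`. -/
def momentFactor (Q : FinQuiver I E) (s : I) : E ⊕ E → AQ k Q
  | Sum.inl a => idem k Q s + arr k Q (Sum.inl a) * arr k Q (Sum.inr a)
  | Sum.inr a => idem k Q s * UnivLoc.inv k (locFamily k Q) (Sum.inr a) * idem k Q s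

/-- `Φ_s`, the increasing product over `T_s` of the factors `(e_s + a a^*)^{ε(a)}`, taken in the
algebra `e_s A_Q e_s` with unit `e_s`. -/
def momentMap [Fintype E] (Q : FinQuiver I E) (o : Q.Ordering) (s : I) : AQ k Q :=
  idem k Q s * ((Q.sortedT o s).map fun a => momentFactor k Q s a.1).prod

/-- `br` is Van den Bergh's bracket: the `B`-linear double bracket on `A_Q` with the given values
on the arrows of the double quiver. -/
structure IsVdBBracket (Q : FinQuiver I E) (o : Q.Ordering)
    (br : AQ k Q →ₗ[k] AQ k Q →ₗ[k] AQ k Q ⊗[k] AQ k Q) : Prop where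
  isDoubleBracket : IsDoubleBracket br
  isBLinear : IsBLinear (idem k Q) br
  self : ∀ a : E ⊕ E, br (arr k Q a) (arr k Q a) =
    ((1 / 2 : k) * (Q.ordFun o (Q.double.t a) a a.swap : k)) •
      ((arr k Q a * arr k Q a) ⊗ₜ[k] idem k Q (Q.double.t a)
        - idem k Q (Q.double.h a) ⊗ₜ[k] (arr k Q a * arr k Q a))
  star : ∀ a : E, br (arr k Q (Sum.inl a)) (arr k Q (Sum.inr a)) =
    idem k Q (Q.h a) ⊗ₜ[k] idem k Q (Q.t a)
      + (1 / 2 : k) •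
        ((arr k Q (Sum.inr a) * arr k Q (Sum.inl a)) ⊗ₜ[k] idem k Q (Q.t a))
      + (1 / 2 : k) •
        (idem k Q (Q.h a) ⊗ₜ[k] (arr k Q (Sum.inl a) * arr k Q (Sum.inr a)))
      + ((1 / 2 : k) * (Q.ordFun o (Q.t a) (Sum.inl a) (Sum.inr a) : k)) •
        (arr k Q (Sum.inr a) ⊗ₜ[k] arr k Q (Sum.inl a)
          - arr k Q (Sum.inl a) ⊗ₜ[k] arr k Q (Sum.inr a))
  other : ∀ b c : E ⊕ E, c ≠ b → c ≠ b.swap → br (arr k Q b) (arr k Q c) =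
    - (((1 / 2 : k) * (Q.ordFun o (Q.double.t b) b c : k)) • (arr k Q b ⊗ₜ[k] arr k Q c))
      - ((1 / 2 : k) * (Q.ordFun o (Q.double.h b) b.swap c.swap : k)) •
        (arr k Q c ⊗ₜ[k] arr k Q b)
      + ((1 / 2 : k) * (Q.ordFun o (Q.double.t b) b c.swap : k)) •
        ((arr k Q c * arr k Q b) ⊗ₜ[k] idem k Q (Q.double.t b))
      + ((1 / 2 : k) * (Q.ordFun o (Q.double.h b) b.swap c : k)) •
        (idem k Q (Q.double.h b) ⊗ₜ[k] (arr k Q b * arr k Q c))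

end Quivers

end

end VdB

open scoped TensorProduct

namespace VdB

noncomputable section

universe u v w z

set_option linter.unusedSimpArgs false

/-! Every arrow `p` of the double quiver is regarded as a half-edge attached to the vertex t(p). All
of Van den Bergh's values are instances of one formula, `arrowBracket`: {{c, b}} = (b ⊗ 1) G(c, b*)
- G(c, b) (1 ⊗ b), plus η(c) times `pairTerm` when b = c*. The gauge term G(c, p) is linear in a
skew form O that compares half-edges. Thus the orderings enter only through O and the orientation
only through the sign η, and the two can be varied independently.

Existence and uniqueness. A derivation of A_Q is the upper right corner of an algebra map into
triangular 2 × 2 matrices, so by the universal property of A_Q it is determined by its values on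
arrows, which are arbitrary up to compatibility with the idempotents (`exists_isDer`). A double
bracket is a derivation in each argument.

Quasi-Poisson property. Both sides are derivations in the last argument and are compatible with
cyclic rotation, so arrows suffice. Write the bracket as U + V, with U the part given by O and V the
part given by η. The triple bracket is quadratic and its cross terms vanish (`mixedTriple_eq_zero`).
In the triple bracket of U each of the eight terms of the right-hand side carries a coefficient
O(p,q)O(q,r) + O(q,r)O(r,p) + O(r,p)O(p,q), which is -1 for elements p, q, r of a total order that
are not all equal. The exceptional terms p = q = r are exactly what V contributes
(`tripleBracket_form`, `tripleBracket_pair`).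

Moment map. The bracket of an arrow c with one factor (1 + pp*)^ε(p) is a gauge term for the cut of
the ordering just after p, minus one for the cut just before p (`OrderDatum.bracket_factor`). Along
the ordered product these telescope, leaving the two extreme cuts.

Independence. With signs detached from the orientation, a structure on A_Q is given by an
`OrderDatum`: signs, and a list of half-edges at each vertex. Three moves yield isomorphisms.
Relabelling along a bijection of half-edges that respects * and tails covers reversal of arrows. The
map a ↦ -(1 + aa*)⁻¹a, a* ↦ a* reverses the signs of a and a*. Consecutive half-edges b, a with a ≠
b* are exchanged by b ↦ Xb, b* ↦ b*X⁻¹, where X is the factor of a; if a = b*, a relabelling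
followed by a change of signs does it. Adjacent transpositions generate all permutations, so any two
data are equivalent. -/

theorem FinQuiver.double_h {I : Type u} {E : Type v} (Q : FinQuiver I E) (p : E ⊕ E) :
    Q.double.h p = Q.double.t p.swap := by
  cases p <;> rfl

/-! ### The algebra `A_Q`: relations, universal property, induction -/

section Algebra

variable {k : Type z} [Field k] {I : Type u} {E : Type v} [Fintype I]
variable {Q : FinQuiver I E}

/-- The quotient map from the free algebra to the path algebra. -/
def pathMk (Q : FinQuiver I E) : FreeAlgebra k (I ⊕ E) →ₐ[k] PathAlgebra k Q :=
  RingQuot.mkAlgHom k (PathRel k Q)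

theorem pathMk_rel {x y : FreeAlgebra k (I ⊕ (E ⊕ E))} (h : PathRel k Q.double x y) :
    pathMk Q.double x = pathMk Q.double y :=
  RingQuot.mkAlgHom_rel k h

/-- The canonical algebra map from the path algebra of the double quiver to `A_Q`. -/
def ofPath (Q : FinQuiver I E) : PathAlgebra k Q.double →ₐ[k] AQ k Q where
  toFun := UnivLoc.of k (locFamily k Q)
  map_one' := by
    have := RingQuot.mkAlgHom_rel k (UnivLocRel.scalar (f := locFamily k Q) (1 : k))
    rw [map_one, map_one, map_one] at this
    exact this
  map_mul' x y := by
    have := RingQuot.mkAlgHom_rel k (UnivLocRel.mul (k := k) (f := locFamily k Q) x y)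
    rw [map_mul] at this
    exact this
  map_zero' := by
    have := RingQuot.mkAlgHom_rel k (UnivLocRel.scalar (f := locFamily k Q) (0 : k))
    rw [map_zero, map_zero, map_zero] at this
    exact this
  map_add' x y := by
    have := RingQuot.mkAlgHom_rel k (UnivLocRel.add (k := k) (f := locFamily k Q) x y)
    rw [map_add] at this
    exact this
  commutes' c := by
    have := RingQuot.mkAlgHom_rel k (UnivLocRel.scalar (f := locFamily k Q) c)
    rw [AlgHom.commutes] at this
    exact this

/-- The map from the free algebra on vertices and arrows to `A_Q`. -/
def freeMk (Q : FinQuiver I E) : FreeAlgebra k (I ⊕ (E ⊕ E)) →ₐ[k] AQ k Q :=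
  (ofPath Q).comp (pathMk Q.double)

theorem freeMk_rel {x y : FreeAlgebra k (I ⊕ (E ⊕ E))} (h : PathRel k Q.double x y) :
    freeMk Q x = freeMk Q y :=
  congrArg (ofPath Q) (pathMk_rel h)

theorem freeMk_inl (s : I) : freeMk Q (FreeAlgebra.ι k (Sum.inl s)) = idem k Q s := rfl

theorem freeMk_inr (p : E ⊕ E) : freeMk Q (FreeAlgebra.ι k (Sum.inr p)) = arr k Q p := rfl

theorem idem_mul_self (s : I) : idem k Q s * idem k Q s = idem k Q s := by
  simpa only [map_mul, freeMk_inl] using freeMk_rel (PathRel.idem (k := k) (Q := Q.double) s)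

theorem idem_mul_of_ne {s s' : I} (hs : s ≠ s') : idem k Q s * idem k Q s' = 0 := by
  simpa only [map_mul, map_zero, freeMk_inl] using
    freeMk_rel (PathRel.orth (k := k) (Q := Q.double) s s' hs)

variable (k Q) in
theorem sum_idem : ∑ s : I, idem k Q s = 1 := by
  simpa only [map_sum, map_one, freeMk_inl] using
    freeMk_rel (PathRel.one (k := k) (Q := Q.double))

theorem idem_arr_idem (p : E ⊕ E) :
    idem k Q (Q.double.t p) * arr k Q p * idem k Q (Q.double.t p.swap) = arr k Q p := by
  simpa only [map_mul, freeMk_inl, freeMk_inr, FinQuiver.double_h] using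
    freeMk_rel (PathRel.arrow (k := k) (Q := Q.double) p)

theorem idem_mul_arr (p : E ⊕ E) : idem k Q (Q.double.t p) * arr k Q p = arr k Q p := by
  rw [← idem_arr_idem, ← mul_assoc, ← mul_assoc, idem_mul_self]

theorem arr_mul_idem (p : E ⊕ E) : arr k Q p * idem k Q (Q.double.t p.swap) = arr k Q p := by
  rw [← idem_arr_idem, mul_assoc, idem_mul_self]

theorem arr_swap_mul_idem (p : E ⊕ E) :
    arr k Q p.swap * idem k Q (Q.double.t p) = arr k Q p.swap := by
  simpa using arr_mul_idem (k := k) (Q := Q) p.swap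

theorem idem_mul_arr_of_ne {s : I} {p : E ⊕ E} (h : s ≠ Q.double.t p) :
    idem k Q s * arr k Q p = 0 := by
  rw [← idem_mul_arr, ← mul_assoc, idem_mul_of_ne h, zero_mul]

theorem arr_mul_idem_of_ne {s : I} {p : E ⊕ E} (h : s ≠ Q.double.t p.swap) :
    arr k Q p * idem k Q s = 0 := by
  rw [← arr_mul_idem, mul_assoc, idem_mul_of_ne h.symm, mul_zero]

/-- The invertible element `1 + a a^*` of `A_Q`. -/
def zUnit (k : Type z) [Field k] (Q : FinQuiver I E) (p : E ⊕ E) : (AQ k Q)ˣ where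
  val := 1 + arr k Q p * arr k Q p.swap
  inv := UnivLoc.inv k (locFamily k Q) p
  val_inv := by
    have h := RingQuot.mkAlgHom_rel k (UnivLocRel.mul_inv (k := k) (f := locFamily k Q) p)
    rw [map_mul, map_one] at h
    refine Eq.trans ?_ h
    congr 1
    have : (ofPath Q) (locFamily k Q p) = 1 + arr k Q p * arr k Q p.swap := by
      rw [locFamily, map_add, map_one, map_mul]
      rfl
    exact this.symm
  inv_val := by
    have h := RingQuot.mkAlgHom_rel k (UnivLocRel.inv_mul (k := k) (f := locFamily k Q) p)
    rw [map_mul, map_one] at h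
    refine Eq.trans ?_ h
    congr 1
    have : (ofPath Q) (locFamily k Q p) = 1 + arr k Q p * arr k Q p.swap := by
      rw [locFamily, map_add, map_one, map_mul]
      rfl
    exact this.symm

theorem coe_zUnit (p : E ⊕ E) :
    ((zUnit k Q p : (AQ k Q)ˣ) : AQ k Q) = 1 + arr k Q p * arr k Q p.swap := rfl

/-- The formal inverses in the localisation are inverses of elements already generated by
idempotents and arrows. The hypothesis `inv` therefore only has to pass from an element to its
two-sided inverse, which is automatic for identities between algebra maps or derivations. -/
theorem AQ.induction {P : AQ k Q → Prop} (algebraMap : ∀ c : k, P (algebraMap k _ c))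
    (idem : ∀ s, P (idem k Q s)) (arr : ∀ p, P (arr k Q p))
    (add : ∀ a b, P a → P b → P (a + b)) (mul : ∀ a b, P a → P b → P (a * b))
    (inv : ∀ a b, a * b = 1 → b * a = 1 → P a → P b) (a : AQ k Q) : P a := by
  obtain ⟨a, rfl⟩ := RingQuot.mkAlgHom_surjective k (UnivLocRel k (locFamily k Q)) a
  have hfree : ∀ x, P (freeMk Q x) := by
    intro x
    induction x using FreeAlgebra.induction with
    | grade0 r =>
      rw [AlgHom.commutes]
      exact algebraMap r
    | grade1 x =>
      rcases x with s | p
      · exact idem s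
      · exact arr p
    | mul a b ha hb =>
      rw [map_mul]
      exact mul _ _ ha hb
    | add a b ha hb =>
      rw [map_add]
      exact add _ _ ha hb
  have hof : ∀ x : PathAlgebra k Q.double, P (ofPath Q x) := by
    intro x
    obtain ⟨x, rfl⟩ := RingQuot.mkAlgHom_surjective k (PathRel k Q.double) x
    exact hfree x
  induction a using FreeAlgebra.induction with
  | grade0 r =>
    have := algebraMap r
    rwa [AlgHom.commutes]
  | grade1 x =>
    rcases x with x | p
    · exact hof x
    · refine inv (zUnit k Q p : (AQ k Q)ˣ) _ (zUnit k Q p).mul_inv (zUnit k Q p).inv_mul ?_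
      have h1 := algebraMap 1
      rw [map_one] at h1
      exact add _ _ h1 (mul _ _ (arr p) (arr _))
  | mul a b ha hb =>
    rw [map_mul]
    exact mul _ _ ha hb
  | add a b ha hb =>
    rw [map_add]
    exact add _ _ ha hb

theorem AQ.exists_lift {C : Type w} [Ring C] [Algebra k C] (e : I → C) (x : E ⊕ E → C)
    (idem : ∀ s, e s * e s = e s) (orth : ∀ s s', s ≠ s' → e s * e s' = 0)
    (one : ∑ s, e s = 1) (arrow : ∀ p, e (Q.double.t p) * x p * e (Q.double.t p.swap) = x p)
    (unit : ∀ p, IsUnit (1 + x p * x p.swap)) :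
    ∃ f : AQ k Q →ₐ[k] C, (∀ s, f (VdB.idem k Q s) = e s) ∧ ∀ p, f (arr k Q p) = x p := by
  let g₀ : FreeAlgebra k (I ⊕ (E ⊕ E)) →ₐ[k] C := FreeAlgebra.lift k (Sum.elim e x)
  have hg₀ : ∀ ⦃y z⦄, PathRel k Q.double y z → g₀ y = g₀ z := by
    intro y z h
    cases h with
    | idem s => simpa [g₀] using idem s
    | orth s s' h => simpa [g₀] using orth s s' h
    | one => simpa [g₀] using one
    | arrow p => simpa [g₀, FinQuiver.double_h] using arrow p
  let g : PathAlgebra k Q.double →ₐ[k] C := RingQuot.liftAlgHom k ⟨g₀, hg₀⟩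
  have hgs : ∀ s, g (PathAlgebra.idem k Q.double s) = e s := fun s => by
    refine (RingQuot.liftAlgHom_mkAlgHom_apply k g₀ hg₀ _).trans ?_
    simp [g₀]
  have hgp : ∀ p, g (PathAlgebra.arrow k Q.double p) = x p := fun p => by
    refine (RingQuot.liftAlgHom_mkAlgHom_apply k g₀ hg₀ _).trans ?_
    simp [g₀]
  choose v hv using unit
  have hloc : ∀ p, g (locFamily k Q p) = v p := fun p => by
    rw [locFamily, map_add, map_one, map_mul, hgp, hgp, hv]
  let f₀ : FreeAlgebra k (PathAlgebra k Q.double ⊕ (E ⊕ E)) →ₐ[k] C :=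
    FreeAlgebra.lift k (Sum.elim g fun p => ((v p)⁻¹ : Cˣ))
  have hf₀ : ∀ ⦃y z⦄, UnivLocRel k (locFamily k Q) y z → f₀ y = f₀ z := by
    intro y z h
    cases h with
    | add x y => simp [f₀]
    | mul x y => simp [f₀]
    | scalar c => simp [f₀]
    | mul_inv p => simp [f₀, hloc]
    | inv_mul p => simp [f₀, hloc]
  refine ⟨RingQuot.liftAlgHom k ⟨f₀, hf₀⟩, fun s => ?_, fun p => ?_⟩
  · refine (RingQuot.liftAlgHom_mkAlgHom_apply k f₀ hf₀ _).trans ?_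
    simp [f₀, hgs]
  · refine (RingQuot.liftAlgHom_mkAlgHom_apply k f₀ hf₀ _).trans ?_
    simp [f₀, hgp]

theorem AQ.algHom_ext {C : Type w} [Ring C] [Algebra k C] {f g : AQ k Q →ₐ[k] C}
    (idem : ∀ s, f (idem k Q s) = g (VdB.idem k Q s))
    (arr : ∀ p, f (arr k Q p) = g (VdB.arr k Q p)) : f = g := by
  ext a
  induction a using AQ.induction with
  | algebraMap c => simp
  | idem s => exact idem s
  | arr p => exact arr p
  | add a b ha hb => simp [ha, hb]
  | mul a b ha hb => simp [ha, hb]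
  | inv a b hab hba ha =>
    calc f b = f b * (g a * g b) := by rw [← map_mul, hab, map_one, mul_one]
      _ = g b := by rw [← ha, ← mul_assoc, ← map_mul, hba, map_one, one_mul]

end Algebra

/-! ### Derivations into an algebra which is a bimodule through two algebra maps -/

section Derivations

variable {k : Type z} [Field k]

/-- `d` is a derivation for the bimodule structure on `M` with left action through `l` and right
action through `r`. -/
def IsDer {A : Type u} [Ring A] [Algebra k A] {M : Type v} [Ring M] [Algebra k M]
    (l r : A →ₐ[k] M) (d : A →ₗ[k] M) : Prop :=
  ∀ a b, d (a * b) = d a * r b + l a * d b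

namespace IsDer

variable {A : Type u} [Ring A] [Algebra k A] {M : Type v} [Ring M] [Algebra k M]
variable {l r : A →ₐ[k] M} {d d' : A →ₗ[k] M}

theorem map_one (h : IsDer l r d) : d 1 = 0 := by
  have := h 1 1
  simpa using this

theorem map_inv (h : IsDer l r d) {a b : A} (hab : a * b = 1) (hba : b * a = 1) :
    d b = -(l b * d a * r b) := by
  have h1 := h a b
  rw [hab, h.map_one] at h1
  have h2 : l b * (l a * d b) = d b := by rw [← mul_assoc, ← map_mul, hba, _root_.map_one, one_mul]
  rw [← h2, ← neg_eq_of_add_eq_zero_right h1.symm, mul_neg, mul_assoc]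

theorem map_algebraMap (h : IsDer l r d) (c : k) : d (algebraMap k A c) = 0 := by
  rw [Algebra.algebraMap_eq_smul_one, map_smul, h.map_one, smul_zero]

theorem sub (h : IsDer l r d) (h' : IsDer l r d') : IsDer l r (d - d') := fun a b => by
  simp only [LinearMap.sub_apply, h a b, h' a b]
  noncomm_ring

theorem add (h : IsDer l r d) (h' : IsDer l r d') : IsDer l r (d + d') := fun a b => by
  simp only [LinearMap.add_apply, h a b, h' a b]
  noncomm_ring

end IsDer

variable {I : Type u} {E : Type v} [Fintype I] {Q : FinQuiver I E}
variable {M : Type w} [Ring M] [Algebra k M] {l r : AQ k Q →ₐ[k] M}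

theorem IsDer.eq_zero {d : AQ k Q →ₗ[k] M} (h : IsDer l r d)
    (hs : ∀ s, d (idem k Q s) = 0) (hp : ∀ p, d (arr k Q p) = 0) (a : AQ k Q) : d a = 0 := by
  induction a using AQ.induction with
  | algebraMap c => exact h.map_algebraMap c
  | idem s => exact hs s
  | arr p => exact hp p
  | add a b ha hb => rw [map_add, ha, hb, add_zero]
  | mul a b ha hb => rw [h, ha, hb, zero_mul, mul_zero, add_zero]
  | inv a b hab hba ha => rw [h.map_inv hab hba, ha, mul_zero, zero_mul, neg_zero]

theorem IsDer.ext {d d' : AQ k Q →ₗ[k] M} (h : IsDer l r d) (h' : IsDer l r d')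
    (hs : ∀ s, d (idem k Q s) = d' (idem k Q s)) (hp : ∀ p, d (arr k Q p) = d' (arr k Q p))
    (a : AQ k Q) : d a = d' a := by
  have := (h.sub h').eq_zero (fun s => by simp [hs]) (fun p => by simp [hp]) a
  simpa [sub_eq_zero] using this

variable (l r) in
-- The map a ↦ (l a, d a; 0, r a) into 2 × 2 matrices is multiplicative exactly when d is a
-- derivation, so d is the corner of a lift of A_Q.
theorem exists_isDer (v : E ⊕ E → M)
    (hv : ∀ p, l (idem k Q (Q.double.t p)) * v p * r (idem k Q (Q.double.t p.swap)) = v p) :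
    ∃ d : AQ k Q →ₗ[k] M, IsDer l r d ∧ (∀ s, d (idem k Q s) = 0) ∧
      ∀ p, d (arr k Q p) = v p := by
  obtain ⟨f, hfs, hfp⟩ := AQ.exists_lift (k := k) (Q := Q) (C := Matrix (Fin 2) (Fin 2) M)
    (fun s => !![l (idem k Q s), 0; 0, r (idem k Q s)])
    (fun p => !![l (arr k Q p), v p; 0, r (arr k Q p)])
    (fun s => by simp [← map_mul, idem_mul_self])
    (fun s s' h => by
      simp only [Matrix.mul_fin_two, ← map_mul, idem_mul_of_ne h]
      ext i j; fin_cases i <;> fin_cases j <;> simp)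
    (by
      have hl : ∑ s, l (idem k Q s) = 1 := by rw [← map_sum, sum_idem, map_one]
      have hr : ∑ s, r (idem k Q s) = 1 := by rw [← map_sum, sum_idem, map_one]
      ext i j
      rw [Matrix.sum_apply]
      fin_cases i <;> fin_cases j <;> simp [hl, hr])
    (fun p => by
      simp only [Matrix.mul_fin_two, zero_mul, mul_zero, add_zero, zero_add, hv,
        ← map_mul, idem_arr_idem])
    (fun p => by
      have hl : l (1 + arr k Q p * arr k Q p.swap) = 1 + l (arr k Q p) * l (arr k Q p.swap) := by
        simp
      have hr : r (1 + arr k Q p * arr k Q p.swap) = 1 + r (arr k Q p) * r (arr k Q p.swap) := by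
        simp
      set z := zUnit k Q p
      set L := Units.map (l : AQ k Q →* M) z with hL
      set R := Units.map (r : AQ k Q →* M) z with hR
      set m := l (arr k Q p) * v p.swap + v p * r (arr k Q p.swap) with hm
      have key : (1 : Matrix (Fin 2) (Fin 2) M) + !![l (arr k Q p), v p; 0, r (arr k Q p)] *
          !![l (arr k Q p.swap), v p.swap; 0, r (arr k Q p.swap)] = !![(L : M), m; 0, (R : M)] := by
        rw [Matrix.one_fin_two, Matrix.mul_fin_two]
        simp [hL, hR, z, hm, coe_zUnit]
      rw [key]
      -- A triangular matrix with invertible diagonal entries L, R and corner m has the triangular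
      -- inverse with corner -L⁻¹ m R⁻¹.
      refine isUnit_iff_exists.2 ⟨!![((L⁻¹ : Mˣ) : M), -((L⁻¹ : Mˣ) * m * (R⁻¹ : Mˣ)); 0,
        ((R⁻¹ : Mˣ) : M)], ?_, ?_⟩
      · rw [Matrix.mul_fin_two, Matrix.one_fin_two]
        simp [← mul_assoc]
      · rw [Matrix.mul_fin_two, Matrix.one_fin_two]
        simp [mul_assoc])
  -- The lift stays triangular with the prescribed diagonal; the entries of an inverse are recovered
  -- from f a * f b = 1.
  have hf : ∀ a, f a 0 0 = l a ∧ f a 1 1 = r a ∧ f a 1 0 = 0 := by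
    intro a
    induction a using AQ.induction with
    | algebraMap c =>
      simp [AlgHom.commutes, Matrix.algebraMap_matrix_apply]
    | idem s => simp [hfs]
    | arr p => simp [hfp]
    | add a b ha hb => simp [ha, hb]
    | mul a b ha hb => simp [Matrix.mul_apply, ha, hb]
    | inv a b hab hba ha =>
      have hl : l b * l a = 1 := by rw [← map_mul, hba, map_one]
      have hr : r b * r a = 1 := by rw [← map_mul, hba, map_one]
      have hl' : l a * l b = 1 := by rw [← map_mul, hab, map_one]
      have hr' : r a * r b = 1 := by rw [← map_mul, hab, map_one]
      have h1 : f a * f b = 1 := by rw [← map_mul, hab, map_one]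
      have h2 : f b * f a = 1 := by rw [← map_mul, hba, map_one]
      have h10 : f b 1 0 = 0 := by
        have := congrFun (congrFun h1 1) 0
        simp only [Matrix.mul_apply, Fin.sum_univ_two, ha, zero_mul, zero_add] at this
        have := congrArg (r b * ·) this
        simpa [← mul_assoc, hr] using this
      refine ⟨?_, ?_, h10⟩
      · have := congrFun (congrFun h1 0) 0
        simp only [Matrix.mul_apply, Fin.sum_univ_two, ha, h10, mul_zero, add_zero,
          Matrix.one_apply_eq] at this
        have := congrArg (l b * ·) this
        simpa [← mul_assoc, hl] using this
      · have := congrFun (congrFun h1 1) 1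
        simp only [Matrix.mul_apply, Fin.sum_univ_two, ha, zero_mul, zero_add,
          Matrix.one_apply_eq] at this
        have := congrArg (r b * ·) this
        simpa [← mul_assoc, hr] using this
  refine ⟨⟨⟨fun a => f a 0 1, fun a b => by simp⟩, fun c a => by simp⟩, fun a b => ?_, fun s => ?_,
    fun p => ?_⟩
  · simp [Matrix.mul_apply, hf, add_comm]
  · simp [hfs]
  · simp [hfp]

end Derivations

/-! ### Double brackets as derivations -/

section DoubleBracketDer

open Algebra.TensorProduct (includeLeft includeRight)

variable {k : Type z} [Field k] {A : Type u} [Ring A] [Algebra k A]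
variable {br : A →ₗ[k] A →ₗ[k] A ⊗[k] A}

theorem comm_mul (x y : A ⊗[k] A) : TensorProduct.comm k A A (x * y) =
    TensorProduct.comm k A A x * TensorProduct.comm k A A y :=
  map_mul (Algebra.TensorProduct.comm k A A) x y

theorem comm_comm (x : A ⊗[k] A) : TensorProduct.comm k A A (TensorProduct.comm k A A x) = x :=
  (TensorProduct.comm k A A).left_inv x

namespace IsDoubleBracket

theorem isDer_right (h : IsDoubleBracket br) (a : A) :
    IsDer (includeLeft : A →ₐ[k] A ⊗[k] A) includeRight (br a) := fun b c => by
  simpa using h.deriv a b c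

/-- Antisymmetry exchanges the arguments together with the tensor factors, which turns the outer
bimodule structure into the inner one. -/
theorem isDer_left (h : IsDoubleBracket br) (b : A) :
    IsDer (includeRight : A →ₐ[k] A ⊗[k] A) includeLeft (br.flip b) := fun a c => by
  simp only [LinearMap.flip_apply, Algebra.TensorProduct.includeLeft_apply,
    Algebra.TensorProduct.includeRight_apply]
  rw [h.antisymm, h.deriv, h.antisymm a b, h.antisymm c b, map_add, comm_mul, comm_mul]
  simp only [TensorProduct.comm_tmul]
  noncomm_ring

end IsDoubleBracket

end DoubleBracketDer

/-! ### Existence and uniqueness of double brackets with given values on arrows -/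

section Existence

open Algebra.TensorProduct (includeLeft includeRight)

variable {k : Type z} [Field k] {I : Type u} {E : Type v} [Fintype I] {Q : FinQuiver I E}

/-- Two double brackets which agree on the generators are equal. -/
theorem IsDoubleBracket.ext {br br' : AQ k Q →ₗ[k] AQ k Q →ₗ[k] AQ k Q ⊗[k] AQ k Q}
    (h : IsDoubleBracket br) (h' : IsDoubleBracket br') (hB : IsBLinear (idem k Q) br)
    (hB' : IsBLinear (idem k Q) br')
    (hp : ∀ p q, br (arr k Q p) (arr k Q q) = br' (arr k Q p) (arr k Q q)) : br = br' := by
  refine LinearMap.ext fun a => LinearMap.ext fun b => ?_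
  refine (h.isDer_left b).ext (h'.isDer_left b) (fun s => ?_) (fun p => ?_) a
  · simp [(hB s b).1, (hB' s b).1]
  · simp only [LinearMap.flip_apply]
    refine (h.isDer_right _).ext (h'.isDer_right _) (fun s => ?_) (fun q => hp p q) b
    simp [(hB s _).2, (hB' s _).2]

/-- A double bracket on `A_Q` exists for any admissible values on the arrows. -/
theorem exists_isDoubleBracket (v : E ⊕ E → E ⊕ E → AQ k Q ⊗[k] AQ k Q)
    (houter : ∀ p q, (idem k Q (Q.double.t q) ⊗ₜ[k] (1 : AQ k Q)) * v p q *
      ((1 : AQ k Q) ⊗ₜ[k] idem k Q (Q.double.t q.swap)) = v p q)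
    (hinner : ∀ p q, ((1 : AQ k Q) ⊗ₜ[k] idem k Q (Q.double.t p)) * v p q *
      (idem k Q (Q.double.t p.swap) ⊗ₜ[k] (1 : AQ k Q)) = v p q)
    (hanti : ∀ p q, v p q = -TensorProduct.comm k _ _ (v q p)) :
    ∃ br : AQ k Q →ₗ[k] AQ k Q →ₗ[k] AQ k Q ⊗[k] AQ k Q,
      IsDoubleBracket br ∧ IsBLinear (idem k Q) br ∧
      ∀ p q, br (arr k Q p) (arr k Q q) = v p q := by
  -- First extension: an arrow stays in the first argument and the second argument becomes
  -- arbitrary.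
  have hD : ∀ p, ∃ d : AQ k Q →ₗ[k] AQ k Q ⊗[k] AQ k Q,
      IsDer (includeLeft : AQ k Q →ₐ[k] AQ k Q ⊗[k] AQ k Q) includeRight d ∧
      (∀ s, d (idem k Q s) = 0) ∧ ∀ q, d (arr k Q q) = v p q :=
    fun p => exists_isDer _ _ (v p) (fun q => by simpa using houter p q)
  choose D hD hDs hDp using hD
  -- The second extension needs the idempotent condition for D p y with y arbitrary. The inner and
  -- outer actions commute, so cutting D p by idempotents from inside gives again an outer
  -- derivation, equal to D p because it is so on arrows.
  have hinner' : ∀ p y, ((1 : AQ k Q) ⊗ₜ[k] idem k Q (Q.double.t p)) * D p y *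
      (idem k Q (Q.double.t p.swap) ⊗ₜ[k] (1 : AQ k Q)) = D p y := by
    intro p y
    let m : AQ k Q →ₗ[k] AQ k Q ⊗[k] AQ k Q :=
      (LinearMap.mulRight k (idem k Q (Q.double.t p.swap) ⊗ₜ[k] (1 : AQ k Q))) ∘ₗ
      (LinearMap.mulLeft k ((1 : AQ k Q) ⊗ₜ[k] idem k Q (Q.double.t p))) ∘ₗ D p
    have hm : ∀ y, m y = ((1 : AQ k Q) ⊗ₜ[k] idem k Q (Q.double.t p)) * D p y *
      (idem k Q (Q.double.t p.swap) ⊗ₜ[k] (1 : AQ k Q)) := fun y => by simp [m]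
    have hm' : IsDer (includeLeft : AQ k Q →ₐ[k] AQ k Q ⊗[k] AQ k Q) includeRight m := by
      intro a b
      simp only [hm, hD p a b, Algebra.TensorProduct.includeLeft_apply,
        Algebra.TensorProduct.includeRight_apply]
      have h1 : ((1 : AQ k Q) ⊗ₜ[k] b) * (idem k Q (Q.double.t p.swap) ⊗ₜ[k] (1 : AQ k Q)) =
        (idem k Q (Q.double.t p.swap) ⊗ₜ[k] (1 : AQ k Q)) * ((1 : AQ k Q) ⊗ₜ[k] b) := by simp
      have h2 : ((1 : AQ k Q) ⊗ₜ[k] idem k Q (Q.double.t p)) * (a ⊗ₜ[k] (1 : AQ k Q)) =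
        (a ⊗ₜ[k] (1 : AQ k Q)) * ((1 : AQ k Q) ⊗ₜ[k] idem k Q (Q.double.t p)) := by simp
      simp only [mul_add, add_mul, mul_assoc, h1]
      rw [← mul_assoc _ (a ⊗ₜ[k] (1 : AQ k Q)), h2]
      simp only [mul_assoc]
    rw [← hm]
    refine hm'.ext (hD p) (fun s => by simp [hm, hDs]) (fun q => ?_) y
    rw [hm, hDp, hinner]
  -- Second extension, in the first argument. Linearity and the Leibniz rule in y then follow from
  -- uniqueness of derivations.
  have hF : ∀ y, ∃ d : AQ k Q →ₗ[k] AQ k Q ⊗[k] AQ k Q,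
      IsDer (includeRight : AQ k Q →ₐ[k] AQ k Q ⊗[k] AQ k Q) includeLeft d ∧
      (∀ s, d (idem k Q s) = 0) ∧ ∀ p, d (arr k Q p) = D p y :=
    fun y => exists_isDer _ _ (fun p => D p y) (fun p => by simpa using hinner' p y)
  choose F hF hFs hFp using hF
  let br : AQ k Q →ₗ[k] AQ k Q →ₗ[k] AQ k Q ⊗[k] AQ k Q :=
    LinearMap.mk₂ k (fun x y => F y x) (fun x x' y => by simp) (fun c x y => by simp)
      (fun x y y' => by
        have := (hF (y + y')).ext ((hF y).add (hF y')) (fun s => by simp [hFs])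
          (fun p => by simp [hFp]) x
        simpa using this)
      (fun c x y => by
        have hc : IsDer (includeRight : AQ k Q →ₐ[k] AQ k Q ⊗[k] AQ k Q) includeLeft (c • F y) :=
          fun a b => by simp [hF y a b]
        have := (hF (c • y)).ext hc (fun s => by simp [hFs]) (fun p => by simp [hFp]) x
        simpa using this)
  have hbr : ∀ x y, br x y = F y x := fun x y => rfl
  have hBl : ∀ s a, br (idem k Q s) a = 0 := fun s a => hFs a s
  have hpq : ∀ p y, br (arr k Q p) y = D p y := fun p y => hFp y p
  have hleft : ∀ a a' b, br (a * a') b = br a b * (a' ⊗ₜ[k] (1 : AQ k Q)) +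
      ((1 : AQ k Q) ⊗ₜ[k] a) * br a' b := fun a a' b => by simpa [hbr] using hF b a a'
  have hright : ∀ b c a, br a (b * c) = br a b * ((1 : AQ k Q) ⊗ₜ[k] c) +
      (b ⊗ₜ[k] (1 : AQ k Q)) * br a c := by
    intro b c a
    let m : AQ k Q →ₗ[k] AQ k Q ⊗[k] AQ k Q :=
      (LinearMap.mulRight k ((1 : AQ k Q) ⊗ₜ[k] c)) ∘ₗ (F b) +
        (LinearMap.mulLeft k (b ⊗ₜ[k] (1 : AQ k Q))) ∘ₗ (F c)
    have hm : ∀ a, m a = br a b * ((1 : AQ k Q) ⊗ₜ[k] c) +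
      (b ⊗ₜ[k] (1 : AQ k Q)) * br a c := fun a => by simp [m, hbr]
    have hm' : IsDer (includeRight : AQ k Q →ₐ[k] AQ k Q ⊗[k] AQ k Q) includeLeft m := by
      intro x y
      simp only [hm, hleft, Algebra.TensorProduct.includeLeft_apply,
        Algebra.TensorProduct.includeRight_apply]
      have h1 : ((1 : AQ k Q) ⊗ₜ[k] c) * (y ⊗ₜ[k] (1 : AQ k Q)) =
        (y ⊗ₜ[k] (1 : AQ k Q)) * ((1 : AQ k Q) ⊗ₜ[k] c) := by simp
      have h2 : ((1 : AQ k Q) ⊗ₜ[k] x) * (b ⊗ₜ[k] (1 : AQ k Q)) =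
        (b ⊗ₜ[k] (1 : AQ k Q)) * ((1 : AQ k Q) ⊗ₜ[k] x) := by simp
      simp only [mul_add, add_mul, mul_assoc, h1]
      rw [← mul_assoc _ (b ⊗ₜ[k] (1 : AQ k Q)), h2]
      simp only [mul_assoc]
      abel
    rw [← hm]
    refine (hF (b * c)).ext hm' (fun s => ?_) (fun p => ?_) a
    · simp [hm, hFs, hBl]
    · rw [hm, hpq, hpq, hFp]
      simpa using hD p b c
  have hBr : ∀ s a, br a (idem k Q s) = 0 := by
    intro s a
    refine (hF (idem k Q s)).eq_zero (fun s' => hFs _ _) (fun p => ?_) a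
    rw [hFp, hDs]
  have hcomm : ∀ a, IsDer (includeRight : AQ k Q →ₐ[k] AQ k Q ⊗[k] AQ k Q) includeLeft
      (-((TensorProduct.comm k (AQ k Q) (AQ k Q)).toLinearMap ∘ₗ br a)) := by
    intro a x y
    simp only [LinearMap.neg_apply, LinearMap.comp_apply, hright, map_add,
      LinearEquiv.coe_coe, comm_mul, TensorProduct.comm_tmul,
      Algebra.TensorProduct.includeLeft_apply, Algebra.TensorProduct.includeRight_apply]
    noncomm_ring
  -- Antisymmetry spreads from pairs of arrows in two passes, one argument at a time.
  have hanti' : ∀ p y, br (arr k Q p) y = -TensorProduct.comm k _ _ (br y (arr k Q p)) := by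
    intro p y
    have h1 : br y (arr k Q p) = -TensorProduct.comm k _ _ (br (arr k Q p) y) := by
      refine (hF (arr k Q p)).ext (hcomm (arr k Q p)) (fun s => ?_) (fun q => ?_) y
      · simp [hFs, hBr]
      · simp only [LinearMap.neg_apply, LinearMap.comp_apply, LinearEquiv.coe_coe]
        rw [hFp, hpq, hDp, hDp, hanti]
    rw [h1, map_neg, comm_comm, neg_neg]
  refine ⟨br, ⟨fun a b => ?_, fun a b c => hright b c a⟩, fun s a => ⟨hBl s a, hBr s a⟩,
    fun p q => by rw [hpq, hDp]⟩
  refine (hF b).ext (hcomm b) (fun s => ?_) (fun p => ?_) a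
  · simp [hFs, hBr]
  · exact hanti' p b

end Existence

/-! ### The values of the bracket on arrows -/

section Values

variable {k : Type z} [Field k] {I : Type u} {E : Type v} (Q : FinQuiver I E)

/-- A skew-symmetric scalar function on pairs of arrows of the double quiver which vanishes on pairs
with different tails. -/
structure IsTailForm (O : E ⊕ E → E ⊕ E → k) : Prop where
  antisymm : ∀ p q, O p q = -O q p
  eq_zero : ∀ p q, Q.double.t p ≠ Q.double.t q → O p q = 0

variable {Q} {O : E ⊕ E → E ⊕ E → k}

theorem IsTailForm.self [CharZero k] (hO : IsTailForm Q O) (p : E ⊕ E) : O p p = 0 := by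
  have := hO.antisymm p p
  linear_combination (1 / 2 : k) * this

/-- The coefficient vanishes unless the tails agree, so under it the idempotents at the two tails
may be interchanged. This avoids case distinctions on end points in the bracket computations. -/
theorem IsTailForm.smul_congr {M : Type*} [AddCommMonoid M] [Module k M] (hO : IsTailForm Q O)
    {p q : E ⊕ E} {x y : M} (h : Q.double.t p = Q.double.t q → x = y) : O p q • x = O p q • y := by
  by_cases hpq : Q.double.t p = Q.double.t q
  · rw [h hpq]
  · rw [hO.eq_zero p q hpq, zero_smul, zero_smul]

variable [Fintype I]

variable (Q)

/-- The element `½ (O(c, p) c ⊗ e_{t(c)} - O(c^*, p) e_{h(c)} ⊗ c)`. -/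
def gaugeTerm (O : E ⊕ E → E ⊕ E → k) (c p : E ⊕ E) : AQ k Q ⊗[k] AQ k Q :=
  (1 / 2 : k) • (O c p • (arr k Q c ⊗ₜ[k] idem k Q (Q.double.t c))
    - O c.swap p • (idem k Q (Q.double.t c.swap) ⊗ₜ[k] arr k Q c))

variable (k) in
/-- The element `e_{h(c)} ⊗ e_{t(c)} + ½ c^* c ⊗ e_{t(c)} + ½ e_{h(c)} ⊗ c c^*`. -/
def pairTerm (c : E ⊕ E) : AQ k Q ⊗[k] AQ k Q :=
  idem k Q (Q.double.t c.swap) ⊗ₜ[k] idem k Q (Q.double.t c)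
    + (1 / 2 : k) • ((arr k Q c.swap * arr k Q c) ⊗ₜ[k] idem k Q (Q.double.t c))
    + (1 / 2 : k) • (idem k Q (Q.double.t c.swap) ⊗ₜ[k] (arr k Q c * arr k Q c.swap))

open Classical in
/-- The value on the arrows `c`, `b` of the bracket defined by the form `O` and the signs `η`. -/
def arrowBracket (O : E ⊕ E → E ⊕ E → k) (η : E ⊕ E → k) (c b : E ⊕ E) : AQ k Q ⊗[k] AQ k Q :=
  (arr k Q b ⊗ₜ[k] (1 : AQ k Q)) * gaugeTerm Q O c b.swap
    - gaugeTerm Q O c b * ((1 : AQ k Q) ⊗ₜ[k] arr k Q b)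
    + if b = c.swap then η c • pairTerm k Q c else 0

variable {Q} {η : E ⊕ E → k}

theorem arr_mul_gaugeTerm (hO : IsTailForm Q O) (c b : E ⊕ E) :
    (arr k Q b ⊗ₜ[k] (1 : AQ k Q)) * gaugeTerm Q O c b.swap =
      (1 / 2 : k) • (O c b.swap • ((arr k Q b * arr k Q c) ⊗ₜ[k] idem k Q (Q.double.t c))
        - O c.swap b.swap • (arr k Q b ⊗ₜ[k] arr k Q c)) := by
  rw [gaugeTerm, mul_smul_comm, mul_sub, mul_smul_comm, mul_smul_comm,
    Algebra.TensorProduct.tmul_mul_tmul, Algebra.TensorProduct.tmul_mul_tmul, one_mul, one_mul]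
  congr 2
  refine hO.smul_congr fun h => ?_
  rw [h, arr_mul_idem]

theorem gaugeTerm_mul_arr (hO : IsTailForm Q O) (c b : E ⊕ E) :
    gaugeTerm Q O c b * ((1 : AQ k Q) ⊗ₜ[k] arr k Q b) =
      (1 / 2 : k) • (O c b • (arr k Q c ⊗ₜ[k] arr k Q b)
        - O c.swap b • (idem k Q (Q.double.t c.swap) ⊗ₜ[k] (arr k Q c * arr k Q b))) := by
  rw [gaugeTerm, smul_mul_assoc, sub_mul, smul_mul_assoc, smul_mul_assoc,
    Algebra.TensorProduct.tmul_mul_tmul, Algebra.TensorProduct.tmul_mul_tmul, mul_one, mul_one]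
  congr 2
  refine hO.smul_congr fun h => ?_
  rw [h, idem_mul_arr]

open Classical in
-- The expanded form is the one to compare with Van den Bergh's values; the factored form in the
-- definition is the one that telescopes for moment maps.
theorem arrowBracket_eq (hO : IsTailForm Q O) (c b : E ⊕ E) : arrowBracket Q O η c b =
    (1 / 2 : k) • (O c b.swap • ((arr k Q b * arr k Q c) ⊗ₜ[k] idem k Q (Q.double.t c)))
    - (1 / 2 : k) • (O c.swap b.swap • (arr k Q b ⊗ₜ[k] arr k Q c))
    - (1 / 2 : k) • (O c b • (arr k Q c ⊗ₜ[k] arr k Q b))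
    + (1 / 2 : k) • (O c.swap b •
        (idem k Q (Q.double.t c.swap) ⊗ₜ[k] (arr k Q c * arr k Q b)))
    + if b = c.swap then η c • pairTerm k Q c else 0 := by
  rw [arrowBracket, arr_mul_gaugeTerm hO, gaugeTerm_mul_arr hO]
  module

theorem arrowBracket_outer (hO : IsTailForm Q O) (c b : E ⊕ E) :
    (idem k Q (Q.double.t b) ⊗ₜ[k] (1 : AQ k Q)) * arrowBracket Q O η c b *
      ((1 : AQ k Q) ⊗ₜ[k] idem k Q (Q.double.t b.swap)) = arrowBracket Q O η c b := by
  rw [arrowBracket_eq hO]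
  simp only [mul_add, add_mul, mul_sub, sub_mul, mul_smul_comm, smul_mul_assoc,
    Algebra.TensorProduct.tmul_mul_tmul, one_mul, mul_one, ← mul_assoc, idem_mul_arr]
  congr 1
  · congr 1
    · congr 1
      · congr 2
        · refine hO.smul_congr fun h => ?_
          rw [h, idem_mul_self]
        · refine hO.smul_congr fun h => ?_
          rw [← h, arr_mul_idem]
      · congr 1
        refine hO.smul_congr fun h => ?_
        rw [← h, idem_mul_arr, arr_mul_idem]
    · congr 1
      refine hO.smul_congr fun h => ?_
      rw [← h, idem_mul_self, mul_assoc, arr_mul_idem]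
  · split_ifs with h
    · subst h
      simp only [pairTerm, mul_add, add_mul, mul_smul_comm, smul_mul_assoc, Sum.swap_swap,
        Algebra.TensorProduct.tmul_mul_tmul, one_mul, mul_one, ← mul_assoc, idem_mul_arr,
        idem_mul_self]
      rw [mul_assoc, arr_swap_mul_idem]
    · simp

open Classical in
theorem arrowBracket_antisymm (hO : IsTailForm Q O) (hη : ∀ p, η p.swap = -η p) (c b : E ⊕ E) :
    arrowBracket Q O η c b = -TensorProduct.comm k _ _ (arrowBracket Q O η b c) := by
  rw [arrowBracket_eq hO, arrowBracket_eq hO]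
  simp only [map_add, map_sub, map_smul, TensorProduct.comm_tmul]
  have h1 : O c b.swap • ((arr k Q b * arr k Q c) ⊗ₜ[k] idem k Q (Q.double.t c)) =
      -(O b.swap c • ((arr k Q b * arr k Q c) ⊗ₜ[k] idem k Q (Q.double.t b.swap))) := by
    rw [hO.antisymm b.swap c, neg_smul, neg_neg]
    exact hO.smul_congr fun h => by rw [h]
  have h2 : O c.swap b • (idem k Q (Q.double.t c.swap) ⊗ₜ[k] (arr k Q c * arr k Q b)) =
      -(O b c.swap • (idem k Q (Q.double.t b) ⊗ₜ[k] (arr k Q c * arr k Q b))) := by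
    rw [hO.antisymm b c.swap, neg_smul, neg_neg]
    exact hO.smul_congr fun h => by rw [h]
  have h3 : (if b = c.swap then η c • pairTerm k Q c else 0) =
      -TensorProduct.comm k _ _ (if c = b.swap then η b • pairTerm k Q b else 0) := by
    by_cases h : b = c.swap
    · subst h
      simp only [Sum.swap_swap, if_true, map_smul, hη, pairTerm, map_add, TensorProduct.comm_tmul]
      module
    · rw [if_neg h, if_neg (fun h' => h (by rw [h', Sum.swap_swap])), map_zero, neg_zero]
  rw [h1, h2, h3, hO.antisymm c.swap b.swap, hO.antisymm c b]
  module

theorem arrowBracket_inner (hO : IsTailForm Q O) (hη : ∀ p, η p.swap = -η p) (c b : E ⊕ E) :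
    ((1 : AQ k Q) ⊗ₜ[k] idem k Q (Q.double.t c)) * arrowBracket Q O η c b *
      (idem k Q (Q.double.t c.swap) ⊗ₜ[k] (1 : AQ k Q)) = arrowBracket Q O η c b := by
  rw [arrowBracket_antisymm hO hη c b, mul_neg, neg_mul]
  congr 1
  conv_rhs => rw [← arrowBracket_outer hO b c]
  simp only [comm_mul, TensorProduct.comm_tmul]

/-- `br` is the `B`-linear double bracket on `A_Q` defined by the form `O` and the signs `η`. -/
structure IsFormBracket (Q : FinQuiver I E) (O : E ⊕ E → E ⊕ E → k) (η : E ⊕ E → k)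
    (br : AQ k Q →ₗ[k] AQ k Q →ₗ[k] AQ k Q ⊗[k] AQ k Q) : Prop where
  isDoubleBracket : IsDoubleBracket br
  isBLinear : IsBLinear (idem k Q) br
  arr_arr : ∀ p q, br (arr k Q p) (arr k Q q) = arrowBracket Q O η p q

theorem exists_isFormBracket (hO : IsTailForm Q O) (hη : ∀ p, η p.swap = -η p) :
    ∃ br, IsFormBracket Q O η br := by
  obtain ⟨br, h1, h2, h3⟩ := exists_isDoubleBracket (arrowBracket Q O η)
    (arrowBracket_outer hO) (arrowBracket_inner hO hη) (arrowBracket_antisymm hO hη)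
  exact ⟨br, h1, h2, h3⟩

theorem IsFormBracket.unique {br br' : AQ k Q →ₗ[k] AQ k Q →ₗ[k] AQ k Q ⊗[k] AQ k Q}
    (h : IsFormBracket Q O η br) (h' : IsFormBracket Q O η br') : br = br' :=
  h.isDoubleBracket.ext h'.isDoubleBracket h.isBLinear h'.isBLinear
    fun p q => by rw [h.arr_arr, h'.arr_arr]

end Values

/-! ### Van den Bergh's bracket -/

section VanDenBergh

variable (k : Type z) [Field k] {I : Type u} {E : Type v}
variable (Q : FinQuiver I E)

/-- The ordering function as a form on pairs of arrows. -/
def ordForm [DecidableEq I] (o : Q.Ordering) (p q : E ⊕ E) : k :=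
  (Q.ordFun o (Q.double.t p) p q : k)

/-- The sign `ε`: it is `1` on arrows of `Q` and `-1` on the opposite arrows. -/
def stdSign : E ⊕ E → ℤˣ := Sum.elim (fun _ => 1) fun _ => -1

variable [DecidableEq I] {Q}

theorem ordFun_antisymm (o : Q.Ordering) (p q : E ⊕ E) :
    Q.ordFun o (Q.double.t p) p q = -Q.ordFun o (Q.double.t q) q p := by
  by_cases h : Q.double.t q = Q.double.t p
  · rw [h]
    unfold FinQuiver.ordFun
    rw [dif_pos ⟨rfl, h⟩, dif_pos ⟨h, rfl⟩]
    let := o (Q.double.t p)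
    rcases lt_trichotomy (⟨p, rfl⟩ : Q.T (Q.double.t p)) ⟨q, h⟩ with h' | h' | h'
    · rw [if_pos h', if_neg h'.asymm, if_pos h']; rfl
    · rw [h']; simp
    · rw [if_neg h'.asymm, if_pos h', if_pos h']
  · unfold FinQuiver.ordFun
    rw [dif_neg (fun h' => h h'.2), dif_neg (fun h' => h h'.2.symm), neg_zero]

theorem ordForm_isTailForm (o : Q.Ordering) : IsTailForm Q (ordForm k Q o) where
  antisymm p q := by rw [ordForm, ordFun_antisymm, Int.cast_neg]; rfl
  eq_zero p q h := by
    rw [ordForm, FinQuiver.ordFun, dif_neg (fun h' => h h'.2.symm), Int.cast_zero]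

theorem stdSign_swap (p : E ⊕ E) : stdSign p.swap = -stdSign p := by
  cases p <;> simp [stdSign]

/-- The three families of values are one formula: O(p, p) = 0 kills terms when the arrows coincide
or are opposite, and the value on (a*, a), which is not prescribed, is forced by antisymmetry. -/
theorem isVdBBracket_iff [Fintype I] [CharZero k] (o : Q.Ordering)
    (br : AQ k Q →ₗ[k] AQ k Q →ₗ[k] AQ k Q ⊗[k] AQ k Q) : IsVdBBracket k Q o br ↔
      IsFormBracket Q (ordForm k Q o) (fun p => ((stdSign p : ℤ) : k)) br := by
  have hO := ordForm_isTailForm k o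
  have hself : ∀ a : E ⊕ E, arrowBracket Q (ordForm k Q o) (fun p => ((stdSign p : ℤ) : k)) a a =
      ((1 / 2 : k) * (Q.ordFun o (Q.double.t a) a a.swap : k)) •
      ((arr k Q a * arr k Q a) ⊗ₜ[k] idem k Q (Q.double.t a)
        - idem k Q (Q.double.h a) ⊗ₜ[k] (arr k Q a * arr k Q a)) := by
    intro a
    rw [arrowBracket_eq hO, if_neg (by cases a <;> simp), hO.self, hO.self,
      hO.antisymm a.swap a, FinQuiver.double_h]
    unfold ordForm
    module
  have hstar : ∀ a : E, arrowBracket Q (ordForm k Q o) (fun p => ((stdSign p : ℤ) : k))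
      (Sum.inl a) (Sum.inr a) =
    idem k Q (Q.h a) ⊗ₜ[k] idem k Q (Q.t a)
      + (1 / 2 : k) •
        ((arr k Q (Sum.inr a) * arr k Q (Sum.inl a)) ⊗ₜ[k] idem k Q (Q.t a))
      + (1 / 2 : k) •
        (idem k Q (Q.h a) ⊗ₜ[k] (arr k Q (Sum.inl a) * arr k Q (Sum.inr a)))
      + ((1 / 2 : k) * (Q.ordFun o (Q.t a) (Sum.inl a) (Sum.inr a) : k)) •
        (arr k Q (Sum.inr a) ⊗ₜ[k] arr k Q (Sum.inl a)
          - arr k Q (Sum.inl a) ⊗ₜ[k] arr k Q (Sum.inr a)) := by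
    intro a
    have h1 : ordForm k Q o (Sum.inl a) (Sum.inr a) =
      (Q.ordFun o (Q.t a) (Sum.inl a) (Sum.inr a) : k) := rfl
    rw [arrowBracket_eq hO, if_pos (by simp)]
    simp only [Sum.swap_inl, Sum.swap_inr, hO.self, hO.antisymm (Sum.inr a) (Sum.inl a), h1,
      pairTerm, stdSign, Sum.elim_inl, Units.val_one, Int.cast_one]
    have h2 : Q.double.t (Sum.inl a) = Q.t a := rfl
    have h3 : Q.double.t (Sum.inr a) = Q.h a := rfl
    rw [h2, h3]
    module
  have hother : ∀ b c : E ⊕ E, c ≠ b → c ≠ b.swap →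
      arrowBracket Q (ordForm k Q o) (fun p => ((stdSign p : ℤ) : k)) b c =
    - (((1 / 2 : k) * (Q.ordFun o (Q.double.t b) b c : k)) • (arr k Q b ⊗ₜ[k] arr k Q c))
      - ((1 / 2 : k) * (Q.ordFun o (Q.double.h b) b.swap c.swap : k)) •
        (arr k Q c ⊗ₜ[k] arr k Q b)
      + ((1 / 2 : k) * (Q.ordFun o (Q.double.t b) b c.swap : k)) •
        ((arr k Q c * arr k Q b) ⊗ₜ[k] idem k Q (Q.double.t b))
      + ((1 / 2 : k) * (Q.ordFun o (Q.double.h b) b.swap c : k)) •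
        (idem k Q (Q.double.h b) ⊗ₜ[k] (arr k Q b * arr k Q c)) := by
    intro b c _ h
    rw [arrowBracket_eq hO, if_neg h, FinQuiver.double_h]
    unfold ordForm
    module
  constructor
  · intro h
    refine ⟨h.isDoubleBracket, h.isBLinear, fun p q => ?_⟩
    by_cases h1 : q = p
    · subst h1
      rw [h.self, hself]
    by_cases h2 : q = p.swap
    · subst h2
      rcases p with a | a
      · exact (h.star a).trans (hstar a).symm
      · rw [h.isDoubleBracket.antisymm, arrowBracket_antisymm hO (fun p => by simp [stdSign_swap])]
        congr 2
        exact (h.star a).trans (hstar a).symm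
    · rw [h.other p q h1 h2, hother p q h1 h2]
  · intro h
    exact ⟨h.isDoubleBracket, h.isBLinear, fun a => by rw [h.arr_arr, hself],
      fun a => by rw [h.arr_arr, hstar], fun b c h1 h2 => by rw [h.arr_arr, hother b c h1 h2]⟩

end VanDenBergh

/-! ### The triple bracket -/

section Triple

open Algebra.TensorProduct (includeLeft includeRight)

variable {k : Type z} [Field k] {A : Type u} [Ring A] [Algebra k A]

@[simp]
theorem tau_tmul (x y z : A) : tau (x ⊗ₜ[k] y ⊗ₜ[k] z) = z ⊗ₜ[k] x ⊗ₜ[k] y := by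
  simp [tau]

theorem triple_induction {P : A ⊗[k] A ⊗[k] A → Prop} (h0 : P 0)
    (hadd : ∀ x y, P x → P y → P (x + y)) (ht : ∀ x y z, P (x ⊗ₜ[k] y ⊗ₜ[k] z))
    (x : A ⊗[k] A ⊗[k] A) : P x := by
  induction x using TensorProduct.induction_on with
  | zero => exact h0
  | add x y hx hy => exact hadd x y hx hy
  | tmul x z =>
    induction x using TensorProduct.induction_on with
    | zero => simpa using h0
    | add x y hx hy =>
      rw [TensorProduct.add_tmul]
      exact hadd _ _ hx hy
    | tmul x y => exact ht x y z

theorem tau_tau_tau (x : A ⊗[k] A ⊗[k] A) : tau (tau (tau x)) = x := by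
  induction x using triple_induction with
  | h0 => simp
  | hadd x y hx hy => simp [hx, hy]
  | ht x y z => simp

theorem tau_mul (x y : A ⊗[k] A ⊗[k] A) : tau (x * y) = tau x * tau y := by
  induction x using triple_induction with
  | h0 => simp
  | hadd x x' hx hx' => simp [hx, hx', add_mul]
  | ht x₁ x₂ x₃ =>
    induction y using triple_induction with
    | h0 => simp
    | hadd y y' hy hy' => simp [hy, hy', mul_add]
    | ht y₁ y₂ y₃ => simp

/-- The algebra map `x ⊗ y ↦ 1 ⊗ x ⊗ y`. -/
def incl23 : A ⊗[k] A →ₐ[k] A ⊗[k] A ⊗[k] A :=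
  Algebra.TensorProduct.map includeRight (AlgHom.id k A)

theorem incl23_tmul (x y : A) : incl23 (x ⊗ₜ[k] y) = (1 : A) ⊗ₜ[k] x ⊗ₜ[k] y := by
  simp [incl23]

theorem tau_tmul_one (x : A ⊗[k] A) : tau (x ⊗ₜ[k] (1 : A)) = incl23 x := by
  induction x using TensorProduct.induction_on with
  | zero => simp
  | add x y hx hy => simp [TensorProduct.add_tmul, hx, hy]
  | tmul x y => simp [incl23_tmul]

/-- The sum of the cyclic permutations which defines the triple bracket, for two brackets. -/
def mixedTriple (br br' : A →ₗ[k] A →ₗ[k] A ⊗[k] A) (a b c : A) : A ⊗[k] A ⊗[k] A :=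
  (br a).rTensor A (br' b c) + tau ((br b).rTensor A (br' c a)) +
    tau (tau ((br c).rTensor A (br' a b)))

theorem tripleBracket_add (br br' : A →ₗ[k] A →ₗ[k] A ⊗[k] A) (a b c : A) :
    tripleBracket (br + br') a b c = tripleBracket br a b c + tripleBracket br' a b c
      + (mixedTriple br br' a b c + mixedTriple br' br a b c) := by
  simp only [tripleBracket, mixedTriple, LinearMap.add_apply, LinearMap.rTensor_add, map_add]
  abel

theorem tripleBracket_rotate (br : A →ₗ[k] A →ₗ[k] A ⊗[k] A) (a b c : A) :
    tripleBracket br a b c = tau (tripleBracket br b c a) := by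
  simp only [tripleBracket, map_add, tau_tau_tau]
  abel

/-- The triple bracket as a linear map in its last argument. -/
def tripleLin (br : A →ₗ[k] A →ₗ[k] A ⊗[k] A) (a b : A) : A →ₗ[k] A ⊗[k] A ⊗[k] A :=
  (br a).rTensor A ∘ₗ br b + tau ∘ₗ (br b).rTensor A ∘ₗ br.flip a
    + tau ∘ₗ tau ∘ₗ (LinearMap.rTensorHom A ∘ₗ br).flip (br a b)

theorem tripleLin_apply (br : A →ₗ[k] A →ₗ[k] A ⊗[k] A) (a b c : A) :
    tripleLin br a b c = tripleBracket br a b c := by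
  simp [tripleLin, tripleBracket]

variable {br : A →ₗ[k] A →ₗ[k] A ⊗[k] A}

namespace IsDoubleBracket

theorem rTensor_left_mul (h : IsDoubleBracket br) (a c : A) (m : A ⊗[k] A) :
    (br a).rTensor A ((c ⊗ₜ[k] (1 : A)) * m) =
      (br a c ⊗ₜ[k] (1 : A)) * incl23 m
        + (c ⊗ₜ[k] (1 : A) ⊗ₜ[k] (1 : A)) * (br a).rTensor A m := by
  induction m using TensorProduct.induction_on with
  | zero => simp
  | add x y hx hy =>
    simp only [mul_add, map_add, hx, hy]
    abel
  | tmul x y =>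
    simp [h.deriv, incl23_tmul, TensorProduct.add_tmul]

theorem rTensor_mul_left (h : IsDoubleBracket br) (a d : A) (m : A ⊗[k] A) :
    tau ((br a).rTensor A (m * (d ⊗ₜ[k] (1 : A)))) =
      tau ((br a).rTensor A m) * ((1 : A) ⊗ₜ[k] (1 : A) ⊗ₜ[k] d)
        + (TensorProduct.comm k A A m ⊗ₜ[k] (1 : A)) * incl23 (br a d) := by
  induction m using TensorProduct.induction_on with
  | zero => simp
  | add x y hx hy =>
    simp only [add_mul, map_add, hx, hy, TensorProduct.add_tmul]
    abel
  | tmul x y =>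
    have h1 : (br a x * ((1 : A) ⊗ₜ[k] d)) ⊗ₜ[k] y =
      (br a x ⊗ₜ[k] y) * ((1 : A) ⊗ₜ[k] d ⊗ₜ[k] (1 : A)) := by simp
    have h2 : ((x ⊗ₜ[k] (1 : A)) * br a d) ⊗ₜ[k] y =
      (x ⊗ₜ[k] (1 : A) ⊗ₜ[k] y) * (br a d ⊗ₜ[k] (1 : A)) := by simp
    rw [Algebra.TensorProduct.tmul_mul_tmul, mul_one, LinearMap.rTensor_tmul, h.deriv,
      TensorProduct.add_tmul, map_add, h1, h2, tau_mul, tau_mul, tau_tmul, tau_tmul, tau_tmul_one,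
      TensorProduct.comm_tmul, LinearMap.rTensor_tmul]

theorem rTensor_right (f : A →ₗ[k] A ⊗[k] A) (c d : A) (m : A ⊗[k] A) :
    f.rTensor A (((1 : A) ⊗ₜ[k] c) * m * ((1 : A) ⊗ₜ[k] d)) =
      ((1 : A ⊗[k] A) ⊗ₜ[k] c) * f.rTensor A m * ((1 : A ⊗[k] A) ⊗ₜ[k] d) := by
  induction m using TensorProduct.induction_on with
  | zero => simp
  | add x y hx hy => simp only [mul_add, add_mul, map_add, hx, hy]
  | tmul x y => simp

theorem rTensor_mul (h : IsDoubleBracket br) (c d : A) (m : A ⊗[k] A) :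
    (br (c * d)).rTensor A m = (br c).rTensor A m * (d ⊗ₜ[k] (1 : A) ⊗ₜ[k] (1 : A))
      + ((1 : A) ⊗ₜ[k] c ⊗ₜ[k] (1 : A)) * (br d).rTensor A m := by
  induction m using TensorProduct.induction_on with
  | zero => simp
  | add x y hx hy =>
    simp only [mul_add, add_mul, map_add, hx, hy]
    abel
  | tmul x y =>
    have := h.isDer_left x c d
    simp only [LinearMap.flip_apply, Algebra.TensorProduct.includeLeft_apply,
      Algebra.TensorProduct.includeRight_apply] at this
    simp [this, TensorProduct.add_tmul]

/-- Expanding in c * d gives, besides the Leibniz terms, one product of {{a, c}} ⊗ 1 with 1 ⊗ {{b,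
d}} from the first cyclic summand and one from the second, where {{c, a}}° replaces {{a, c}}. They
cancel by antisymmetry. -/
theorem isDer_tripleLin (h : IsDoubleBracket br) (a b : A) :
    IsDer ((includeLeft : A ⊗[k] A →ₐ[k] A ⊗[k] A ⊗[k] A).comp includeLeft)
      (includeRight : A →ₐ[k] A ⊗[k] A ⊗[k] A) (tripleLin br a b) := by
  intro c d
  have r1 : ∀ (f : A →ₗ[k] A ⊗[k] A) (d : A) (m : A ⊗[k] A),
      f.rTensor A (m * ((1 : A) ⊗ₜ[k] d)) = f.rTensor A m * ((1 : A ⊗[k] A) ⊗ₜ[k] d) := by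
    intro f d m
    have := rTensor_right f 1 d m
    rwa [← Algebra.TensorProduct.one_def, ← Algebra.TensorProduct.one_def, one_mul, one_mul] at this
  have r2 : ∀ (f : A →ₗ[k] A ⊗[k] A) (d : A) (m : A ⊗[k] A),
      f.rTensor A (((1 : A) ⊗ₜ[k] d) * m) = ((1 : A ⊗[k] A) ⊗ₜ[k] d) * f.rTensor A m := by
    intro f d m
    have := rTensor_right f d 1 m
    rwa [← Algebra.TensorProduct.one_def, ← Algebra.TensorProduct.one_def, mul_one, mul_one] at this
  have hflip := h.isDer_left a c d
  simp only [LinearMap.flip_apply, Algebra.TensorProduct.includeLeft_apply,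
      Algebra.TensorProduct.includeRight_apply] at hflip
  simp only [tripleLin_apply, tripleBracket, h.deriv, hflip, map_add, h.rTensor_left_mul,
    h.rTensor_mul_left, h.rTensor_mul, r1, r2, tau_mul, tau_tmul, Algebra.TensorProduct.one_def,
    AlgHom.comp_apply, Algebra.TensorProduct.includeLeft_apply,
    Algebra.TensorProduct.includeRight_apply]
  have hanti : TensorProduct.comm k A A (br c a) = - br a c := by
    rw [h.antisymm a c, neg_neg]
  have hneg : ((-br a c) ⊗ₜ[k] (1 : A)) * incl23 (br b d) =
      -((br a c ⊗ₜ[k] (1 : A)) * incl23 (br b d)) := by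
    refine eq_neg_of_add_eq_zero_left ?_
    rw [← add_mul, ← TensorProduct.add_tmul, neg_add_cancel, TensorProduct.zero_tmul, zero_mul]
  rw [hanti, hneg]
  simp only [mul_add, add_mul]
  abel

end IsDoubleBracket

end Triple

/-! ### The defect of the quasi-Poisson property -/

section QuasiPoisson

open Algebra.TensorProduct (includeLeft includeRight)

variable {k : Type z} [Field k]

section General

variable {A : Type u} [Ring A] [Algebra k A]

/-- The summand for the idempotent `e` in the quasi-Poisson property. -/
def qpSummand (a b c e : A) : A ⊗[k] A ⊗[k] A :=
  (c * e * a) ⊗ₜ[k] (e * b) ⊗ₜ[k] e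
      - (c * e * a) ⊗ₜ[k] e ⊗ₜ[k] (b * e)
      - (c * e) ⊗ₜ[k] (a * e * b) ⊗ₜ[k] e
      + (c * e) ⊗ₜ[k] (a * e) ⊗ₜ[k] (b * e)
      - (e * a) ⊗ₜ[k] (e * b) ⊗ₜ[k] (e * c)
      + (e * a) ⊗ₜ[k] e ⊗ₜ[k] (b * e * c)
      + e ⊗ₜ[k] (a * e * b) ⊗ₜ[k] (e * c)
      - e ⊗ₜ[k] (a * e) ⊗ₜ[k] (b * e * c)

theorem qpSummand_rotate (a b c e : A) :
    qpSummand (k := k) a b c e = tau (qpSummand b c a e) := by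
  simp only [qpSummand, map_add, map_sub, tau_tmul]
  abel

/-- Half of the terms of `qpSummand`. -/
def qpHalf (a b e : A) : A ⊗[k] A ⊗[k] A :=
  (e * a) ⊗ₜ[k] (e * b) ⊗ₜ[k] e - (e * a) ⊗ₜ[k] e ⊗ₜ[k] (b * e)
    - e ⊗ₜ[k] (a * e * b) ⊗ₜ[k] e + e ⊗ₜ[k] (a * e) ⊗ₜ[k] (b * e)

/-- The right-hand side is a commutator in `c`, hence an inner derivation for the bimodule structure
that governs `tripleLin`. -/
theorem qpSummand_eq (a b c e : A) : qpSummand (k := k) a b c e =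
    (c ⊗ₜ[k] (1 : A) ⊗ₜ[k] (1 : A)) * qpHalf a b e
      - qpHalf a b e * ((1 : A) ⊗ₜ[k] (1 : A) ⊗ₜ[k] c) := by
  simp only [qpSummand, qpHalf, mul_add, mul_sub, add_mul, sub_mul,
    Algebra.TensorProduct.tmul_mul_tmul, one_mul, mul_one, mul_assoc]
  abel

/-- The right hand side of the quasi-Poisson property, as a linear map in `c`. -/
def qpLin {I : Type v} [Fintype I] (e : I → A) (a b : A) : A →ₗ[k] A ⊗[k] A ⊗[k] A :=
  (1 / 4 : k) • ∑ s : I, ((LinearMap.mulRight k (qpHalf a b (e s))) ∘ₗ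
      ((includeLeft : A ⊗[k] A →ₐ[k] A ⊗[k] A ⊗[k] A).comp includeLeft).toLinearMap
    - (LinearMap.mulLeft k (qpHalf a b (e s))) ∘ₗ
      (includeRight : A →ₐ[k] A ⊗[k] A ⊗[k] A).toLinearMap)

theorem qpLin_apply {I : Type v} [Fintype I] (e : I → A) (a b c : A) :
    qpLin (k := k) e a b c = (1 / 4 : k) • ∑ s : I, qpSummand a b c (e s) := by
  simp only [qpLin, qpSummand_eq]
  simp [LinearMap.sum_apply, Algebra.TensorProduct.one_def]

theorem isDer_qpLin {I : Type v} [Fintype I] (e : I → A) (a b : A) :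
    IsDer ((includeLeft : A ⊗[k] A →ₐ[k] A ⊗[k] A ⊗[k] A).comp includeLeft)
      (includeRight : A →ₐ[k] A ⊗[k] A ⊗[k] A) (qpLin e a b) := by
  intro c d
  simp only [qpLin, LinearMap.smul_apply, LinearMap.sum_apply, LinearMap.sub_apply,
    LinearMap.comp_apply, AlgHom.toLinearMap_apply, LinearMap.mulRight_apply,
    LinearMap.mulLeft_apply, map_mul, smul_mul_assoc, mul_smul_comm, Finset.sum_mul,
    Finset.mul_sum, ← smul_add, ← Finset.sum_add_distrib]
  congr 1
  refine Finset.sum_congr rfl fun s _ => ?_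
  simp only [mul_sub, sub_mul, mul_assoc]
  abel

end General

variable {I : Type u} {E : Type v} [Fintype I] {Q : FinQuiver I E}

theorem qpLin_idem (a b : AQ k Q) (s : I) : qpLin (k := k) (idem k Q) a b (idem k Q s) = 0 := by
  classical
  rw [qpLin_apply, Finset.sum_eq_zero, smul_zero]
  intro s' _
  rw [qpSummand_eq]
  by_cases h : s = s'
  · subst h
    simp only [qpHalf, mul_add, mul_sub, add_mul, sub_mul,
      Algebra.TensorProduct.tmul_mul_tmul, one_mul, mul_one, mul_assoc, idem_mul_self]
    simp only [← mul_assoc, idem_mul_self]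
    abel
  · simp only [qpHalf, mul_add, mul_sub, add_mul, sub_mul,
      Algebra.TensorProduct.tmul_mul_tmul, one_mul, mul_one, mul_assoc, idem_mul_of_ne (Ne.symm h)]
    simp only [← mul_assoc, idem_mul_of_ne h]
    simp

/-- The quasi-Poisson property may be checked on arrows. -/
theorem isDoubleQuasiPoisson_of_arr {br : AQ k Q →ₗ[k] AQ k Q →ₗ[k] AQ k Q ⊗[k] AQ k Q}
    (h : IsDoubleBracket br) (hB : IsBLinear (idem k Q) br)
    (harr : ∀ a b c, tripleBracket br (arr k Q a) (arr k Q b) (arr k Q c) =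
      (1 / 4 : k) • ∑ s, qpSummand (arr k Q a) (arr k Q b) (arr k Q c) (idem k Q s)) :
    IsDoubleQuasiPoisson (idem k Q) br := by
  have hidem : ∀ a b s, tripleLin br a b (idem k Q s) = 0 := by
    intro a b s
    have : br (idem k Q s) = 0 := LinearMap.ext fun x => (hB s x).1
    simp [tripleLin_apply, tripleBracket, (hB s _).2, this]
  have hext : ∀ a b, (∀ p, tripleLin br a b (arr k Q p) = qpLin (idem k Q) a b (arr k Q p)) →
      ∀ c, tripleLin br a b c = qpLin (idem k Q) a b c := fun a b hp c =>
    (h.isDer_tripleLin a b).ext (isDer_qpLin _ a b) (fun s => by rw [hidem, qpLin_idem]) hp c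
  have hrot : ∀ a b c, tripleLin br a b c = qpLin (idem k Q) a b c →
      tripleLin br c a b = qpLin (idem k Q) c a b := by
    intro a b c habc
    rw [tripleLin_apply, qpLin_apply] at *
    rw [tripleBracket_rotate, habc, map_smul, map_sum]
    congr 1
    exact Finset.sum_congr rfl fun s _ => (qpSummand_rotate _ _ _ _).symm
  -- One argument at a time is freed: extend the last argument from arrows to A_Q, rotate
  -- cyclically, and repeat until none of the three is restricted.
  have h1 : ∀ p q c, tripleLin br (arr k Q p) (arr k Q q) c =
      qpLin (idem k Q) (arr k Q p) (arr k Q q) c := fun p q =>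
    hext _ _ fun r => by rw [tripleLin_apply, qpLin_apply, harr]
  have h2 : ∀ p c b, tripleLin br c (arr k Q p) b = qpLin (idem k Q) c (arr k Q p) b :=
    fun p c => hext _ _ fun q => hrot _ _ _ (h1 p q c)
  have h3 : ∀ b c a, tripleLin br b c a = qpLin (idem k Q) b c a :=
    fun b c => hext _ _ fun p => hrot _ _ _ (h2 p c b)
  refine ⟨h, hB, fun a b c => ?_⟩
  have := h3 a b c
  rw [tripleLin_apply, qpLin_apply] at this
  exact this

end QuasiPoisson

/-! ### The quasi-Poisson property on arrows -/

section Generators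

variable {k : Type z} [Field k] {I : Type u} {E : Type v} [Fintype I] {Q : FinQuiver I E}
variable {O : E ⊕ E → E ⊕ E → k} {η : E ⊕ E → k}
variable {br br' U V : AQ k Q →ₗ[k] AQ k Q →ₗ[k] AQ k Q ⊗[k] AQ k Q}

local notation "𝐞" => idem k Q
local notation "𝐱" => arr k Q
local notation "𝐭" => FinQuiver.t (FinQuiver.double Q)

/-- The idempotents are moved to the ends of `b`, where the terms of `qpSummand` have them. -/
theorem arrowBracket_form (hO : IsTailForm Q O) (c b : E ⊕ E) : arrowBracket Q O 0 c b =
    (1 / 2 : k) • (O c b.swap • ((𝐱 b * 𝐱 c) ⊗ₜ[k] 𝐞 (𝐭 b.swap)))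
    - (1 / 2 : k) • (O c.swap b.swap • (𝐱 b ⊗ₜ[k] (𝐱 c * 𝐞 (𝐭 b.swap))))
    - (1 / 2 : k) • (O c b • ((𝐞 (𝐭 b) * 𝐱 c) ⊗ₜ[k] 𝐱 b))
    + (1 / 2 : k) • (O c.swap b • (𝐞 (𝐭 b) ⊗ₜ[k] (𝐱 c * 𝐱 b))) := by
  rw [arrowBracket_eq hO]
  simp only [Pi.zero_apply, zero_smul, ite_self, add_zero]
  congr 1
  · congr 1
    · congr 2
      · exact hO.smul_congr fun h => by rw [h]
      · exact hO.smul_congr fun h => by rw [← h, arr_mul_idem]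
    · congr 1
      exact hO.smul_congr fun h => by rw [← h, idem_mul_arr]
  · congr 1
    exact hO.smul_congr fun h => by rw [h]

/-- The inner bracket only multiplies `b` and `c` by idempotents or by each other, so the outer
bracket hits either `c` or `b`. The two halves are kept apart because the cyclic sum is later
regrouped by the pair that is bracketed. -/
theorem rTensor_form (hO : IsTailForm Q O) (hU : IsFormBracket Q O 0 U)
    (hb : IsDoubleBracket br) (hB : IsBLinear (idem k Q) br) (a b c : E ⊕ E) :
    (br (𝐱 a)).rTensor _ (U (𝐱 b) (𝐱 c)) =
      ((1 / 2 : k) • (O b c.swap • ((br (𝐱 a) (𝐱 c) * ((1 : AQ k Q) ⊗ₜ[k] 𝐱 b)) ⊗ₜ[k] 𝐞 (𝐭 c.swap)))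
        - (1 / 2 : k) • (O b.swap c.swap • (br (𝐱 a) (𝐱 c) ⊗ₜ[k] (𝐱 b * 𝐞 (𝐭 c.swap)))))
      + ((1 / 2 : k) • (O b c.swap • (((𝐱 c ⊗ₜ[k] (1 : AQ k Q)) * br (𝐱 a) (𝐱 b)) ⊗ₜ[k] 𝐞 (𝐭 b)))
        - (1 / 2 : k) • (O b c • (br (𝐱 a) (𝐱 b) ⊗ₜ[k] (𝐞 (𝐭 b) * 𝐱 c)))) := by
  have h1 : O b c.swap • ((br (𝐱 a) (𝐱 c) * ((1 : AQ k Q) ⊗ₜ[k] 𝐱 b)) ⊗ₜ[k] 𝐞 (𝐭 c.swap)) =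
    O b c.swap • ((br (𝐱 a) (𝐱 c) * ((1 : AQ k Q) ⊗ₜ[k] 𝐱 b)) ⊗ₜ[k] 𝐞 (𝐭 b)) :=
    hO.smul_congr fun h => by rw [h]
  have h2 : O b.swap c.swap • (br (𝐱 a) (𝐱 c) ⊗ₜ[k] (𝐱 b * 𝐞 (𝐭 c.swap))) =
    O b.swap c.swap • (br (𝐱 a) (𝐱 c) ⊗ₜ[k] (𝐱 b)) :=
    hO.smul_congr fun h => by rw [← h, arr_mul_idem]
  have h3 : O b c • (br (𝐱 a) (𝐱 b) ⊗ₜ[k] (𝐞 (𝐭 b) * 𝐱 c)) =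
    O b c • (br (𝐱 a) (𝐱 b) ⊗ₜ[k] (𝐱 c)) :=
    hO.smul_congr fun h => by rw [h, idem_mul_arr]
  rw [h1, h2, h3, hU.arr_arr, arrowBracket_eq hO]
  simp only [Pi.zero_apply, zero_smul, ite_self, add_zero, map_add, map_sub, map_smul,
    LinearMap.rTensor_tmul, hb.deriv, (hB _ _).2, TensorProduct.zero_tmul, smul_zero,
    TensorProduct.add_tmul, smul_add]
  abel

/-- The part of the triple bracket of `a`, `b`, `c` where the products of values of the form `O`
involve `(b, c)` and `(c, a)`. -/
theorem center_form [CharZero k] (hO : IsTailForm Q O) (hU : IsFormBracket Q O 0 U)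
    (a b c : E ⊕ E) :
    ((1 / 2 : k) • (O b c.swap • ((U (𝐱 a) (𝐱 c) * ((1 : AQ k Q) ⊗ₜ[k] 𝐱 b)) ⊗ₜ[k] 𝐞 (𝐭 c.swap)))
        - (1 / 2 : k) • (O b.swap c.swap • (U (𝐱 a) (𝐱 c) ⊗ₜ[k] (𝐱 b * 𝐞 (𝐭 c.swap)))))
      + tau ((1 / 2 : k) • (O c a.swap • (((𝐱 a ⊗ₜ[k] (1 : AQ k Q)) * U (𝐱 b) (𝐱 c)) ⊗ₜ[k] 𝐞 (𝐭 c)))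
        - (1 / 2 : k) • (O c a • (U (𝐱 b) (𝐱 c) ⊗ₜ[k] (𝐞 (𝐭 c) * 𝐱 a)))) =
    -(1 / 4 : k) •
      ((O b c.swap * O c.swap a) •
          ((𝐱 c * 𝐞 (𝐭 c.swap) * 𝐱 a) ⊗ₜ[k] (𝐞 (𝐭 c.swap) * 𝐱 b) ⊗ₜ[k] 𝐞 (𝐭 c.swap))
      - (O b.swap c.swap * O c.swap a) •
          ((𝐱 c * 𝐞 (𝐭 c.swap) * 𝐱 a) ⊗ₜ[k] 𝐞 (𝐭 c.swap) ⊗ₜ[k] (𝐱 b * 𝐞 (𝐭 c.swap)))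
      - (O b c.swap * O c.swap a.swap) •
          ((𝐱 c * 𝐞 (𝐭 c.swap)) ⊗ₜ[k] (𝐱 a * 𝐞 (𝐭 c.swap) * 𝐱 b) ⊗ₜ[k] 𝐞 (𝐭 c.swap))
      + (O b.swap c.swap * O c.swap a.swap) •
          ((𝐱 c * 𝐞 (𝐭 c.swap)) ⊗ₜ[k] (𝐱 a * 𝐞 (𝐭 c.swap)) ⊗ₜ[k] (𝐱 b * 𝐞 (𝐭 c.swap)))
      - (O b c * O c a) • ((𝐞 (𝐭 c) * 𝐱 a) ⊗ₜ[k] (𝐞 (𝐭 c) * 𝐱 b) ⊗ₜ[k] (𝐞 (𝐭 c) * 𝐱 c))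
      + (O b.swap c * O c a) • ((𝐞 (𝐭 c) * 𝐱 a) ⊗ₜ[k] 𝐞 (𝐭 c) ⊗ₜ[k] (𝐱 b * 𝐞 (𝐭 c) * 𝐱 c))
      + (O b c * O c a.swap) • (𝐞 (𝐭 c) ⊗ₜ[k] (𝐱 a * 𝐞 (𝐭 c) * 𝐱 b) ⊗ₜ[k] (𝐞 (𝐭 c) * 𝐱 c))
      - (O b.swap c * O c a.swap) •
          (𝐞 (𝐭 c) ⊗ₜ[k] (𝐱 a * 𝐞 (𝐭 c)) ⊗ₜ[k] (𝐱 b * 𝐞 (𝐭 c) * 𝐱 c))) := by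
  rw [hU.arr_arr, hU.arr_arr, arrowBracket_form hO, arrowBracket_form hO,
    hO.antisymm c.swap a, hO.antisymm c.swap a.swap, hO.antisymm c a, hO.antisymm c a.swap]
  simp only [mul_add, add_mul, mul_sub, sub_mul, mul_smul_comm, smul_mul_assoc,
    Algebra.TensorProduct.tmul_mul_tmul, one_mul, mul_one, TensorProduct.add_tmul,
    TensorProduct.sub_tmul, ← TensorProduct.smul_tmul', map_add, map_sub, map_smul, tau_tmul,
    arr_mul_idem, idem_mul_arr, mul_assoc]
  module

/-- A form with the quadratic relation satisfied by the ordering function of a total order. -/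
structure IsOrderForm (Q : FinQuiver I E) (O : E ⊕ E → E ⊕ E → k) : Prop extends
    IsTailForm Q O where
  quadratic : ∀ p q r, Q.double.t p = Q.double.t q → Q.double.t q = Q.double.t r →
    ¬(p = q ∧ q = r) → O p q * O q r + O q r * O r p + O r p * O p q = -1

open Classical in
-- At most one vertex, the common tail of p, q, r, contributes to the sum. There the quadratic
-- relation gives the coefficient -1, except for p = q = r, where all values of O vanish and the
-- term must be added back.
theorem IsOrderForm.smul_add_smul_add_smul [CharZero k] {M : Type*} [AddCommGroup M] [Module k M]
    (hO : IsOrderForm Q O) (p q r : E ⊕ E) (f : I → M)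
    (hp : ∀ s, s ≠ 𝐭 p → f s = 0) (hq : ∀ s, s ≠ 𝐭 q → f s = 0) (hr : ∀ s, s ≠ 𝐭 r → f s = 0) :
    (O q r * O r p) • f (𝐭 r) + (O r p * O p q) • f (𝐭 p) + (O p q * O q r) • f (𝐭 q) =
      -∑ s, f s + if p = q ∧ q = r then f (𝐭 p) else 0 := by
  have hsum : ∑ s, f s = f (𝐭 p) := Finset.sum_eq_single _ (fun s _ => hp s) (by simp)
  by_cases h : 𝐭 p = 𝐭 q ∧ 𝐭 q = 𝐭 r
  · rw [hsum, ← h.2, ← h.1]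
    by_cases hpqr : p = q ∧ q = r
    · obtain ⟨rfl, rfl⟩ := hpqr
      simp [hO.self]
    · rw [if_neg hpqr, ← add_smul, ← add_smul]
      have := hO.quadratic p q r h.1 h.2 hpqr
      rw [show O q r * O r p + O r p * O p q + O p q * O q r = -1 by linear_combination this]
      simp
  · have hz : ∀ s, f s = 0 := by
      intro s
      by_contra hs
      refine h ⟨?_, ?_⟩
      · rw [← not_not.1 (mt (hp s) hs), ← not_not.1 (mt (hq s) hs)]
      · rw [← not_not.1 (mt (hr s) hs), ← not_not.1 (mt (hq s) hs)]
    simp [hz]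

variable (k Q) in
open Classical in
/-- The terms of the quasi-Poisson property for the arrows `a`, `b`, `c` where three of their end
points coincide as arrows of the double quiver. -/
def diagonalTerm (a b c : E ⊕ E) : AQ k Q ⊗[k] AQ k Q ⊗[k] AQ k Q :=
  (if a = b ∧ b = c.swap then
      (𝐱 c * 𝐞 (𝐭 a) * 𝐱 a) ⊗ₜ[k] (𝐞 (𝐭 a) * 𝐱 b) ⊗ₜ[k] 𝐞 (𝐭 a) else 0)
  - (if a = b.swap ∧ b.swap = c.swap then
      (𝐱 c * 𝐞 (𝐭 a) * 𝐱 a) ⊗ₜ[k] 𝐞 (𝐭 a) ⊗ₜ[k] (𝐱 b * 𝐞 (𝐭 a)) else 0)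
  - (if a.swap = b ∧ b = c.swap then
      (𝐱 c * 𝐞 (𝐭 a.swap)) ⊗ₜ[k] (𝐱 a * 𝐞 (𝐭 a.swap) * 𝐱 b) ⊗ₜ[k] 𝐞 (𝐭 a.swap) else 0)
  + (if a.swap = b.swap ∧ b.swap = c.swap then
      (𝐱 c * 𝐞 (𝐭 a.swap)) ⊗ₜ[k] (𝐱 a * 𝐞 (𝐭 a.swap)) ⊗ₜ[k] (𝐱 b * 𝐞 (𝐭 a.swap)) else 0)
  - (if a = b ∧ b = c then
      (𝐞 (𝐭 a) * 𝐱 a) ⊗ₜ[k] (𝐞 (𝐭 a) * 𝐱 b) ⊗ₜ[k] (𝐞 (𝐭 a) * 𝐱 c) else 0)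
  + (if a = b.swap ∧ b.swap = c then
      (𝐞 (𝐭 a) * 𝐱 a) ⊗ₜ[k] 𝐞 (𝐭 a) ⊗ₜ[k] (𝐱 b * 𝐞 (𝐭 a) * 𝐱 c) else 0)
  + (if a.swap = b ∧ b = c then
      𝐞 (𝐭 a.swap) ⊗ₜ[k] (𝐱 a * 𝐞 (𝐭 a.swap) * 𝐱 b) ⊗ₜ[k] (𝐞 (𝐭 a.swap) * 𝐱 c) else 0)
  - (if a.swap = b.swap ∧ b.swap = c then
      𝐞 (𝐭 a.swap) ⊗ₜ[k] (𝐱 a * 𝐞 (𝐭 a.swap)) ⊗ₜ[k] (𝐱 b * 𝐞 (𝐭 a.swap) * 𝐱 c) else 0)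

/-- The six halves from `rTensor_form` regroup into three rotations of `center_form`. Each of the
eight tensor shapes then collects the three products of values of O to which the quadratic relation
applies; its exceptions make up `diagonalTerm`. -/
theorem tripleBracket_form [CharZero k] (hO : IsOrderForm Q O) (hU : IsFormBracket Q O 0 U)
    (a b c : E ⊕ E) : tripleBracket U (𝐱 a) (𝐱 b) (𝐱 c) =
      (1 / 4 : k) • ∑ s, qpSummand (𝐱 a) (𝐱 b) (𝐱 c) (𝐞 s)
        - (1 / 4 : k) • diagonalTerm k Q a b c := by
  have hO' := hO.toIsTailForm
  have hX := rTensor_form hO' hU hU.isDoubleBracket hU.isBLinear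
  have h1 := center_form hO' hU a b c
  have h2 := congrArg tau (center_form hO' hU b c a)
  have h3 := congrArg (tau ∘ tau) (center_form hO' hU c a b)
  simp only [Function.comp_apply] at h3
  have hT : tripleBracket U (𝐱 a) (𝐱 b) (𝐱 c) = _ := Eq.trans
    (by
      simp only [tripleBracket, hX a b c, hX b c a, hX c a b, map_add, tau_tau_tau]
      abel)
    (congrArg₂ (fun u v => u + v) (congrArg₂ (fun u v => u + v) h1 h2) h3)
  have hl : ∀ (p : E ⊕ E) (s : I), s ≠ 𝐭 p → 𝐞 s * 𝐱 p = 0 := fun p s => idem_mul_arr_of_ne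
  have hr : ∀ (p : E ⊕ E) (s : I), s ≠ 𝐭 p.swap → 𝐱 p * 𝐞 s = 0 := fun p s => arr_mul_idem_of_ne
  -- One relation for each choice of an end of a, of b and of c: the chosen ends are those next to
  -- the idempotent e_s in the tensor.
  have y1 := hO.smul_add_smul_add_smul a b c.swap
    (fun s => (𝐱 c * 𝐞 s * 𝐱 a) ⊗ₜ[k] (𝐞 s * 𝐱 b) ⊗ₜ[k] 𝐞 s)
    (fun s h => by simp [mul_assoc, hl a s h]) (fun s h => by simp [hl b s h])
    (fun s h => by simp [hr c s h])
  have y2 := hO.smul_add_smul_add_smul a b.swap c.swap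
    (fun s => (𝐱 c * 𝐞 s * 𝐱 a) ⊗ₜ[k] 𝐞 s ⊗ₜ[k] (𝐱 b * 𝐞 s))
    (fun s h => by simp [mul_assoc, hl a s h]) (fun s h => by simp [hr b s h])
    (fun s h => by simp [hr c s h])
  have y3 := hO.smul_add_smul_add_smul a.swap b c.swap
    (fun s => (𝐱 c * 𝐞 s) ⊗ₜ[k] (𝐱 a * 𝐞 s * 𝐱 b) ⊗ₜ[k] 𝐞 s)
    (fun s h => by simp [hr a s h]) (fun s h => by simp [mul_assoc, hl b s h])
    (fun s h => by simp [hr c s h])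
  have y4 := hO.smul_add_smul_add_smul a.swap b.swap c.swap
    (fun s => (𝐱 c * 𝐞 s) ⊗ₜ[k] (𝐱 a * 𝐞 s) ⊗ₜ[k] (𝐱 b * 𝐞 s))
    (fun s h => by simp [hr a s h]) (fun s h => by simp [hr b s h])
    (fun s h => by simp [hr c s h])
  have y5 := hO.smul_add_smul_add_smul a b c
    (fun s => (𝐞 s * 𝐱 a) ⊗ₜ[k] (𝐞 s * 𝐱 b) ⊗ₜ[k] (𝐞 s * 𝐱 c))
    (fun s h => by simp [hl a s h]) (fun s h => by simp [hl b s h])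
    (fun s h => by simp [hl c s h])
  have y6 := hO.smul_add_smul_add_smul a b.swap c
    (fun s => (𝐞 s * 𝐱 a) ⊗ₜ[k] 𝐞 s ⊗ₜ[k] (𝐱 b * 𝐞 s * 𝐱 c))
    (fun s h => by simp [hl a s h]) (fun s h => by simp [hr b s h])
    (fun s h => by simp [mul_assoc, hl c s h])
  have y7 := hO.smul_add_smul_add_smul a.swap b c
    (fun s => 𝐞 s ⊗ₜ[k] (𝐱 a * 𝐞 s * 𝐱 b) ⊗ₜ[k] (𝐞 s * 𝐱 c))
    (fun s h => by simp [hr a s h]) (fun s h => by simp [mul_assoc, hl b s h])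
    (fun s h => by simp [hl c s h])
  have y8 := hO.smul_add_smul_add_smul a.swap b.swap c
    (fun s => 𝐞 s ⊗ₜ[k] (𝐱 a * 𝐞 s) ⊗ₜ[k] (𝐱 b * 𝐞 s * 𝐱 c))
    (fun s h => by simp [hr a s h]) (fun s h => by simp [hr b s h])
    (fun s h => by simp [mul_assoc, hl c s h])
  beta_reduce at y1 y2 y3 y4 y5 y6 y7 y8
  rw [hT]
  simp only [qpSummand, diagonalTerm, Finset.sum_add_distrib, Finset.sum_sub_distrib]
  simp only [map_add, map_sub, map_smul, tau_tmul]
  linear_combination (norm := module) (-(1 / 4 : k)) • (y1 - y2 - y3 + y4 - y5 + y6 + y7 - y8)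

end Generators

variable (k : Type z) [Field k] {I : Type u} {E : Type v} (Q : FinQuiver I E) in
theorem isTailForm_zero : IsTailForm Q (0 : E ⊕ E → E ⊕ E → k) :=
  ⟨fun _ _ => by simp, fun _ _ _ => rfl⟩

/-! ### The part of the bracket given by the signs, and the cross terms -/

section PairPart

variable {k : Type z} [Field k] {I : Type u} {E : Type v} [Fintype I] {Q : FinQuiver I E}
variable {O : E ⊕ E → E ⊕ E → k} {η : E ⊕ E → k}
variable {br br' U V : AQ k Q →ₗ[k] AQ k Q →ₗ[k] AQ k Q ⊗[k] AQ k Q}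

local notation "𝐞" => idem k Q
local notation "𝐱" => arr k Q
local notation "𝐭" => FinQuiver.t (FinQuiver.double Q)

theorem swap_ne (p : E ⊕ E) : p.swap ≠ p := by
  cases p <;> simp

theorem arr_swap_mul_idem_mul (p : E ⊕ E) (y : AQ k Q) :
    𝐱 p.swap * (𝐞 (𝐭 p) * y) = 𝐱 p.swap * y := by
  rw [← mul_assoc, arr_swap_mul_idem]

open Classical in
theorem IsFormBracket.pair_arr_arr (hV : IsFormBracket Q 0 η V) (b c : E ⊕ E) :
    V (𝐱 b) (𝐱 c) = if c = b.swap then η b • pairTerm k Q b else 0 := by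
  rw [hV.arr_arr, arrowBracket_eq (isTailForm_zero k Q)]
  simp

theorem rTensor_pairTerm (hb : IsDoubleBracket br) (hB : IsBLinear (idem k Q) br) (a : AQ k Q)
    (b : E ⊕ E) : (br a).rTensor _ (pairTerm k Q b) = (1 / 2 : k) •
      ((br a (𝐱 b.swap) * ((1 : AQ k Q) ⊗ₜ[k] 𝐱 b)
        + (𝐱 b.swap ⊗ₜ[k] (1 : AQ k Q)) * br a (𝐱 b)) ⊗ₜ[k] 𝐞 (𝐭 b)) := by
  simp only [pairTerm, map_add, map_smul, LinearMap.rTensor_tmul, (hB _ _).2, hb.deriv,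
    TensorProduct.zero_tmul, smul_zero, add_zero, zero_add]

/-- Collects the cross terms in which V pairs `b` with `c`: V inside and U outside, and the two
halves with U inside in which V hits that pair. Only c = b* matters. Then U(a, -) acts as a
derivation on the factors b and b* of the pair term, and the other two contributions undo this. -/
theorem mixed_part [CharZero k] (hO : IsTailForm Q O) (hη : ∀ p, η p.swap = -η p)
    (hU : IsFormBracket Q O 0 U) (hV : IsFormBracket Q 0 η V) (a b c : E ⊕ E) :
    (U (𝐱 a)).rTensor _ (V (𝐱 b) (𝐱 c))
      + tau ((1 / 2 : k) • (O c a.swap • (((𝐱 a ⊗ₜ[k] (1 : AQ k Q)) * V (𝐱 b) (𝐱 c)) ⊗ₜ[k] 𝐞 (𝐭 c)))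
        - (1 / 2 : k) • (O c a • (V (𝐱 b) (𝐱 c) ⊗ₜ[k] (𝐞 (𝐭 c) * 𝐱 a))))
      + tau (tau (((1 / 2 : k) •
          (O a b.swap • ((V (𝐱 c) (𝐱 b) * ((1 : AQ k Q) ⊗ₜ[k] 𝐱 a)) ⊗ₜ[k] 𝐞 (𝐭 b.swap)))
        - (1 / 2 : k) • (O a.swap b.swap • (V (𝐱 c) (𝐱 b) ⊗ₜ[k] (𝐱 a * 𝐞 (𝐭 b.swap))))))) = 0 := by
  classical
  rw [hV.pair_arr_arr, hV.pair_arr_arr]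
  by_cases h : c = b.swap
  · subst h
    rw [if_pos rfl, if_pos (by simp), hη, map_smul,
      rTensor_pairTerm hU.isDoubleBracket hU.isBLinear, hU.arr_arr, hU.arr_arr,
      arrowBracket_form hO, arrowBracket_form hO, hO.antisymm b.swap a, hO.antisymm b.swap a.swap]
    simp only [pairTerm, Sum.swap_swap, mul_add, add_mul, mul_sub, sub_mul, mul_smul_comm,
      smul_mul_assoc, Algebra.TensorProduct.tmul_mul_tmul, one_mul, mul_one,
      TensorProduct.add_tmul, smul_add, smul_sub,
      TensorProduct.sub_tmul, ← TensorProduct.smul_tmul', map_add, map_sub, map_smul, tau_tmul,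
      idem_mul_arr, arr_swap_mul_idem, arr_swap_mul_idem_mul, mul_assoc]
    module
  · rw [if_neg h, if_neg (fun h' => h (by rw [h', Sum.swap_swap]))]
    simp

/-- The three rotations of `mixed_part` account for every cross term exactly once. -/
theorem mixedTriple_eq_zero [CharZero k] (hO : IsTailForm Q O) (hη : ∀ p, η p.swap = -η p)
    (hU : IsFormBracket Q O 0 U) (hV : IsFormBracket Q 0 η V) (a b c : E ⊕ E) :
    mixedTriple U V (𝐱 a) (𝐱 b) (𝐱 c) + mixedTriple V U (𝐱 a) (𝐱 b) (𝐱 c) = 0 := by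
  have hX := rTensor_form hO hU hV.isDoubleBracket hV.isBLinear
  have h1 := mixed_part hO hη hU hV a b c
  have h2 := congrArg tau (mixed_part hO hη hU hV b c a)
  have h3 := congrArg (tau ∘ tau) (mixed_part hO hη hU hV c a b)
  simp only [Function.comp_apply] at h3
  refine Eq.trans ?_ ((congrArg₂ (fun u v => u + v) (congrArg₂ (fun u v => u + v) h1 h2) h3).trans
    (by simp))
  simp only [mixedTriple, hX a b c, hX b c a, hX c a b, map_add, tau_tau_tau]
  abel

open Classical in
-- Both brackets contribute a sign, and η² = 1, so the result no longer depends on the orientation.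
theorem rTensor_pair (hη : ∀ p, η p.swap = -η p) (hη' : ∀ p, η p * η p = 1)
    (hV : IsFormBracket Q 0 η V) (a b c : E ⊕ E) :
    (V (𝐱 a)).rTensor _ (V (𝐱 b) (𝐱 c)) = if c = b.swap then
      ((if a = b then (1 / 2 : k) • ((pairTerm k Q b * ((1 : AQ k Q) ⊗ₜ[k] 𝐱 b)) ⊗ₜ[k] 𝐞 (𝐭 b))
        else 0)
      - if a = b.swap then
        (1 / 2 : k) • (((𝐱 b.swap ⊗ₜ[k] (1 : AQ k Q)) * pairTerm k Q b.swap) ⊗ₜ[k] 𝐞 (𝐭 b))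
        else 0) else 0 := by
  rw [hV.pair_arr_arr]
  by_cases h : c = b.swap
  · rw [if_pos h, if_pos h, map_smul, rTensor_pairTerm hV.isDoubleBracket hV.isBLinear,
      hV.pair_arr_arr, hV.pair_arr_arr]
    by_cases hab : a = b
    · subst hab
      rw [if_pos rfl, if_neg (swap_ne a).symm, if_pos rfl, if_neg (swap_ne a).symm]
      simp only [mul_zero, add_zero, sub_zero, smul_mul_assoc, ← TensorProduct.smul_tmul']
      rw [smul_comm (1 / 2 : k), smul_smul, hη', one_smul]
    · by_cases hab' : a = b.swap
      · subst hab'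
        rw [if_neg (fun h => hab (by simpa using h)), if_pos (by simp), if_neg hab, if_pos rfl]
        simp only [zero_mul, zero_add, zero_sub, mul_smul_comm, ← TensorProduct.smul_tmul', hη]
        rw [smul_comm (1 / 2 : k), smul_smul, mul_neg, hη', neg_smul, one_smul]
      · rw [if_neg (fun h => hab (by rw [← Sum.swap_swap b, h, Sum.swap_swap])),
          if_neg (fun h => hab' (by rw [h, Sum.swap_swap])), if_neg hab, if_neg hab']
        simp
  · rw [if_neg h, if_neg h, map_zero]

/-- Both sides vanish unless all three arrows belong to one pair {p, p*}, which leaves a few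
explicit cases. For a = b = c the two surviving diagonal terms cancel. -/
theorem tripleBracket_pair [CharZero k] (hη : ∀ p, η p.swap = -η p) (hη' : ∀ p, η p * η p = 1)
    (hV : IsFormBracket Q 0 η V) (a b c : E ⊕ E) :
    tripleBracket V (𝐱 a) (𝐱 b) (𝐱 c) = (1 / 4 : k) • diagonalTerm k Q a b c := by
  classical
  have hs : ∀ p q : E ⊕ E, p.swap = q.swap ↔ p = q :=
    fun p q => ⟨fun h => by rw [← Sum.swap_swap p, h, Sum.swap_swap], fun h => by rw [h]⟩
  have hs' : ∀ p q : E ⊕ E, p.swap = q ↔ p = q.swap :=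
    fun p q => ⟨fun h => by rw [← h, Sum.swap_swap], fun h => by rw [h, Sum.swap_swap]⟩
  have hn : ∀ p : E ⊕ E, ¬ p.swap = p := swap_ne
  have hn' : ∀ p : E ⊕ E, ¬ p = p.swap := fun p h => swap_ne p h.symm
  simp only [tripleBracket, rTensor_pair hη hη' hV, diagonalTerm, hs]
  by_cases hab : a = b
  · subst hab
    by_cases hac : a = c
    · subst hac
      simp [hn, hn', idem_mul_arr, arr_mul_idem]
    · by_cases hac' : a = c.swap
      · subst hac'
        simp only [Sum.swap_swap, hn, hn', if_true, if_false, and_true, and_false, true_and,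
          false_and]
        simp only [pairTerm, Sum.swap_swap, mul_add, add_mul, mul_smul_comm,
          smul_mul_assoc, Algebra.TensorProduct.tmul_mul_tmul, one_mul, mul_one,
          TensorProduct.add_tmul, smul_add, smul_sub, map_zero,
          TensorProduct.sub_tmul, ← TensorProduct.smul_tmul', map_add, map_sub, map_smul, tau_tmul,
          arr_mul_idem, idem_mul_arr, arr_swap_mul_idem, mul_assoc]
        module
      · have : ¬ c = a.swap := fun h => hac' (by rw [h, Sum.swap_swap])
        simp [hac, hac', this, hn, hn', hs', Ne.symm hac]
  · by_cases hab' : a = b.swap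
    · subst hab'
      by_cases hbc : b = c
      · subst hbc
        simp only [Sum.swap_swap, hn, hn', if_true, if_false, and_true, and_false, true_and,
          false_and, and_self]
        simp only [pairTerm, Sum.swap_swap, mul_add, add_mul, mul_smul_comm,
          smul_mul_assoc, Algebra.TensorProduct.tmul_mul_tmul, one_mul, mul_one,
          TensorProduct.add_tmul, smul_add, smul_sub, map_zero,
          TensorProduct.sub_tmul, ← TensorProduct.smul_tmul', map_add, map_sub, map_smul, tau_tmul,
          arr_mul_idem, idem_mul_arr, arr_swap_mul_idem, mul_assoc]
        module
      · by_cases hbc' : b = c.swap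
        · subst hbc'
          simp only [Sum.swap_swap, hn, hn', if_true, if_false, and_true, and_false, true_and,
            false_and, and_self]
          simp only [pairTerm, Sum.swap_swap, mul_add, add_mul, mul_smul_comm,
            smul_mul_assoc, Algebra.TensorProduct.tmul_mul_tmul, one_mul, mul_one,
            TensorProduct.add_tmul, smul_add, smul_sub, map_zero,
            TensorProduct.sub_tmul, ← TensorProduct.smul_tmul', map_add, map_sub, map_smul,
            tau_tmul, arr_mul_idem, idem_mul_arr, arr_swap_mul_idem, mul_assoc]
          module
        · have : ¬ c = b.swap := fun h => hbc' (by rw [h, Sum.swap_swap])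
          simp [hbc, hbc', this, hn, hn', hs', Ne.symm hbc]
    · have : ¬ b = a.swap := fun h => hab' (by rw [h, Sum.swap_swap])
      simp [hab, hab', this, hs', Ne.symm hab]
      grind

/-- The bracket defined by an ordering form and a choice of signs is quasi-Poisson. -/
theorem IsFormBracket.isDoubleQuasiPoisson [CharZero k] (hO : IsOrderForm Q O)
    (hη : ∀ p, η p.swap = -η p) (hη' : ∀ p, η p * η p = 1) (h : IsFormBracket Q O η br) :
    IsDoubleQuasiPoisson (idem k Q) br := by
  refine isDoubleQuasiPoisson_of_arr h.isDoubleBracket h.isBLinear fun a b c => ?_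
  -- The bracket is the sum of its order part U and its pair part V, and their diagonal terms have
  -- opposite signs.
  obtain ⟨U, hU⟩ := exists_isFormBracket (η := 0) hO.toIsTailForm (by simp)
  obtain ⟨V, hV⟩ := exists_isFormBracket (isTailForm_zero k Q) hη
  have hUV : br = U + V := by
    refine h.isDoubleBracket.ext ?_ h.isBLinear ?_ fun p q => ?_
    · refine ⟨fun a b => ?_, fun a b c => ?_⟩
      · simp only [LinearMap.add_apply, map_add, hU.isDoubleBracket.antisymm a b,
          hV.isDoubleBracket.antisymm a b, neg_add]
      · simp only [LinearMap.add_apply, hU.isDoubleBracket.deriv, hV.isDoubleBracket.deriv,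
          mul_add, add_mul]
        abel
    · exact fun s a => by simp [(hU.isBLinear s a).1, (hV.isBLinear s a).1, (hU.isBLinear s a).2,
        (hV.isBLinear s a).2]
    · rw [h.arr_arr, LinearMap.add_apply, LinearMap.add_apply, hU.arr_arr, hV.arr_arr,
        arrowBracket_eq hO.toIsTailForm, arrowBracket_eq hO.toIsTailForm,
        arrowBracket_eq (isTailForm_zero k Q)]
      simp
  rw [hUV, tripleBracket_add, tripleBracket_form hO hU, tripleBracket_pair hη hη' hV,
    mixedTriple_eq_zero hO.toIsTailForm hη hU hV]
  abel

end PairPart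

/-! ### Orderings given by lists, and the multiplicative moment map -/

section Moment

open Algebra.TensorProduct (includeLeft includeRight)

variable (k : Type z) [Field k] {I : Type u} {E : Type v}

/-- The data which define a quasi-Hamiltonian structure on `A_Q`: signs of the arrows of the double
quiver, and for each vertex `s` a list of the arrows with tail `s`, together with the ordering
form of these lists. -/
@[ext]
structure OrderDatum (Q : FinQuiver I E) where
  form : E ⊕ E → E ⊕ E → k
  sign : E ⊕ E → ℤˣ
  list : I → List (E ⊕ E)
  isTailForm : IsTailForm Q form
  sign_swap : ∀ p, sign p.swap = -sign p
  mem_list : ∀ s p, p ∈ list s ↔ Q.double.t p = s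
  pairwise : ∀ s, (list s).Pairwise fun p q => form p q = 1

variable {k} {Q : FinQuiver I E} (D : OrderDatum k Q)

/-- The sign as a scalar. -/
def OrderDatum.scalar (p : E ⊕ E) : k := ((D.sign p : ℤ) : k)

theorem OrderDatum.scalar_swap (p : E ⊕ E) : D.scalar p.swap = -D.scalar p := by
  simp [OrderDatum.scalar, D.sign_swap]

theorem OrderDatum.scalar_mul_self (p : E ⊕ E) : D.scalar p * D.scalar p = 1 := by
  rcases Int.units_eq_one_or (D.sign p) with h | h <;> simp [OrderDatum.scalar, h]

section

variable {D} {s : I} {pre l : List (E ⊕ E)} {p q : E ⊕ E}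

theorem OrderDatum.form_eq_one_of_mem_left (h : D.list s = pre ++ p :: l) (hq : q ∈ pre) :
    D.form q p = 1 := by
  have := D.pairwise s
  rw [h, List.pairwise_append] at this
  exact this.2.2 q hq p (by simp)

theorem OrderDatum.form_eq_one_of_mem_right (h : D.list s = pre ++ p :: l) (hq : q ∈ l) :
    D.form p q = 1 := by
  have := D.pairwise s
  rw [h, List.pairwise_append, List.pairwise_cons] at this
  exact this.2.1.1 q hq

theorem OrderDatum.ne_of_form [CharZero k] (h : D.form p q = 1) : p ≠ q := by
  rintro rfl
  rw [D.isTailForm.self] at h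
  exact zero_ne_one h

variable (D) in
theorem OrderDatum.nodup [CharZero k] (s : I) : (D.list s).Nodup :=
  (D.pairwise s).imp fun h => ne_of_form h

theorem OrderDatum.mem_cases [CharZero k] (h : D.list s = pre ++ p :: l) (hq : Q.double.t q = s) :
    (q ∈ pre ∧ q ≠ p) ∨ (q = p ∧ q ∉ pre) ∨ (q ∈ l ∧ q ∉ pre ∧ q ≠ p) := by
  have h1 := (D.mem_list s q).2 hq
  have h2 := D.nodup s
  rw [h] at h1 h2
  simp only [List.mem_append, List.mem_cons] at h1
  rw [List.nodup_append] at h2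
  have h3 := h2.2.2
  have h4 := (List.nodup_cons.1 h2.2.1).1
  rcases h1 with h1 | h1 | h1
  · exact Or.inl ⟨h1, h3 q h1 p (by simp)⟩
  · subst h1
    exact Or.inr (Or.inl ⟨rfl, fun h => h3 q h q (by simp) rfl⟩)
  · exact Or.inr (Or.inr ⟨h1, fun h => h3 q h q (by simp [h1]) rfl, fun h => h4 (h ▸ h1)⟩)

end

open Classical in
/-- The form which is `1` on the diagonal and `0` elsewhere. -/
def diagForm (q p : E ⊕ E) : k := if q = p then 1 else 0

open Classical in
/-- The form of a cut of the list at the vertex `s`, after the elements of `pre`. -/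
def cutForm (Q : FinQuiver I E) (s : I) (pre : List (E ⊕ E)) (q _p : E ⊕ E) : k :=
  if Q.double.t q = s then if q ∈ pre then 1 else -1 else 0

/-- Against a fixed p, the form records whether q lies before or after p. Adding 1 at q = p counts p
among the earlier half-edges, and subtracting 1 counts it among the later ones. Hence the two
modified forms describe the gaps just after and just before p. The argument p' is a dummy. -/
theorem OrderDatum.form_add_diagForm [CharZero k] {s : I} {pre l : List (E ⊕ E)} {p : E ⊕ E}
    (hl : D.list s = pre ++ p :: l) (q p' : E ⊕ E) :
    (D.form + diagForm : E ⊕ E → E ⊕ E → k) q p = cutForm Q s (pre ++ [p]) q p' := by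
  classical
  have hp : Q.double.t p = s := (D.mem_list s p).1 (by simp [hl])
  simp only [Pi.add_apply, cutForm, diagForm]
  by_cases hq : Q.double.t q = s
  · rw [if_pos hq]
    rcases mem_cases hl hq with ⟨h1, h2⟩ | ⟨h1, h2⟩ | ⟨h1, h2, h3⟩
    · simp [h1, h2, form_eq_one_of_mem_left hl h1]
    · subst h1
      simp [D.isTailForm.self]
    · simp [h2, h3, D.isTailForm.antisymm q p, form_eq_one_of_mem_right hl h1]
  · rw [if_neg hq, D.isTailForm.eq_zero q p (by rwa [hp]), if_neg (by rintro rfl; exact hq hp),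
      add_zero]

theorem OrderDatum.form_sub_diagForm [CharZero k] {s : I} {pre l : List (E ⊕ E)} {p : E ⊕ E}
    (hl : D.list s = pre ++ p :: l) (q p' : E ⊕ E) :
    (D.form - diagForm : E ⊕ E → E ⊕ E → k) q p = cutForm Q s pre q p' := by
  classical
  have hp : Q.double.t p = s := (D.mem_list s p).1 (by simp [hl])
  simp only [Pi.sub_apply, cutForm, diagForm]
  by_cases hq : Q.double.t q = s
  · rw [if_pos hq]
    rcases mem_cases hl hq with ⟨h1, h2⟩ | ⟨h1, h2⟩ | ⟨h1, h2, h3⟩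
    · simp [h1, h2, form_eq_one_of_mem_left hl h1]
    · subst h1
      simp [D.isTailForm.self, h2]
    · simp [h2, h3, D.isTailForm.antisymm q p, form_eq_one_of_mem_right hl h1]
  · rw [if_neg hq, D.isTailForm.eq_zero q p (by rwa [hp]), if_neg (by rintro rfl; exact hq hp),
      sub_zero]

variable [Fintype I]

local notation "𝐞" => idem k Q
local notation "𝐱" => arr k Q
local notation "𝐭" => FinQuiver.t (FinQuiver.double Q)

/-- The factor `(1 + p p^*)^{ε(p)}` as a unit of `A_Q`. -/
def OrderDatum.factor (p : E ⊕ E) : (AQ k Q)ˣ := zUnit k Q p ^ (D.sign p : ℤ)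

/-- The product of the factors at the vertex `s`. -/
def OrderDatum.factorProd (s : I) : (AQ k Q)ˣ := ((D.list s).map D.factor).prod

/-- The component `Φ_s` of the moment map. -/
def OrderDatum.moment (s : I) : AQ k Q := 𝐞 s * D.factorProd s

theorem commute_idem_zUnit (p : E ⊕ E) : Commute (𝐞 (𝐭 p)) (zUnit k Q p).val := by
  rw [coe_zUnit, commute_iff_eq, mul_add, add_mul, ← mul_assoc, idem_mul_arr, mul_assoc,
    arr_swap_mul_idem, one_mul, mul_one]

theorem OrderDatum.commute_idem_factor (p : E ⊕ E) : Commute (𝐞 (𝐭 p)) (D.factor p).val :=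
  (commute_idem_zUnit p).units_zpow_right _

theorem OrderDatum.commute_idem_factorProd (s : I) :
    Commute (𝐞 s) (D.factorProd s).val := by
  have : ∀ l : List (E ⊕ E), (∀ p ∈ l, 𝐭 p = s) → Commute (𝐞 s) ((l.map D.factor).prod).val := by
    intro l hl
    induction l with
    | nil => exact Commute.one_right _
    | cons p l ih =>
      rw [List.map_cons, List.prod_cons, Units.val_mul]
      obtain rfl := hl p (by simp)
      exact (D.commute_idem_factor p).mul_right (ih fun q hq => hl q (by simp [hq]))
  exact this _ fun p hp => (D.mem_list s p).1 hp

theorem OrderDatum.moment_mul_idem (s : I) : D.moment s * 𝐞 s = D.moment s := by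
  rw [moment, mul_assoc, ← (D.commute_idem_factorProd s).eq, ← mul_assoc, idem_mul_self]

theorem OrderDatum.idem_mul_moment (s : I) : 𝐞 s * D.moment s = D.moment s := by
  rw [moment, ← mul_assoc, idem_mul_self]

/-- The factor products commute with the idempotents at their vertices, so the inverse is the sum of
the e_s Π_s⁻¹, where Π_s is `factorProd`. -/
theorem OrderDatum.isUnit_sum_moment : IsUnit (∑ s, D.moment s) := by
  have h1 : ∀ s s', s ≠ s' → D.moment s * (𝐞 s' * ↑(D.factorProd s')⁻¹) = 0 := by
    intro s s' h
    rw [moment, (D.commute_idem_factorProd s).eq, mul_assoc, ← mul_assoc (𝐞 s), idem_mul_of_ne h,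
      zero_mul, mul_zero]
  have h2 : ∀ s s', s ≠ s' → 𝐞 s * ↑(D.factorProd s)⁻¹ * D.moment s' = 0 := by
    intro s s' h
    rw [moment, (D.commute_idem_factorProd s).units_inv_right.eq, mul_assoc, ← mul_assoc (𝐞 s),
      idem_mul_of_ne h, zero_mul, mul_zero]
  refine isUnit_iff_exists.2 ⟨∑ s, 𝐞 s * ↑(D.factorProd s)⁻¹, ?_, ?_⟩
  · rw [Finset.sum_mul_sum, ← sum_idem k Q]
    refine Finset.sum_congr rfl fun s _ => ?_
    rw [Finset.sum_eq_single s (fun s' _ h => h1 s s' h.symm) (by simp), moment,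
      (D.commute_idem_factorProd s).eq, mul_assoc, ← mul_assoc (𝐞 s), idem_mul_self,
      (D.commute_idem_factorProd s).units_inv_right.eq, ← mul_assoc, Units.mul_inv, one_mul]
  · rw [Finset.sum_mul_sum, ← sum_idem k Q]
    refine Finset.sum_congr rfl fun s _ => ?_
    rw [Finset.sum_eq_single s (fun s' _ h => h2 s s' h.symm) (by simp), moment,
      (D.commute_idem_factorProd s).units_inv_right.eq, mul_assoc, ← mul_assoc (𝐞 s), idem_mul_self,
      (D.commute_idem_factorProd s).eq, ← mul_assoc, Units.inv_mul, one_mul]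

theorem gaugeTerm_add (O O' : E ⊕ E → E ⊕ E → k) (c p : E ⊕ E) :
    gaugeTerm Q (O + O') c p = gaugeTerm Q O c p + gaugeTerm Q O' c p := by
  simp only [gaugeTerm, Pi.add_apply]
  module

theorem gaugeTerm_sub (O O' : E ⊕ E → E ⊕ E → k) (c p : E ⊕ E) :
    gaugeTerm Q (O - O') c p = gaugeTerm Q O c p - gaugeTerm Q O' c p := by
  simp only [gaugeTerm, Pi.sub_apply]
  module

theorem gaugeTerm_congr {O O' : E ⊕ E → E ⊕ E → k} {c p p' : E ⊕ E} (h : O c p = O' c p')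
    (h' : O c.swap p = O' c.swap p') : gaugeTerm Q O c p = gaugeTerm Q O' c p' := by
  rw [gaugeTerm, gaugeTerm, h, h']

variable {br : AQ k Q →ₗ[k] AQ k Q →ₗ[k] AQ k Q ⊗[k] AQ k Q} {O : E ⊕ E → E ⊕ E → k}
variable {η : E ⊕ E → k}

/-- In the Leibniz expansion of {{c, pp*}} the two terms with G(c, p*) cancel, which leaves only
G(c, p) at the outer ends. The pair term contributes only for c = p or c = p*, and there it is a
gauge term for the diagonal form. -/
theorem IsFormBracket.arr_zUnit [CharZero k] (h : IsFormBracket Q O η br)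
    (hη : ∀ p, η p.swap = -η p) (c p : E ⊕ E) :
    br (𝐱 c) (zUnit k Q p).val =
      ((zUnit k Q p).val ⊗ₜ[k] (1 : AQ k Q)) *
          (gaugeTerm Q O c p + η p • gaugeTerm Q diagForm c p)
        - (gaugeTerm Q O c p - η p • gaugeTerm Q diagForm c p) *
          ((1 : AQ k Q) ⊗ₜ[k] (zUnit k Q p).val) := by
  classical
  have hb := h.isDoubleBracket
  have h1 : (1 : AQ k Q) ⊗ₜ[k] (1 : AQ k Q) = (1 : AQ k Q ⊗[k] AQ k Q) := rfl
  have hpair : (if p = c.swap then η c • pairTerm k Q c else 0) * ((1 : AQ k Q) ⊗ₜ[k] 𝐱 p.swap)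
      + (𝐱 p ⊗ₜ[k] (1 : AQ k Q)) * (if p.swap = c.swap then η c • pairTerm k Q c else 0) =
      η p • (((zUnit k Q p).val ⊗ₜ[k] (1 : AQ k Q)) * gaugeTerm Q diagForm c p
        + gaugeTerm Q diagForm c p * ((1 : AQ k Q) ⊗ₜ[k] (zUnit k Q p).val)) := by
    by_cases hp : p = c
    · subst hp
      rw [if_neg (swap_ne p).symm, if_pos rfl]
      simp only [gaugeTerm, diagForm, if_true, if_neg (swap_ne p), coe_zUnit, pairTerm, zero_mul,
        zero_add, one_smul, zero_smul, sub_zero, mul_add, add_mul, mul_smul_comm, smul_mul_assoc,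
        Algebra.TensorProduct.tmul_mul_tmul, one_mul, mul_one, TensorProduct.add_tmul,
        TensorProduct.tmul_add, arr_mul_idem, idem_mul_arr, ← mul_assoc]
      module
    · by_cases hp' : p = c.swap
      · subst hp'
        rw [if_pos rfl, if_neg (by simpa using (swap_ne c).symm), hη]
        simp only [gaugeTerm, diagForm, if_true, if_neg (swap_ne c).symm, coe_zUnit, pairTerm,
          mul_zero, Sum.swap_swap, arr_mul_idem,
          add_zero, one_smul, zero_smul, zero_sub, mul_add, add_mul, mul_smul_comm, smul_mul_assoc,
          Algebra.TensorProduct.tmul_mul_tmul, one_mul, mul_one, TensorProduct.add_tmul,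
          TensorProduct.tmul_add, arr_swap_mul_idem, idem_mul_arr, mul_assoc, mul_neg, neg_mul]
        module
      · rw [if_neg hp', if_neg (fun h => hp (by rw [← Sum.swap_swap p, h, Sum.swap_swap]))]
        simp [gaugeTerm, diagForm, Ne.symm hp, Ne.symm hp']
  have h2 : br (𝐱 c) (zUnit k Q p).val =
      br (𝐱 c) (𝐱 p) * ((1 : AQ k Q) ⊗ₜ[k] 𝐱 p.swap)
        + (𝐱 p ⊗ₜ[k] (1 : AQ k Q)) * br (𝐱 c) (𝐱 p.swap) := by
    rw [coe_zUnit, map_add, (hb.isDer_right _).map_one, zero_add, hb.deriv]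
  have h3 : (zUnit k Q p).val ⊗ₜ[k] (1 : AQ k Q) =
      1 + (𝐱 p ⊗ₜ[k] (1 : AQ k Q)) * (𝐱 p.swap ⊗ₜ[k] (1 : AQ k Q)) := by
    rw [coe_zUnit, TensorProduct.add_tmul, h1, Algebra.TensorProduct.tmul_mul_tmul, one_mul]
  have h4 : (1 : AQ k Q) ⊗ₜ[k] (zUnit k Q p).val =
      1 + ((1 : AQ k Q) ⊗ₜ[k] 𝐱 p) * ((1 : AQ k Q) ⊗ₜ[k] 𝐱 p.swap) := by
    rw [coe_zUnit, TensorProduct.tmul_add, h1, Algebra.TensorProduct.tmul_mul_tmul, one_mul]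
  rw [h2, h.arr_arr, h.arr_arr, arrowBracket, arrowBracket, Sum.swap_swap]
  simp only [mul_add, add_mul, mul_sub, sub_mul, smul_add, mul_smul_comm, smul_mul_assoc] at hpair ⊢
  have h5 := hpair
  rw [h3, h4] at h5 ⊢
  simp only [mul_add, add_mul, one_mul, mul_one, mul_assoc, smul_add] at h5 ⊢
  linear_combination (norm := abel) h5

/-- Inverting 1 + pp* exchanges the roles of O + η and O - η on the diagonal. As the exponent equals
η(p), both cases give the same formula without a sign. -/
theorem OrderDatum.bracket_factor [CharZero k] (h : IsFormBracket Q D.form D.scalar br)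
    (c p : E ⊕ E) : br (𝐱 c) (D.factor p).val =
      ((D.factor p).val ⊗ₜ[k] (1 : AQ k Q)) * gaugeTerm Q (D.form + diagForm) c p
        - gaugeTerm Q (D.form - diagForm) c p *
          ((1 : AQ k Q) ⊗ₜ[k] (D.factor p).val) := by
  have hz := h.arr_zUnit D.scalar_swap c p
  rcases Int.units_eq_one_or (D.sign p) with hs | hs
  · have : D.factor p = zUnit k Q p := by simp [factor, hs]
    rw [this, hz, gaugeTerm_add, gaugeTerm_sub]
    simp [scalar, hs]
  · have : D.factor p = (zUnit k Q p)⁻¹ := by simp [factor, hs]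
    rw [this, (h.isDoubleBracket.isDer_right _).map_inv (zUnit k Q p).mul_inv (zUnit k Q p).inv_mul,
      hz, gaugeTerm_add, gaugeTerm_sub]
    have h1 : ((zUnit k Q p)⁻¹).val ⊗ₜ[k] (1 : AQ k Q) *
      ((zUnit k Q p).val ⊗ₜ[k] (1 : AQ k Q)) = 1 := by simp; rfl
    have h2 : ((1 : AQ k Q) ⊗ₜ[k] (zUnit k Q p).val) *
      ((1 : AQ k Q) ⊗ₜ[k] ((zUnit k Q p)⁻¹).val) = 1 := by simp; rfl
    simp only [scalar, hs, Algebra.TensorProduct.includeLeft_apply,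
      Algebra.TensorProduct.includeRight_apply, Units.val_neg, Units.val_one, Int.cast_neg,
      Int.cast_one, neg_smul, one_smul, mul_sub, sub_mul]
    rw [← mul_assoc, h1]
    simp only [mul_assoc, h2, mul_one, one_mul]
    noncomm_ring

/-- Telescoping: the cut after one factor is the cut before the next, so the intermediate terms of
the Leibniz rule cancel. The prefix `pre` records the position in the list. -/
theorem OrderDatum.bracket_prod [CharZero k] (h : IsFormBracket Q D.form D.scalar br)
    (c : E ⊕ E) (s : I) (l : List (E ⊕ E)) : ∀ pre, D.list s = pre ++ l →
      br (𝐱 c) ((l.map D.factor).prod).val =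
        (((l.map D.factor).prod).val ⊗ₜ[k] (1 : AQ k Q)) *
            gaugeTerm Q (cutForm Q s (D.list s)) c c
          - gaugeTerm Q (cutForm Q s pre) c c *
            ((1 : AQ k Q) ⊗ₜ[k] ((l.map D.factor).prod).val) := by
  induction l with
  | nil =>
    intro pre hpre
    rw [List.append_nil] at hpre
    have h1 : (1 : AQ k Q) ⊗ₜ[k] (1 : AQ k Q) = (1 : AQ k Q ⊗[k] AQ k Q) := rfl
    simp [(h.isDoubleBracket.isDer_right _).map_one, hpre, h1]
  | cons p l ih =>
    intro pre hpre
    have ih' := ih (pre ++ [p]) (by rw [hpre]; simp)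
    rw [List.map_cons, List.prod_cons, Units.val_mul, h.isDoubleBracket.deriv, ih',
      D.bracket_factor h,
      gaugeTerm_congr (D.form_add_diagForm hpre c c) (D.form_add_diagForm hpre c.swap c),
      gaugeTerm_congr (D.form_sub_diagForm hpre c c) (D.form_sub_diagForm hpre c.swap c)]
    set X : AQ k Q := (D.factor p).val
    set Y : AQ k Q := ((l.map D.factor).prod).val
    have h1 : (X * Y) ⊗ₜ[k] (1 : AQ k Q) = (X ⊗ₜ[k] (1 : AQ k Q)) * (Y ⊗ₜ[k] (1 : AQ k Q)) := by
      simp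
    have h2 : (1 : AQ k Q) ⊗ₜ[k] (X * Y) = ((1 : AQ k Q) ⊗ₜ[k] X) * ((1 : AQ k Q) ⊗ₜ[k] Y) := by
      simp
    rw [h1, h2]
    simp only [mul_sub, sub_mul, mul_assoc]
    abel

/-- The moment map property. -/
theorem OrderDatum.isMultMomentMap [CharZero k] (h : IsFormBracket Q D.form D.scalar br) :
    IsMultMomentMap (idem k Q) br D.moment := by
  classical
  refine ⟨fun s => by rw [idem_mul_moment, moment_mul_idem], D.isUnit_sum_moment, fun s a => ?_⟩
  -- As a function of a, the required value is the inner derivation a m - m a, so both sides can be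
  -- compared on arrows alone.
  let m : AQ k Q ⊗[k] AQ k Q := (1 / 2 : k) • (𝐞 s ⊗ₜ[k] D.moment s + D.moment s ⊗ₜ[k] 𝐞 s)
  let d : AQ k Q →ₗ[k] AQ k Q ⊗[k] AQ k Q :=
    LinearMap.mulRight k m ∘ₗ (includeLeft : AQ k Q →ₐ[k] AQ k Q ⊗[k] AQ k Q).toLinearMap
      - LinearMap.mulLeft k m ∘ₗ (includeRight : AQ k Q →ₐ[k] AQ k Q ⊗[k] AQ k Q).toLinearMap
  have hd : ∀ a, d a = (1 / 2 : k) • ((a * 𝐞 s) ⊗ₜ[k] D.moment s - 𝐞 s ⊗ₜ[k] (D.moment s * a)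
      + (a * D.moment s) ⊗ₜ[k] 𝐞 s - D.moment s ⊗ₜ[k] (𝐞 s * a)) := by
    intro a
    simp only [d, m, LinearMap.sub_apply, LinearMap.comp_apply, AlgHom.toLinearMap_apply,
      LinearMap.mulRight_apply, LinearMap.mulLeft_apply, Algebra.TensorProduct.includeLeft_apply,
      Algebra.TensorProduct.includeRight_apply, mul_smul_comm, smul_mul_assoc, mul_add, add_mul,
      Algebra.TensorProduct.tmul_mul_tmul, one_mul, mul_one]
    module
  have hd' : IsDer (includeLeft : AQ k Q →ₐ[k] AQ k Q ⊗[k] AQ k Q) includeRight d := by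
    intro a b
    simp only [d, LinearMap.sub_apply, LinearMap.comp_apply, AlgHom.toLinearMap_apply,
      LinearMap.mulRight_apply, LinearMap.mulLeft_apply, map_mul, mul_sub, sub_mul, mul_assoc]
    abel
  rw [← hd]
  have hne : ∀ s', s' ≠ s → D.moment s * 𝐞 s' = 0 := fun s' hs => by
    rw [← moment_mul_idem, mul_assoc, idem_mul_of_ne hs.symm, mul_zero]
  have hne' : ∀ s', s' ≠ s → 𝐞 s' * D.moment s = 0 := fun s' hs => by
    rw [← idem_mul_moment, ← mul_assoc, idem_mul_of_ne hs, zero_mul]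
  refine (h.isDoubleBracket.isDer_right _).ext hd' (fun s' => ?_) (fun c => ?_) a
  · rw [(h.isBLinear s' _).2, hd]
    by_cases hs : s' = s
    · subst hs
      rw [idem_mul_self, idem_mul_moment, moment_mul_idem]
      module
    · rw [idem_mul_of_ne hs, idem_mul_of_ne (Ne.symm hs), hne s' hs, hne' s' hs]
      simp
  · rw [h.isDoubleBracket.antisymm]
    have h1 : br (𝐱 c) (D.moment s) =
        (D.moment s ⊗ₜ[k] (1 : AQ k Q)) * gaugeTerm Q (cutForm Q s (D.list s)) c c
          + (𝐞 s ⊗ₜ[k] (1 : AQ k Q)) * gaugeTerm Q (cutForm Q s (D.list s)) c c *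
            ((1 : AQ k Q) ⊗ₜ[k] (D.factorProd s).val) := by
      -- Before the list all half-edges at s count as later, after it all count as earlier, so the
      -- extreme cuts have opposite gauge terms.
      have hcut : gaugeTerm Q (cutForm Q s []) c c =
          -gaugeTerm (k := k) Q (cutForm Q s (D.list s)) c c := by
        have hc : ∀ q, cutForm (k := k) Q s [] q c = -cutForm (k := k) Q s (D.list s) q c := by
          intro q
          simp only [cutForm, D.mem_list]
          split_ifs <;> simp_all
        rw [gaugeTerm, gaugeTerm, hc, hc]
        module
      have hm : D.moment s ⊗ₜ[k] (1 : AQ k Q) =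
          (𝐞 s ⊗ₜ[k] (1 : AQ k Q)) * ((D.factorProd s).val ⊗ₜ[k] (1 : AQ k Q)) := by
        simp [moment]
      rw [hm]
      rw [moment, h.isDoubleBracket.deriv, (h.isBLinear s _).2, zero_mul, zero_add,
        factorProd, D.bracket_prod h c s (D.list s) [] rfl, hcut]
      noncomm_ring
    rw [h1, hd]
    have hG : 𝐞 s * (D.factorProd s).val = D.moment s := rfl
    have hcl : 𝐭 c ≠ s → D.moment s * 𝐱 c = 0 ∧ 𝐞 s * 𝐱 c = 0 := fun hs => by
      rw [← moment_mul_idem, mul_assoc, idem_mul_arr_of_ne (Ne.symm hs), mul_zero]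
      exact ⟨rfl, rfl⟩
    have hcr : 𝐭 c.swap ≠ s → 𝐱 c * D.moment s = 0 ∧ 𝐱 c * 𝐞 s = 0 := fun hs => by
      rw [← idem_mul_moment, ← mul_assoc, arr_mul_idem_of_ne (Ne.symm hs), zero_mul]
      exact ⟨rfl, rfl⟩
    have hcG : 𝐭 c.swap = s → 𝐱 c * (D.factorProd s).val = 𝐱 c * D.moment s := by
      intro hs
      rw [moment, ← mul_assoc, ← hs, arr_mul_idem]
    have hce : 𝐭 c.swap = s → 𝐱 c * 𝐞 s = 𝐱 c := by
      intro hs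
      rw [← hs, arr_mul_idem]
    -- Four cases, according to which ends of c lie at s; a gauge contribution exists only at such
    -- an end.
    by_cases h2 : 𝐭 c = s
    · by_cases h3 : 𝐭 c.swap = s
      · simp only [gaugeTerm, cutForm, D.mem_list, h2, h3, if_true, if_false, mul_smul_comm,
          smul_mul_assoc, mul_sub, sub_mul, Algebra.TensorProduct.tmul_mul_tmul, one_mul, mul_one,
          map_add, map_sub, map_smul, TensorProduct.comm_tmul, one_smul, zero_smul, hG,
          moment_mul_idem, idem_mul_self, TensorProduct.zero_tmul, TensorProduct.tmul_zero,
          mul_zero, zero_mul, map_zero, hcG h3, hce h3]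
        module
      · simp only [gaugeTerm, cutForm, D.mem_list, h2, h3, if_true, if_false, mul_smul_comm,
          smul_mul_assoc, mul_sub, sub_mul, Algebra.TensorProduct.tmul_mul_tmul, one_mul, mul_one,
          map_add, map_sub, map_smul, TensorProduct.comm_tmul, one_smul, zero_smul, hG,
          moment_mul_idem, idem_mul_self, TensorProduct.zero_tmul, TensorProduct.tmul_zero,
          mul_zero, zero_mul, map_zero, (hcr h3).1, (hcr h3).2]
        module
    · by_cases h3 : 𝐭 c.swap = s
      · simp only [gaugeTerm, cutForm, D.mem_list, h2, h3, if_true, if_false, mul_smul_comm,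
          smul_mul_assoc, mul_sub, sub_mul, Algebra.TensorProduct.tmul_mul_tmul, one_mul, mul_one,
          map_add, map_sub, map_smul, TensorProduct.comm_tmul, one_smul, zero_smul, hG,
          moment_mul_idem, idem_mul_self, TensorProduct.zero_tmul, TensorProduct.tmul_zero,
          mul_zero, zero_mul, map_zero, hcG h3, hce h3, (hcl h2).1, (hcl h2).2]
        module
      · simp only [gaugeTerm, cutForm, D.mem_list, h2, h3, if_true, if_false, mul_smul_comm,
          smul_mul_assoc, mul_sub, sub_mul, Algebra.TensorProduct.tmul_mul_tmul, one_mul, mul_one,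
          map_add, map_sub, map_smul, TensorProduct.comm_tmul, one_smul, zero_smul, hG,
          moment_mul_idem, idem_mul_self, TensorProduct.zero_tmul, TensorProduct.tmul_zero,
          mul_zero, zero_mul, map_zero, (hcr h3).1, (hcr h3).2, (hcl h2).1, (hcl h2).2]
        module

end Moment

/-! ### The datum of a quiver with orderings -/

section Standard

variable (k : Type z) [Field k] {I : Type u} {E : Type v} [DecidableEq I]
variable {Q : FinQuiver I E} (o : Q.Ordering)

theorem ordForm_coe {s : I} (p q : Q.T s) : ordForm k Q o p.1 q.1 =
    (letI := o s; if p < q then 1 else if q < p then -1 else 0) := by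
  obtain ⟨p, rfl⟩ := p
  rw [ordForm, FinQuiver.ordFun, dif_pos ⟨rfl, q.2⟩]
  dsimp only
  split_ifs <;> simp

/-- For three distinct elements, two of the cyclic products are -1 and one is 1. If exactly two
elements coincide, a single product survives, and it is -1. -/
theorem ordForm_isOrderForm : IsOrderForm Q (ordForm k Q o) where
  toIsTailForm := ordForm_isTailForm k o
  quadratic p q r hpq hqr hne := by
    have h1 := ordForm_coe k o (⟨p, rfl⟩ : Q.T (Q.double.t p)) ⟨q, hpq.symm⟩
    have h2 := ordForm_coe k o (⟨q, hpq.symm⟩ : Q.T (Q.double.t p)) ⟨r, (hpq.trans hqr).symm⟩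
    have h3 := ordForm_coe k o (⟨r, (hpq.trans hqr).symm⟩ : Q.T (Q.double.t p)) ⟨p, rfl⟩
    dsimp only at h1 h2 h3
    rw [h1, h2, h3]
    have hne' : ¬((⟨p, rfl⟩ : Q.T (Q.double.t p)) = ⟨q, hpq.symm⟩ ∧
        (⟨q, hpq.symm⟩ : Q.T (Q.double.t p)) = ⟨r, (hpq.trans hqr).symm⟩) := by
      simpa [Subtype.ext_iff] using hne
    generalize (⟨p, rfl⟩ : Q.T (Q.double.t p)) = p' at *
    generalize (⟨q, hpq.symm⟩ : Q.T (Q.double.t p)) = q' at *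
    generalize (⟨r, (hpq.trans hqr).symm⟩ : Q.T (Q.double.t p)) = r' at *
    clear h1 h2 h3
    let := o (Q.double.t p)
    rcases lt_trichotomy p' q' with h | h | h <;> rcases lt_trichotomy q' r' with h' | h' | h' <;>
      rcases lt_trichotomy r' p' with h'' | h'' | h'' <;>
      first
      | (exfalso; order)
      | (exfalso; exact hne' ⟨h, h'⟩)
      | simp [h, h', h'', h.not_gt, h'.not_gt, h''.not_gt]

/-- The datum of a quiver with orderings. -/
def stdDatum [Fintype E] : OrderDatum k Q where
  form := ordForm k Q o
  sign := stdSign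
  list s := (Q.sortedT o s).map Subtype.val
  isTailForm := ordForm_isTailForm k o
  sign_swap := stdSign_swap
  mem_list s p := by simp [FinQuiver.sortedT]
  pairwise s := by
    rw [List.pairwise_map]
    let := o s
    refine List.Pairwise.imp (fun {p q} h => ?_)
      (Finset.sortedLT_sort (Finset.univ : Finset (Q.T s))).pairwise
    rw [ordForm_coe]
    exact if_pos h

/-- The factors of Φ_s live in the corner algebra with unit e_s. As e_s commutes with the units of
A_Q that represent them, all copies of e_s can be absorbed into one. -/
theorem momentMap_eq [Fintype I] [Fintype E] : momentMap k Q o = (stdDatum k o).moment := by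
  funext s
  have hf : ∀ p : Q.T s, momentFactor k Q s p.1 =
      idem k Q s * ((stdDatum k o).factor p.1).val ∧ momentFactor k Q s p.1 =
        ((stdDatum k o).factor p.1).val * idem k Q s := by
    rintro ⟨p, rfl⟩
    have hc := ((stdDatum k o).commute_idem_factor p).eq
    suffices momentFactor k Q (Q.double.t p) p =
      idem k Q (Q.double.t p) * ((stdDatum k o).factor p).val from ⟨this, this.trans hc⟩
    rcases p with a | a
    · have : (stdDatum k o).factor (Sum.inl a) = zUnit k Q (Sum.inl a) := by
        simp [OrderDatum.factor, stdDatum, stdSign]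
      rw [this, coe_zUnit, mul_add, mul_one, ← mul_assoc, idem_mul_arr]
      rfl
    · have : (stdDatum k o).factor (Sum.inr a) = (zUnit k Q (Sum.inr a))⁻¹ := by
        simp [OrderDatum.factor, stdDatum, stdSign]
      rw [this] at hc ⊢
      have : momentFactor k Q (Q.double.t (Sum.inr a)) (Sum.inr a) =
        idem k Q (Q.double.t (Sum.inr a)) * ((zUnit k Q (Sum.inr a))⁻¹).val *
          idem k Q (Q.double.t (Sum.inr a)) := rfl
      rw [this, mul_assoc, ← hc, ← mul_assoc, idem_mul_self]
  have key : ∀ l : List (Q.T s), idem k Q s * (l.map fun a => momentFactor k Q s a.1).prod =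
      idem k Q s * (((l.map Subtype.val).map (stdDatum k o).factor).prod).val := by
    intro l
    induction l with
    | nil => simp
    | cons p l ih =>
      simp only [List.map_cons, List.prod_cons, Units.val_mul]
      rw [(hf p).1, mul_assoc, ← mul_assoc, idem_mul_self, ← mul_assoc, ← (hf p).1, (hf p).2,
        mul_assoc, ih, ← mul_assoc, ← (hf p).2, (hf p).1, mul_assoc]
  exact key _

end Standard

/-! ### Isomorphisms between the structures of two data -/

section Equivalence

open Algebra.TensorProduct (includeLeft includeRight)

variable {k : Type z} [Field k] {I : Type u} [Fintype I]
variable {E' : Type w} {Q' : FinQuiver I E'} {E : Type v} {Q : FinQuiver I E}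

/-- The double bracket defined by a datum. -/
def OrderDatum.br (D : OrderDatum k Q) : AQ k Q →ₗ[k] AQ k Q →ₗ[k] AQ k Q ⊗[k] AQ k Q :=
  (exists_isFormBracket D.isTailForm D.scalar_swap).choose

theorem OrderDatum.isFormBracket_br (D : OrderDatum k Q) :
    IsFormBracket Q D.form D.scalar D.br :=
  (exists_isFormBracket D.isTailForm D.scalar_swap).choose_spec

theorem OrderDatum.isDoubleBracket_br (D : OrderDatum k Q) : IsDoubleBracket D.br :=
  D.isFormBracket_br.isDoubleBracket

/-- The quasi-Hamiltonian structures of two data are isomorphic over `B`. -/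
def OrderDatum.Equivalent (D : OrderDatum k Q) (D' : OrderDatum k Q') : Prop :=
  ∃ ψ : AQ k Q ≃ₐ[k] AQ k Q', (∀ s, ψ (idem k Q s) = idem k Q' s) ∧
    (∀ a b, D'.br (ψ a) (ψ b) = TensorProduct.map ψ.toLinearMap ψ.toLinearMap (D.br a b)) ∧
    ∀ s, ψ (D.moment s) = D'.moment s

theorem OrderDatum.Equivalent.refl (D : OrderDatum k Q) : D.Equivalent D :=
  ⟨AlgEquiv.refl, fun _ => rfl, fun a b => by
    have : (AlgEquiv.refl : AQ k Q ≃ₐ[k] AQ k Q).toLinearMap = LinearMap.id := rfl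
    rw [this, TensorProduct.map_id]
    rfl, fun _ => rfl⟩

theorem OrderDatum.Equivalent.trans {E'' : Type*} {Q'' : FinQuiver I E''} {D : OrderDatum k Q}
    {D' : OrderDatum k Q'} {D'' : OrderDatum k Q''} (h : D.Equivalent D') (h' : D'.Equivalent D'') :
    D.Equivalent D'' := by
  obtain ⟨ψ, h1, h2, h3⟩ := h
  obtain ⟨ψ', h1', h2', h3'⟩ := h'
  refine ⟨ψ.trans ψ', fun s => by simp [h1, h1'], fun a b => ?_, fun s => by simp [h3, h3']⟩
  have : (ψ.trans ψ').toLinearMap = ψ'.toLinearMap ∘ₗ ψ.toLinearMap := rfl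
  rw [this, TensorProduct.map_comp, LinearMap.comp_apply, ← h2, ← h2']
  rfl

/-- The map `ψ ⊗ ψ` as an algebra map. -/
def tensorSq (ψ : AQ k Q →ₐ[k] AQ k Q') : AQ k Q ⊗[k] AQ k Q →ₐ[k] AQ k Q' ⊗[k] AQ k Q' :=
  Algebra.TensorProduct.map ψ ψ

@[simp]
theorem tensorSq_tmul (ψ : AQ k Q →ₐ[k] AQ k Q') (a b : AQ k Q) :
    tensorSq ψ (a ⊗ₜ[k] b) = ψ a ⊗ₜ[k] ψ b := by
  simp [tensorSq]

theorem tensorSq_comm (ψ : AQ k Q →ₐ[k] AQ k Q') (x : AQ k Q ⊗[k] AQ k Q) :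
    tensorSq ψ (TensorProduct.comm k _ _ x) = TensorProduct.comm k _ _ (tensorSq ψ x) := by
  induction x using TensorProduct.induction_on with
  | zero => simp
  | add x y hx hy => simp [hx, hy]
  | tmul x y => simp

variable {br : AQ k Q →ₗ[k] AQ k Q →ₗ[k] AQ k Q ⊗[k] AQ k Q}
variable {br' : AQ k Q' →ₗ[k] AQ k Q' →ₗ[k] AQ k Q' ⊗[k] AQ k Q'} {ψ : AQ k Q →ₐ[k] AQ k Q'}

theorem bracket_map_symm (hb : IsDoubleBracket br) (hb' : IsDoubleBracket br') {a b : AQ k Q}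
    (h : br' (ψ a) (ψ b) = tensorSq ψ (br a b)) : br' (ψ b) (ψ a) = tensorSq ψ (br b a) := by
  rw [hb'.antisymm, h, hb.antisymm b a, map_neg, tensorSq_comm]

variable (ψ) in
/-- The defect of compatibility with brackets. -/
def bracketDefect (br : AQ k Q →ₗ[k] AQ k Q →ₗ[k] AQ k Q ⊗[k] AQ k Q)
    (br' : AQ k Q' →ₗ[k] AQ k Q' →ₗ[k] AQ k Q' ⊗[k] AQ k Q') (a : AQ k Q) :
    AQ k Q →ₗ[k] AQ k Q' ⊗[k] AQ k Q' :=
  br' (ψ a) ∘ₗ ψ.toLinearMap - (tensorSq ψ).toLinearMap ∘ₗ br a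

theorem bracketDefect_apply (a b : AQ k Q) :
    bracketDefect ψ br br' a b = br' (ψ a) (ψ b) - tensorSq ψ (br a b) := rfl

theorem isDer_bracketDefect (hb : IsDoubleBracket br) (hb' : IsDoubleBracket br') (a : AQ k Q) :
    IsDer ((includeLeft : AQ k Q' →ₐ[k] AQ k Q' ⊗[k] AQ k Q').comp ψ)
      ((includeRight : AQ k Q' →ₐ[k] AQ k Q' ⊗[k] AQ k Q').comp ψ) (bracketDefect ψ br br' a) := by
  intro b c
  simp only [bracketDefect_apply, map_mul, hb.deriv, hb'.deriv, map_add, tensorSq_tmul, map_one,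
    AlgHom.comp_apply, Algebra.TensorProduct.includeLeft_apply,
    Algebra.TensorProduct.includeRight_apply]
  noncomm_ring

/-- Compatibility with brackets may be checked on arrows. -/
theorem bracket_map_of_arr (hb : IsDoubleBracket br) (hb' : IsDoubleBracket br')
    (hB : IsBLinear (idem k Q) br) (hB' : IsBLinear (idem k Q') br')
    (he : ∀ s, ψ (idem k Q s) = idem k Q' s)
    (harr : ∀ p q, br' (ψ (arr k Q p)) (ψ (arr k Q q)) = tensorSq ψ (br (arr k Q p) (arr k Q q)))
    (a b : AQ k Q) : br' (ψ a) (ψ b) = tensorSq ψ (br a b) := by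
  have hs : ∀ a s, bracketDefect ψ br br' a (idem k Q s) = 0 := fun a s => by
    rw [bracketDefect_apply, he, (hB s _).2, (hB' s _).2, map_zero, sub_zero]
  -- The defect is a derivation only in its second argument; antisymmetry of both brackets exchanges
  -- the arguments between the two passes.
  have h1 : ∀ p b, br' (ψ (arr k Q p)) (ψ b) = tensorSq ψ (br (arr k Q p) b) := fun p b =>
    sub_eq_zero.1 ((isDer_bracketDefect hb hb' (arr k Q p)).eq_zero (hs _)
      (fun q => sub_eq_zero.2 (harr p q)) b)
  exact sub_eq_zero.1 ((isDer_bracketDefect hb hb' a).eq_zero (hs _)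
      (fun q => sub_eq_zero.2 (bracket_map_symm hb hb' (h1 q a))) b)

theorem OrderDatum.equivalent_of_arr {D : OrderDatum k Q} {D' : OrderDatum k Q'}
    (ψ : AQ k Q →ₐ[k] AQ k Q') (ψ' : AQ k Q' →ₐ[k] AQ k Q) (h₁ : ψ.comp ψ' = AlgHom.id k _)
    (h₂ : ψ'.comp ψ = AlgHom.id k _) (he : ∀ s, ψ (idem k Q s) = idem k Q' s)
    (harr : ∀ p q, D'.br (ψ (arr k Q p)) (ψ (arr k Q q)) =
      tensorSq ψ (arrowBracket Q D.form D.scalar p q))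
    (hm : ∀ s, ψ (D.moment s) = D'.moment s) : D.Equivalent D' := by
  refine ⟨AlgEquiv.ofAlgHom ψ ψ' h₁ h₂, he, fun a b => ?_, hm⟩
  exact bracket_map_of_arr D.isDoubleBracket_br D'.isDoubleBracket_br D.isFormBracket_br.isBLinear
    D'.isFormBracket_br.isBLinear he (fun p q => by rw [harr, D.isFormBracket_br.arr_arr]) a b

theorem OrderDatum.map_factor (D : OrderDatum k Q)
    {ψ : AQ k Q →ₐ[k] AQ k Q'} {p : E ⊕ E} {u : (AQ k Q')ˣ} (hz : ψ (zUnit k Q p).val = u.val) :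
    Units.map (ψ : AQ k Q →* AQ k Q') (D.factor p) = u ^ (D.sign p : ℤ) := by
  rw [OrderDatum.factor, map_zpow]
  congr 1
  exact Units.ext hz

/-- The moment maps correspond if the factors do. -/
theorem OrderDatum.map_moment {D : OrderDatum k Q} {D' : OrderDatum k Q'}
    {ψ : AQ k Q →ₐ[k] AQ k Q'} (he : ∀ s, ψ (idem k Q s) = idem k Q' s) {s : I}
    (f : E ⊕ E → E' ⊕ E') (hl : D'.list s = (D.list s).map f)
    (hf : ∀ p ∈ D.list s, Units.map (ψ : AQ k Q →* AQ k Q') (D.factor p) = D'.factor (f p)) :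
    ψ (D.moment s) = D'.moment s := by
  have h : Units.map (ψ : AQ k Q →* AQ k Q') (D.factorProd s) = D'.factorProd s := by
    rw [factorProd, factorProd, map_list_prod, List.map_map, hl, List.map_map]
    congr 1
    exact List.map_congr_left hf
  rw [moment, moment, map_mul, he, ← h]
  rfl

end Equivalence

/-! ### Relabelling of arrows -/

section Relabel

variable {k : Type z} [Field k] {I : Type u}
variable {E' : Type w} {Q' : FinQuiver I E'} {E : Type v} {Q : FinQuiver I E}

/-- The transport of a datum along a bijection of arrows compatible with the involution. -/
def OrderDatum.relabel (D : OrderDatum k Q) (φ : E ⊕ E ≃ E' ⊕ E') (hφ : ∀ p, φ p.swap = (φ p).swap)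
    (ht : ∀ p, Q'.double.t (φ p) = Q.double.t p) : OrderDatum k Q' where
  form p q := D.form (φ.symm p) (φ.symm q)
  sign p := D.sign (φ.symm p)
  list s := (D.list s).map φ
  isTailForm := ⟨fun _ _ => D.isTailForm.antisymm _ _, fun p q h =>
    D.isTailForm.eq_zero _ _ (by rwa [← ht, ← ht, φ.apply_symm_apply, φ.apply_symm_apply])⟩
  sign_swap p := by
    rw [← D.sign_swap]
    congr 1
    rw [φ.symm_apply_eq, hφ, φ.apply_symm_apply]
  mem_list s p := by
    obtain ⟨p, rfl⟩ := φ.surjective p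
    simp [D.mem_list, ht]
  pairwise s := by
    rw [List.pairwise_map]
    simpa using D.pairwise s

variable [Fintype I]

theorem exists_relabel_algHom (φ : E ⊕ E ≃ E' ⊕ E') (hφ : ∀ p, φ p.swap = (φ p).swap)
    (ht : ∀ p, Q'.double.t (φ p) = Q.double.t p) : ∃ ψ : AQ k Q →ₐ[k] AQ k Q',
      (∀ s, ψ (idem k Q s) = idem k Q' s) ∧ ∀ p, ψ (arr k Q p) = arr k Q' (φ p) := by
  refine AQ.exists_lift (idem k Q') (fun p => arr k Q' (φ p)) idem_mul_self
    (fun _ _ h => idem_mul_of_ne h) (sum_idem k Q') (fun p => ?_) (fun p => ?_)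
  · rw [← ht, ← ht, hφ, idem_mul_arr, arr_mul_idem]
  · rw [hφ, ← coe_zUnit]
    exact (zUnit k Q' (φ p)).isUnit

theorem OrderDatum.equivalent_relabel (D : OrderDatum k Q) (φ : E ⊕ E ≃ E' ⊕ E')
    (hφ : ∀ p, φ p.swap = (φ p).swap) (ht : ∀ p, Q'.double.t (φ p) = Q.double.t p) :
    D.Equivalent (D.relabel φ hφ ht) := by
  obtain ⟨ψ, he, ha⟩ := exists_relabel_algHom (k := k) φ hφ ht
  obtain ⟨ψ', he', ha'⟩ := exists_relabel_algHom (k := k) (Q := Q') (Q' := Q) φ.symm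
    (fun p => by rw [φ.symm_apply_eq, hφ, φ.apply_symm_apply])
    (fun p => by rw [← ht, φ.apply_symm_apply])
  refine equivalent_of_arr ψ ψ' (AQ.algHom_ext (by simp [he, he']) (by simp [ha, ha']))
    (AQ.algHom_ext (by simp [he, he']) (by simp [ha, ha'])) he (fun p q => ?_) (fun s => ?_)
  · have hg : ∀ c p, tensorSq ψ (gaugeTerm Q D.form c p) =
        gaugeTerm Q' (D.relabel φ hφ ht).form (φ c) (φ p) := fun c p => by
      simp only [gaugeTerm, map_smul, map_sub, tensorSq_tmul, he, ha, relabel, ← hφ, ht,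
        Equiv.symm_apply_apply]
    have hp : tensorSq ψ (pairTerm k Q p) = pairTerm k Q' (φ p) := by
      simp only [pairTerm, map_smul, map_add, map_mul, tensorSq_tmul, he, ha, ← hφ, ht]
    have hs : (D.relabel φ hφ ht).scalar (φ p) = D.scalar p := by simp [scalar, relabel]
    rw [ha, ha, (isFormBracket_br _).arr_arr, arrowBracket, arrowBracket]
    simp only [map_add, map_sub, map_mul, tensorSq_tmul, hg, ha, map_one, hs, ← hφ]
    congr 1
    by_cases h : q = p.swap
    · rw [if_pos h, if_pos (by rw [h, hφ]), map_smul, hp]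
    · rw [if_neg h, if_neg (fun h' => h (φ.injective (by rw [h', hφ]))), map_zero]
  · refine map_moment he φ rfl fun p _ => ?_
    have : ψ (zUnit k Q p).val = (zUnit k Q' (φ p)).val := by
      simp only [coe_zUnit, map_add, map_one, map_mul, ha, hφ]
    rw [D.map_factor this, factor]
    simp [relabel]

end Relabel

/-! ### Reversal of the sign of an arrow -/

section Flip

variable {k : Type z} [Field k] {I : Type u} {E : Type v} {Q : FinQuiver I E}

open Classical in
/-- The datum with the opposite signs at `a` and `a^*`. -/
def OrderDatum.flip (D : OrderDatum k Q) (a : E ⊕ E) : OrderDatum k Q where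
  form := D.form
  sign p := if p = a ∨ p = a.swap then -D.sign p else D.sign p
  list := D.list
  isTailForm := D.isTailForm
  sign_swap p := by
    have : p.swap = a ∨ p.swap = a.swap ↔ p = a ∨ p = a.swap := by
      rw [← Sum.swap_leftInverse.injective.eq_iff (a := p.swap) (b := a), Sum.swap_swap,
        Sum.swap_leftInverse.injective.eq_iff, or_comm]
    simp only [this, D.sign_swap]
    split_ifs <;> rfl
  mem_list := D.mem_list
  pairwise := D.pairwise

theorem OrderDatum.flip_sign_self (D : OrderDatum k Q) (a : E ⊕ E) :
    (D.flip a).sign a = -D.sign a := by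
  simp [flip]

theorem OrderDatum.flip_sign_swap (D : OrderDatum k Q) (a : E ⊕ E) :
    (D.flip a).sign a.swap = -D.sign a.swap := by
  simp [flip]

theorem OrderDatum.flip_sign_of_ne (D : OrderDatum k Q) {a p : E ⊕ E} (h : p ≠ a)
    (h' : p ≠ a.swap) : (D.flip a).sign p = D.sign p := by
  simp [flip, h, h']

variable [Fintype I] (a : E ⊕ E)

local notation "𝐞" => idem k Q
local notation "𝐱" => arr k Q
local notation "𝐭" => FinQuiver.t (FinQuiver.double Q)

variable (k Q) in
/-- The element `-(1 + a a^*)⁻¹ a`. -/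
def flipArr : AQ k Q := -(((zUnit k Q a)⁻¹).val * 𝐱 a)

theorem zUnit_mul_flipArr : (zUnit k Q a).val * flipArr k Q a = -𝐱 a := by
  rw [flipArr, mul_neg, Units.mul_inv_cancel_left]

theorem zUnit_inv_mul_arr : ((zUnit k Q a)⁻¹).val * 𝐱 a = -flipArr k Q a := by
  rw [flipArr, neg_neg]

theorem arr_mul_flipArr : 𝐱 a * (𝐱 a.swap * flipArr k Q a) = -𝐱 a - flipArr k Q a := by
  rw [← zUnit_mul_flipArr, coe_zUnit]
  noncomm_ring

theorem flipArr_mul_zUnit : flipArr k Q a * (zUnit k Q a.swap).val = -𝐱 a := by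
  have : 𝐱 a * (zUnit k Q a.swap).val = (zUnit k Q a).val * 𝐱 a := by
    rw [coe_zUnit, coe_zUnit, Sum.swap_swap]
    noncomm_ring
  rw [flipArr, neg_mul, mul_assoc, this, Units.inv_mul_cancel_left]

theorem idem_mul_flipArr : 𝐞 (𝐭 a) * flipArr k Q a = flipArr k Q a := by
  rw [flipArr, mul_neg, ← mul_assoc, (commute_idem_zUnit a).units_inv_right.eq, mul_assoc,
    idem_mul_arr]

theorem flipArr_mul_idem : flipArr k Q a * 𝐞 (𝐭 a.swap) = flipArr k Q a := by
  rw [flipArr, neg_mul, mul_assoc, arr_mul_idem]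

theorem one_add_flipArr_mul : 1 + flipArr k Q a * 𝐱 a.swap = ((zUnit k Q a)⁻¹).val := by
  have : 𝐱 a * 𝐱 a.swap = (zUnit k Q a).val - 1 := by rw [coe_zUnit, add_sub_cancel_left]
  rw [flipArr, neg_mul, mul_assoc, this, mul_sub, Units.inv_mul, mul_one, neg_sub, add_sub_cancel]

theorem one_add_mul_flipArr : 1 + 𝐱 a.swap * flipArr k Q a = ((zUnit k Q a.swap)⁻¹).val := by
  have : (1 + 𝐱 a.swap * flipArr k Q a) * (zUnit k Q a.swap).val = 1 := by
    rw [add_mul, mul_assoc, flipArr_mul_zUnit, one_mul, coe_zUnit, Sum.swap_swap, mul_neg,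
      add_neg_cancel_right]
  exact Units.eq_inv_of_mul_eq_one_right this

/-- The substitution a ↦ -(1 + aa*)⁻¹a turns 1 + aa* and 1 + a*a into their inverses, so the
elements to be inverted stay invertible. -/
theorem exists_flip_algHom : ∃ ψ : AQ k Q →ₐ[k] AQ k Q, (∀ s, ψ (𝐞 s) = 𝐞 s) ∧
    ψ (𝐱 a) = flipArr k Q a ∧ ∀ p, p ≠ a → ψ (𝐱 p) = 𝐱 p := by
  classical
  have h1 : ∀ p, 𝐞 (𝐭 p) * Function.update 𝐱 a (flipArr k Q a) p * 𝐞 (𝐭 p.swap) =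
      Function.update 𝐱 a (flipArr k Q a) p := by
    intro p
    by_cases hp : p = a
    · subst hp
      rw [Function.update_self, idem_mul_flipArr, flipArr_mul_idem]
    · rw [Function.update_of_ne hp, idem_mul_arr, arr_mul_idem]
  have h2 : ∀ p, IsUnit (1 + Function.update 𝐱 a (flipArr k Q a) p *
      Function.update 𝐱 a (flipArr k Q a) p.swap) := by
    intro p
    by_cases hp : p = a
    · subst hp
      rw [Function.update_self, Function.update_of_ne (swap_ne p), one_add_flipArr_mul]
      exact Units.isUnit _
    · rw [Function.update_of_ne hp]
      by_cases hp' : p = a.swap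
      · subst hp'
        rw [Sum.swap_swap, Function.update_self, one_add_mul_flipArr]
        exact Units.isUnit _
      · rw [Function.update_of_ne (fun h => hp' (by rw [← h, Sum.swap_swap])), ← coe_zUnit]
        exact Units.isUnit _
  obtain ⟨ψ, h3, h4⟩ := AQ.exists_lift (k := k) (Q := Q) 𝐞 (Function.update 𝐱 a (flipArr k Q a))
    idem_mul_self (fun _ _ h => idem_mul_of_ne h) (sum_idem k Q) h1 h2
  exact ⟨ψ, h3, by rw [h4, Function.update_self], fun p hp => by
    rw [h4, Function.update_of_ne hp]⟩

variable {a}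

theorem flip_map_zUnit {ψ : AQ k Q →ₐ[k] AQ k Q} (ha : ψ (𝐱 a) = flipArr k Q a)
    (hp : ∀ p, p ≠ a → ψ (𝐱 p) = 𝐱 p) : ψ (zUnit k Q a).val = ((zUnit k Q a)⁻¹).val := by
  rw [coe_zUnit, map_add, map_one, map_mul, ha, hp _ (swap_ne a), one_add_flipArr_mul]

theorem flip_map_zUnit_swap {ψ : AQ k Q →ₐ[k] AQ k Q} (ha : ψ (𝐱 a) = flipArr k Q a)
    (hp : ∀ p, p ≠ a → ψ (𝐱 p) = 𝐱 p) :
    ψ (zUnit k Q a.swap).val = ((zUnit k Q a.swap)⁻¹).val := by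
  rw [coe_zUnit, map_add, map_one, map_mul, Sum.swap_swap, ha, hp _ (swap_ne a),
    one_add_mul_flipArr]

/-- Since z = 1 + aa* goes to z⁻¹, the element -z⁻¹a goes to -z(-z⁻¹a) = a. -/
theorem flip_comp_self {ψ : AQ k Q →ₐ[k] AQ k Q} (he : ∀ s, ψ (𝐞 s) = 𝐞 s)
    (ha : ψ (𝐱 a) = flipArr k Q a) (hp : ∀ p, p ≠ a → ψ (𝐱 p) = 𝐱 p) :
    ψ.comp ψ = AlgHom.id k _ := by
  refine AQ.algHom_ext (fun s => by simp [he]) (fun p => ?_)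
  by_cases h : p = a
  · subst h
    have h1 : ψ ((zUnit k Q p)⁻¹).val = (zUnit k Q p).val := by
      have := congrArg Units.val (map_inv (Units.map (ψ : AQ k Q →* AQ k Q)) (zUnit k Q p))
      have h2 : Units.map (ψ : AQ k Q →* AQ k Q) (zUnit k Q p) = (zUnit k Q p)⁻¹ :=
        Units.ext (flip_map_zUnit ha hp)
      rw [h2, inv_inv] at this
      exact this
    have h3 : ψ (flipArr k Q p) = 𝐱 p := by
      rw [flipArr, map_neg, map_mul, h1, ha, zUnit_mul_flipArr, neg_neg]
    rw [AlgHom.comp_apply, ha, h3, AlgHom.id_apply]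
  · rw [AlgHom.comp_apply, hp p h, hp p h, AlgHom.id_apply]

open Classical in
/-- The bracket of an arrow with `-(1 + a a^*)⁻¹ a`. -/
theorem IsFormBracket.arr_flipArr [CharZero k] {O : E ⊕ E → E ⊕ E → k} {η : E ⊕ E → k}
    {br : AQ k Q →ₗ[k] AQ k Q →ₗ[k] AQ k Q ⊗[k] AQ k Q} (h : IsFormBracket Q O η br)
    (hη : ∀ p, η p.swap = -η p) (c : E ⊕ E) :
    br (𝐱 c) (flipArr k Q a) = (flipArr k Q a ⊗ₜ[k] (1 : AQ k Q)) * gaugeTerm Q O c a.swap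
      - gaugeTerm Q O c a * ((1 : AQ k Q) ⊗ₜ[k] flipArr k Q a)
      - η a • (gaugeTerm Q diagForm c a * ((1 : AQ k Q) ⊗ₜ[k] flipArr k Q a))
      + (((zUnit k Q a)⁻¹).val ⊗ₜ[k] (1 : AQ k Q)) *
        (η a • (gaugeTerm Q diagForm c a * ((1 : AQ k Q) ⊗ₜ[k] 𝐱 a))
          - if a = c.swap then η c • pairTerm k Q c else 0) := by
  -- The bracket is found by solving the Leibniz rule for the product z · (-z⁻¹a) = -a, with z = 1 +
  -- aa*, in which the other brackets are known.
  have h1 := h.isDoubleBracket.deriv (𝐱 c) (zUnit k Q a).val (flipArr k Q a)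
  rw [zUnit_mul_flipArr, map_neg, h.arr_zUnit hη, h.arr_arr, arrowBracket] at h1
  have h2 : (((zUnit k Q a)⁻¹).val ⊗ₜ[k] (1 : AQ k Q)) *
      ((zUnit k Q a).val ⊗ₜ[k] (1 : AQ k Q)) = 1 := by
    simp only [Algebra.TensorProduct.tmul_mul_tmul, Units.inv_mul, one_mul]
    rfl
  have h3 : ((1 : AQ k Q) ⊗ₜ[k] (zUnit k Q a).val) * ((1 : AQ k Q) ⊗ₜ[k] flipArr k Q a) =
      -((1 : AQ k Q) ⊗ₜ[k] 𝐱 a) := by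
    rw [Algebra.TensorProduct.tmul_mul_tmul, zUnit_mul_flipArr, one_mul, TensorProduct.tmul_neg]
  have h4 : flipArr k Q a ⊗ₜ[k] (1 : AQ k Q) =
      -((((zUnit k Q a)⁻¹).val ⊗ₜ[k] (1 : AQ k Q)) * (𝐱 a ⊗ₜ[k] (1 : AQ k Q))) := by
    rw [Algebra.TensorProduct.tmul_mul_tmul, zUnit_inv_mul_arr, one_mul, TensorProduct.neg_tmul,
      neg_neg]
  have h5 := congrArg (fun x => (((zUnit k Q a)⁻¹).val ⊗ₜ[k] (1 : AQ k Q)) * x) h1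
  simp only [mul_add, add_mul, mul_sub, sub_mul, mul_assoc, h3, mul_neg, smul_mul_assoc] at h5
  simp only [← mul_assoc, mul_smul_comm, h2, one_mul] at h5
  rw [h4]
  simp only [mul_add, add_mul, mul_sub, sub_mul, mul_smul_comm, ← mul_assoc, neg_mul, mul_neg]
    at h5 ⊢
  linear_combination (norm := module) -h5

/-- The gauge terms of -(1 + aa*)⁻¹a have the same shape as those of a, and the form is unchanged.
Only the pair (a*, a) needs a computation, which absorbs the opposite sign. -/
theorem OrderDatum.flip_map_arr_of_ne [CharZero k] (D : OrderDatum k Q) {ψ : AQ k Q →ₐ[k] AQ k Q}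
    (he : ∀ s, ψ (𝐞 s) = 𝐞 s) (ha : ψ (𝐱 a) = flipArr k Q a) (hp : ∀ p, p ≠ a → ψ (𝐱 p) = 𝐱 p)
    (p q : E ⊕ E) (hpa : p ≠ a) : (D.flip a).br (ψ (𝐱 p)) (ψ (𝐱 q)) =
      tensorSq ψ (arrowBracket Q D.form D.scalar p q) := by
  classical
  have hg : ∀ q, tensorSq ψ (gaugeTerm Q D.form p q) = gaugeTerm Q D.form p q := fun q => by
    simp only [gaugeTerm, map_smul, map_sub, tensorSq_tmul, he, hp p hpa]
  rw [arrowBracket, map_add, map_sub, map_mul, map_mul, tensorSq_tmul, tensorSq_tmul, hg, hg,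
    map_one, hp p hpa]
  by_cases hq : q = a
  · subst hq
    rw [ha, (D.flip q).isFormBracket_br.arr_flipArr (D.flip q).scalar_swap]
    have hf : (D.flip q).form = D.form := rfl
    rw [hf, sub_add, sub_eq_add_neg _ (_ - _)]
    congr 1
    by_cases hpq : q = p.swap
    · obtain rfl : p = q.swap := by rw [hpq, Sum.swap_swap]
      have h1 : (D.flip q).scalar q = -D.scalar q := by simp [scalar, D.flip_sign_self]
      have h2 : (D.flip q).scalar q.swap = D.scalar q := by rw [scalar_swap, h1, neg_neg]
      have h3 : ((zUnit k Q q)⁻¹).val * 𝐞 (𝐭 q) = 𝐞 (𝐭 q) + flipArr k Q q * 𝐱 q.swap := by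
        rw [← one_add_flipArr_mul, add_mul, one_mul, mul_assoc, arr_swap_mul_idem]
      have h4 : ((zUnit k Q q)⁻¹).val * (𝐱 q * 𝐱 q.swap) = -(flipArr k Q q * 𝐱 q.swap) := by
        rw [← mul_assoc, zUnit_inv_mul_arr, neg_mul]
      simp only [gaugeTerm, diagForm, if_true, if_neg (swap_ne q), pairTerm, Sum.swap_swap, h1,
        h2, scalar_swap, mul_sub, mul_add, sub_mul, smul_mul_assoc, mul_smul_comm, zero_smul,
        one_smul, zero_sub, mul_neg, neg_mul, map_add, map_smul, map_mul, tensorSq_tmul, he, ha,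
        hp _ (swap_ne q), Algebra.TensorProduct.tmul_mul_tmul, one_mul, mul_one, h3, h4,
        TensorProduct.add_tmul, TensorProduct.neg_tmul, if_false]
      module
    · have h1 : gaugeTerm Q (diagForm (k := k)) p q = 0 := by
        simp [gaugeTerm, diagForm, hpa, Ne.symm hpq]
      rw [if_neg hpq, if_neg hpq, h1]
      simp
  · rw [hp q hq, (D.flip a).isFormBracket_br.arr_arr, arrowBracket]
    have hf : (D.flip a).form = D.form := rfl
    rw [hf]
    congr 1
    by_cases hpq : q = p.swap
    · have hpa' : p ≠ a.swap := fun h => hq (by rw [hpq, h, Sum.swap_swap])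
      have h1 : (D.flip a).scalar p = D.scalar p := by
        rw [scalar, scalar, flip_sign_of_ne D hpa hpa']
      subst hpq
      rw [if_pos rfl, if_pos rfl, h1]
      simp only [pairTerm, map_smul, map_add, tensorSq_tmul, map_mul, he, hp p hpa, hp _ hq]
    · rw [if_neg hpq, if_neg hpq, map_zero]

/-- With a' = -z⁻¹a and z = 1 + aa*, the bracket {{a', a'}} is found from the Leibniz expansion of
{{a', z a'}} = -{{a', a}}. The brackets of a' with a and a* are known from the previous results by
antisymmetry, and z ⊗ 1 can be cancelled. -/
theorem OrderDatum.flip_map_arr_self [CharZero k] (D : OrderDatum k Q) {ψ : AQ k Q →ₐ[k] AQ k Q}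
    (he : ∀ s, ψ (𝐞 s) = 𝐞 s) (ha : ψ (𝐱 a) = flipArr k Q a) (hp : ∀ p, p ≠ a → ψ (𝐱 p) = 𝐱 p) :
    (D.flip a).br (ψ (𝐱 a)) (ψ (𝐱 a)) = tensorSq ψ (arrowBracket Q D.form D.scalar a a) := by
  classical
  have hb := (D.flip a).isDoubleBracket_br
  have hF := (D.flip a).isFormBracket_br
  have hf : (D.flip a).form = D.form := rfl
  have hs : (D.flip a).scalar a = -D.scalar a := by simp [scalar, D.flip_sign_self]
  have h1 := hF.arr_flipArr (a := a) (D.flip a).scalar_swap a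
  have h2 := D.flip_map_arr_of_ne he ha hp a.swap a (swap_ne a)
  rw [ha, hp _ (swap_ne a), arrowBracket_eq D.isTailForm] at h2
  rw [if_neg (swap_ne a).symm] at h1
  rw [ha, arrowBracket_eq D.isTailForm, if_neg (swap_ne a).symm]
  have h3 : (D.flip a).br (flipArr k Q a) (-𝐱 a) =
      ((D.flip a).br (flipArr k Q a) (𝐱 a) * ((1 : AQ k Q) ⊗ₜ[k] 𝐱 a.swap)
        + (𝐱 a ⊗ₜ[k] (1 : AQ k Q)) * (D.flip a).br (flipArr k Q a) (𝐱 a.swap))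
          * ((1 : AQ k Q) ⊗ₜ[k] flipArr k Q a)
        + ((zUnit k Q a).val ⊗ₜ[k] (1 : AQ k Q)) *
          (D.flip a).br (flipArr k Q a) (flipArr k Q a) := by
    rw [← zUnit_mul_flipArr, hb.deriv]
    congr 2
    rw [coe_zUnit, map_add, (hb.isDer_right _).map_one, zero_add, hb.deriv]
  rw [map_neg, hb.antisymm _ (𝐱 a), hb.antisymm _ (𝐱 a.swap), h1, h2] at h3
  have hcancel : ∀ x y : AQ k Q ⊗[k] AQ k Q, ((zUnit k Q a).val ⊗ₜ[k] (1 : AQ k Q)) * x =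
      ((zUnit k Q a).val ⊗ₜ[k] (1 : AQ k Q)) * y → x = y := by
    intro x y hxy
    have h4 : (((zUnit k Q a)⁻¹).val ⊗ₜ[k] (1 : AQ k Q)) *
        ((zUnit k Q a).val ⊗ₜ[k] (1 : AQ k Q)) = 1 := by
      simp only [Algebra.TensorProduct.tmul_mul_tmul, Units.inv_mul, one_mul]
      rfl
    rw [← one_mul x, ← h4, mul_assoc, hxy, ← mul_assoc, h4, one_mul]
  apply hcancel
  have hz : ∀ y, (zUnit k Q a).val * (flipArr k Q a * y) = -(𝐱 a * y) := fun y => by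
    rw [← mul_assoc, zUnit_mul_flipArr, neg_mul]
  have hr : ∀ y, 𝐱 a * (𝐱 a.swap * (flipArr k Q a * y)) = -(𝐱 a * y) - flipArr k Q a * y :=
    fun y => by rw [← mul_assoc (𝐱 a.swap), ← mul_assoc, arr_mul_flipArr, sub_mul, neg_mul]
  have hal := idem_mul_flipArr (k := k) (Q := Q) a
  have har := flipArr_mul_idem (k := k) (Q := Q) a
  have hxl := idem_mul_arr (k := k) (Q := Q) a
  have hxr := arr_mul_idem (k := k) (Q := Q) a
  have hsl := idem_mul_arr (k := k) (Q := Q) a.swap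
  have hsr := arr_swap_mul_idem (k := k) (Q := Q) a
  -- Either a is a loop, so that the idempotents at its ends coincide, or the values of O on a, a*
  -- vanish.
  by_cases ht : 𝐭 a = 𝐭 a.swap
  · have hZ : (zUnit k Q a).val * 𝐞 (𝐭 a) = 𝐞 (𝐭 a) + 𝐱 a * 𝐱 a.swap := by
      rw [coe_zUnit, add_mul, one_mul, mul_assoc, hsr]
    have ho := D.isTailForm.antisymm a.swap a
    rw [← ht] at har hxr hsl
    simp only [gaugeTerm, diagForm, if_true, if_false, if_neg (swap_ne a), pairTerm, Sum.swap_swap,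
      hf, hs, scalar_swap, ← ht, mul_sub, mul_add, sub_mul, add_mul, smul_mul_assoc, mul_smul_comm,
      zero_smul, one_smul, zero_sub, sub_zero, mul_neg, neg_mul, map_add, map_sub, map_neg,
      map_smul, map_mul, tensorSq_tmul, he, ha, TensorProduct.comm_tmul,
      hp _ (swap_ne a), Algebra.TensorProduct.tmul_mul_tmul, one_mul, mul_one,
      TensorProduct.add_tmul, TensorProduct.neg_tmul, TensorProduct.tmul_neg,
      TensorProduct.sub_tmul, TensorProduct.tmul_sub,
      D.isTailForm.self, mul_assoc, zUnit_inv_mul_arr, zUnit_mul_flipArr, hz, hr, arr_mul_flipArr,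
      hal, har, hxl, hxr, hsl, hsr, hZ, ho, add_zero, zero_add, mul_zero, zero_mul,
      map_zero] at h3 ⊢
    linear_combination (norm := module) -h3
  · have ho := D.isTailForm.eq_zero _ _ ht
    have ho' := D.isTailForm.eq_zero _ _ (Ne.symm ht)
    simp only [gaugeTerm, diagForm, if_true, if_false, if_neg (swap_ne a), pairTerm, Sum.swap_swap,
      hf, hs, scalar_swap, mul_sub, mul_add, sub_mul, add_mul, smul_mul_assoc, mul_smul_comm,
      zero_smul, one_smul, zero_sub, sub_zero, mul_neg, neg_mul, map_add, map_sub, map_neg,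
      map_smul, map_mul, tensorSq_tmul, he, ha, TensorProduct.comm_tmul,
      hp _ (swap_ne a), Algebra.TensorProduct.tmul_mul_tmul, one_mul, mul_one,
      TensorProduct.add_tmul, TensorProduct.neg_tmul, TensorProduct.tmul_neg,
      TensorProduct.sub_tmul, TensorProduct.tmul_sub,
      D.isTailForm.self, mul_assoc, zUnit_inv_mul_arr, zUnit_mul_flipArr, hz, hr, arr_mul_flipArr,
      hal, har, hxl, hxr, hsl, hsr, ho, ho', smul_zero, add_zero, zero_add, mul_zero, zero_mul,
      map_zero] at h3 ⊢
    linear_combination (norm := module) -h3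

/-- The moment map is preserved because the elements 1 + aa*, 1 + a*a are inverted while their
exponents change sign; the lists stay the same. -/
theorem OrderDatum.equivalent_flip [CharZero k] (D : OrderDatum k Q) (a : E ⊕ E) :
    D.Equivalent (D.flip a) := by
  obtain ⟨ψ, he, ha, hp⟩ := exists_flip_algHom (k := k) (Q := Q) a
  have hψ := flip_comp_self he ha hp
  refine equivalent_of_arr ψ ψ hψ hψ he (fun p q => ?_) (fun s => ?_)
  · by_cases hpa : p = a
    · subst hpa
      by_cases hq : q = p
      · subst hq
        exact D.flip_map_arr_self he ha hp
      · have h := D.flip_map_arr_of_ne he ha hp q p hq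
        rw [← D.isFormBracket_br.arr_arr] at h ⊢
        exact bracket_map_symm D.isDoubleBracket_br (D.flip p).isDoubleBracket_br h
    · exact D.flip_map_arr_of_ne he ha hp p q hpa
  · refine map_moment he id (by rw [List.map_id]; rfl) fun p _ => ?_
    rw [id, factor.eq_def (D.flip a)]
    by_cases hpa : p = a
    · subst hpa
      rw [D.map_factor (flip_map_zUnit ha hp), flip_sign_self]
      simp
    · by_cases hpa' : p = a.swap
      · subst hpa'
        rw [D.map_factor (flip_map_zUnit_swap ha hp), flip_sign_swap]
        simp
      · rw [flip_sign_of_ne D hpa hpa']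
        refine D.map_factor ?_
        rw [coe_zUnit, map_add, map_one, map_mul, hp p hpa,
          hp _ fun h => hpa' (by rw [← h, Sum.swap_swap])]

/-- The signs may be changed without changing the structure up to isomorphism. -/
theorem OrderDatum.exists_equivalent_sign [CharZero k] [Fintype E] (D : OrderDatum k Q)
    (σ : E ⊕ E → ℤˣ) (hσ : ∀ p, σ p.swap = -σ p) : ∃ D' : OrderDatum k Q,
      D'.form = D.form ∧ D'.list = D.list ∧ D'.sign = σ ∧ D.Equivalent D' := by
  classical
  have key : ∀ S : Finset E, ∃ D' : OrderDatum k Q, D'.form = D.form ∧ D'.list = D.list ∧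
      (∀ x ∈ S, D'.sign (Sum.inl x) = σ (Sum.inl x)) ∧ D.Equivalent D' := by
    intro S
    induction S using Finset.induction_on with
    | empty => exact ⟨D, rfl, rfl, by simp, .refl D⟩
    | insert x S hx ih =>
      obtain ⟨D', h1, h2, h3, h4⟩ := ih
      by_cases h : D'.sign (Sum.inl x) = σ (Sum.inl x)
      · exact ⟨D', h1, h2, Finset.forall_mem_insert .. |>.2 ⟨h, h3⟩, h4⟩
      · refine ⟨D'.flip (Sum.inl x), h1, h2, Finset.forall_mem_insert .. |>.2 ⟨?_, fun y hy => ?_⟩,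
          h4.trans (D'.equivalent_flip _)⟩
        · rw [flip_sign_self]
          rcases Int.units_eq_one_or (D'.sign (Sum.inl x)) with h' | h' <;>
            rcases Int.units_eq_one_or (σ (Sum.inl x)) with h'' | h'' <;>
            first
            | exact absurd (h'.trans h''.symm) h
            | simp [h', h'']
        · rw [flip_sign_of_ne D' (by rintro ⟨⟩; exact hx hy) (by simp), h3 y hy]
  obtain ⟨D', h1, h2, h3, h4⟩ := key Finset.univ
  refine ⟨D', h1, h2, funext fun p => ?_, h4⟩
  rcases p with x | x
  · exact h3 x (Finset.mem_univ x)
  · have h5 := D'.sign_swap (Sum.inl x)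
    have h6 := hσ (Sum.inl x)
    rw [Sum.swap_inl] at h5 h6
    rw [h5, h6, h3 x (Finset.mem_univ x)]

end Flip

/-! ### Transposition of neighbours in an ordering -/

section Conj

variable {k : Type z} [Field k] [CharZero k] {A : Type u} [Ring A] [Algebra k A]
variable {br : A →ₗ[k] A →ₗ[k] A ⊗[k] A} {X : Aˣ} {x s e f : A} {θ η : k}

/-- This and the next two results are the computations for exchanging neighbours b, a. Here x is b,
s is b*, X is the factor of a, e and f are the idempotents at the tail and the head of b, and θ =
O(b*, b). The condition `hθ` says that b is a loop or θ = 0; `h₁` and `h₃` are the brackets with X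
of the old and of the new element. -/
theorem IsDoubleBracket.conj_self (hb : IsDoubleBracket br) (hθ : θ = 0 ∨ e = f)
    (hex : e * x = x) (heX : Commute e X.val)
    (h₁ : br x X.val = (X.val ⊗ₜ[k] (1 : A)) * ((1 / 2 : k) • (-(x ⊗ₜ[k] e) - θ • (f ⊗ₜ[k] x)))
      - ((1 / 2 : k) • (-(x ⊗ₜ[k] e) - θ • (f ⊗ₜ[k] x))) * ((1 : A) ⊗ₜ[k] X.val))
    (h₂ : br x x = ((1 / 2 : k) * θ) • (f ⊗ₜ[k] (x * x) - (x * x) ⊗ₜ[k] e))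
    (h₃ : br (X.val * x) X.val =
      (X.val ⊗ₜ[k] (1 : A)) *
        ((1 / 2 : k) • ((X.val * x) ⊗ₜ[k] e - θ • (f ⊗ₜ[k] (X.val * x))))
      - ((1 / 2 : k) • ((X.val * x) ⊗ₜ[k] e - θ • (f ⊗ₜ[k] (X.val * x)))) *
        ((1 : A) ⊗ₜ[k] X.val)) :
    br (X.val * x) (X.val * x) = ((1 / 2 : k) * θ) •
      (f ⊗ₜ[k] (X.val * x * (X.val * x)) - (X.val * x * (X.val * x)) ⊗ₜ[k] e) := by
  have heX' : ∀ y, e * (X.val * y) = X.val * (e * y) := fun y => by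
    rw [← mul_assoc, heX.eq, mul_assoc]
  have h4 : br (X.val * x) x = -TensorProduct.comm k A A
      (br x X.val * ((1 : A) ⊗ₜ[k] x) + (X.val ⊗ₜ[k] (1 : A)) * br x x) := by
    rw [hb.antisymm, hb.deriv]
  rw [hb.deriv, h₃, h4, h₁, h₂]
  rcases hθ with rfl | rfl
  · simp only [mul_add, add_mul, mul_sub, sub_mul, smul_mul_assoc, mul_smul_comm, mul_neg, neg_mul,
      Algebra.TensorProduct.tmul_mul_tmul, one_mul, mul_one, map_add, map_sub, map_neg, map_smul,
      TensorProduct.comm_tmul, mul_assoc, heX', hex, zero_smul, mul_zero, zero_mul, smul_zero,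
      map_zero]
    module
  · simp only [mul_add, add_mul, mul_sub, sub_mul, smul_mul_assoc, mul_smul_comm, mul_neg, neg_mul,
      Algebra.TensorProduct.tmul_mul_tmul, one_mul, mul_one, map_add, map_sub, map_neg, map_smul,
      TensorProduct.comm_tmul, mul_assoc, heX', heX.eq, hex]
    module

theorem IsDoubleBracket.conj_pair (hb : IsDoubleBracket br) (hθ : θ = 0 ∨ e = f)
    (hex : e * x = x) (hse : s * e = s)
    (heX : Commute e X.val)
    (h₁ : br s X.val = (X.val ⊗ₜ[k] (1 : A)) * ((1 / 2 : k) • (θ • (s ⊗ₜ[k] f) + e ⊗ₜ[k] s))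
      - ((1 / 2 : k) • (θ • (s ⊗ₜ[k] f) + e ⊗ₜ[k] s)) * ((1 : A) ⊗ₜ[k] X.val))
    (h₂ : br s x = ((1 / 2 : k) * θ) • (x ⊗ₜ[k] s - s ⊗ₜ[k] x) - η • (e ⊗ₜ[k] f
      + (1 / 2 : k) • ((x * s) ⊗ₜ[k] f) + (1 / 2 : k) • (e ⊗ₜ[k] (s * x))))
    (h₃ : br (X.val * x) X.val =
      (X.val ⊗ₜ[k] (1 : A)) *
        ((1 / 2 : k) • ((X.val * x) ⊗ₜ[k] e - θ • (f ⊗ₜ[k] (X.val * x))))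
      - ((1 / 2 : k) • ((X.val * x) ⊗ₜ[k] e - θ • (f ⊗ₜ[k] (X.val * x)))) *
        ((1 : A) ⊗ₜ[k] X.val)) :
    br (X.val * x) (s * (X⁻¹).val) = ((1 / 2 : k) * θ) •
      ((X.val * x) ⊗ₜ[k] (s * (X⁻¹).val) - (s * (X⁻¹).val) ⊗ₜ[k] (X.val * x)) +
      η • (f ⊗ₜ[k] e + (1 / 2 : k) • ((s * x) ⊗ₜ[k] e)
        + (1 / 2 : k) • (f ⊗ₜ[k] (X.val * x * (s * (X⁻¹).val)))) := by
  have heY := heX.units_inv_right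
  have hsY : s * ((X⁻¹).val * e) = s * (X⁻¹).val := by rw [← heY.eq, ← mul_assoc, hse]
  have h4 : br (X.val * x) s = -TensorProduct.comm k A A
      (br s X.val * ((1 : A) ⊗ₜ[k] x) + (X.val ⊗ₜ[k] (1 : A)) * br s x) := by
    rw [hb.antisymm, hb.deriv]
  rw [hb.deriv, (hb.isDer_right _).map_inv X.mul_inv X.inv_mul, h₃, h4, h₁, h₂]
  rcases hθ with rfl | rfl
  · simp only [mul_add, add_mul, mul_sub, sub_mul, smul_mul_assoc, mul_smul_comm, mul_neg, neg_mul,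
      Algebra.TensorProduct.includeLeft_apply, Algebra.TensorProduct.includeRight_apply,
      Algebra.TensorProduct.tmul_mul_tmul, one_mul, mul_one, map_add, map_sub, map_neg, map_smul,
      TensorProduct.comm_tmul, mul_assoc, heX.eq, heY.eq, hex, hse, hsY,
      Units.mul_inv, Units.inv_mul, Units.mul_inv_cancel_left, Units.inv_mul_cancel_left,
      zero_smul, mul_zero, zero_mul, smul_zero, map_zero]
    module
  · simp only [mul_add, add_mul, mul_sub, sub_mul, smul_mul_assoc, mul_smul_comm, mul_neg, neg_mul,
      Algebra.TensorProduct.includeLeft_apply, Algebra.TensorProduct.includeRight_apply,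
      Algebra.TensorProduct.tmul_mul_tmul, one_mul, mul_one, map_add, map_sub, map_neg, map_smul,
      TensorProduct.comm_tmul, mul_assoc, heX.eq, heY.eq, hex, hse, hsY,
      Units.mul_inv, Units.inv_mul, Units.mul_inv_cancel_left, Units.inv_mul_cancel_left]
    module

theorem IsDoubleBracket.conj_swap (hb : IsDoubleBracket br) (hθ : θ = 0 ∨ e = f)
    (hse : s * e = s) (heX : Commute e X.val)
    (h₁ : br s X.val = (X.val ⊗ₜ[k] (1 : A)) * ((1 / 2 : k) • (θ • (s ⊗ₜ[k] f) + e ⊗ₜ[k] s))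
      - ((1 / 2 : k) • (θ • (s ⊗ₜ[k] f) + e ⊗ₜ[k] s)) * ((1 : A) ⊗ₜ[k] X.val))
    (h₂ : br s s = ((1 / 2 : k) * θ) • ((s * s) ⊗ₜ[k] f - e ⊗ₜ[k] (s * s)))
    (h₃ : br (s * (X⁻¹).val) X.val =
      (X.val ⊗ₜ[k] (1 : A)) *
        ((1 / 2 : k) • (θ • ((s * (X⁻¹).val) ⊗ₜ[k] f) - e ⊗ₜ[k] (s * (X⁻¹).val)))
      - ((1 / 2 : k) • (θ • ((s * (X⁻¹).val) ⊗ₜ[k] f) - e ⊗ₜ[k] (s * (X⁻¹).val))) *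
        ((1 : A) ⊗ₜ[k] X.val)) :
    br (s * (X⁻¹).val) (s * (X⁻¹).val) = ((1 / 2 : k) * θ) •
      ((s * (X⁻¹).val * (s * (X⁻¹).val)) ⊗ₜ[k] f
        - e ⊗ₜ[k] (s * (X⁻¹).val * (s * (X⁻¹).val))) := by
  have heY := heX.units_inv_right
  have hsY : s * ((X⁻¹).val * e) = s * (X⁻¹).val := by rw [← heY.eq, ← mul_assoc, hse]
  have h4 : br (s * (X⁻¹).val) s = -TensorProduct.comm k A A
      (br s s * ((1 : A) ⊗ₜ[k] (X⁻¹).val) + (s ⊗ₜ[k] (1 : A)) * -(((X⁻¹).val ⊗ₜ[k] (1 : A)) *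
        br s X.val * ((1 : A) ⊗ₜ[k] (X⁻¹).val))) := by
    rw [hb.antisymm, hb.deriv, (hb.isDer_right _).map_inv X.mul_inv X.inv_mul]
    rfl
  rw [hb.deriv, (hb.isDer_right _).map_inv X.mul_inv X.inv_mul, h₃, h4, h₁, h₂]
  rcases hθ with rfl | rfl
  · simp only [mul_add, add_mul, mul_sub, sub_mul, smul_mul_assoc, mul_smul_comm, mul_neg, neg_mul,
      Algebra.TensorProduct.includeLeft_apply, Algebra.TensorProduct.includeRight_apply,
      Algebra.TensorProduct.tmul_mul_tmul, one_mul, mul_one, map_add, map_sub, map_neg, map_smul,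
      TensorProduct.comm_tmul, mul_assoc, heX.eq, heY.eq, hse, hsY,
      Units.mul_inv, Units.inv_mul, Units.mul_inv_cancel_left, Units.inv_mul_cancel_left,
      zero_smul, mul_zero, zero_mul, smul_zero, map_zero]
    module
  · simp only [mul_add, add_mul, mul_sub, sub_mul, smul_mul_assoc, mul_smul_comm, mul_neg, neg_mul,
      Algebra.TensorProduct.includeLeft_apply, Algebra.TensorProduct.includeRight_apply,
      Algebra.TensorProduct.tmul_mul_tmul, one_mul, mul_one, map_add, map_sub, map_neg, map_smul,
      TensorProduct.comm_tmul, mul_assoc, heX.eq, heY.eq, hse, hsY,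
      Units.mul_inv, Units.inv_mul, Units.mul_inv_cancel_left, Units.inv_mul_cancel_left]
    module

end Conj

/-! ### The algebra map b ↦ Xb, b* ↦ b*X⁻¹ and its effect on brackets -/

section Transpose

variable {k : Type z} [Field k] {I : Type u} {E : Type v} {Q : FinQuiver I E}

open Classical in
/-- The datum with the arrows `a`, `b` exchanged in the lists and in the form. -/
def OrderDatum.transpose (D : OrderDatum k Q) (a b : E ⊕ E) (h : Q.double.t a = Q.double.t b) :
    OrderDatum k Q where
  form p q := D.form (Equiv.swap a b p) (Equiv.swap a b q)
  sign := D.sign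
  list s := (D.list s).map (Equiv.swap a b)
  isTailForm := by
    refine ⟨fun _ _ => D.isTailForm.antisymm _ _, fun p q hpq => D.isTailForm.eq_zero _ _ ?_⟩
    rwa [Equiv.apply_swap_eq_self h, Equiv.apply_swap_eq_self h]
  sign_swap := D.sign_swap
  mem_list s p := by
    rw [← Equiv.apply_swap_eq_self h p, ← D.mem_list]
    conv_lhs => rw [← Equiv.swap_apply_self a b p]
    exact List.mem_map_of_injective (Equiv.injective _)
  pairwise s := by
    rw [List.pairwise_map]
    simpa using D.pairwise s

theorem OrderDatum.transpose_form_of_ne_right {D : OrderDatum k Q} {a b p q : E ⊕ E}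
    {h : Q.double.t a = Q.double.t b}
    (hab : ∀ r, r ≠ a → r ≠ b → D.form r a = D.form r b) (ha : q ≠ a) (hb : q ≠ b) :
    (D.transpose a b h).form p q = D.form p q := by
  classical
  have h1 : D.form a q = D.form b q := by
    rw [D.isTailForm.antisymm, hab q ha hb, ← D.isTailForm.antisymm]
  simp only [transpose, Equiv.swap_apply_of_ne_of_ne ha hb]
  by_cases hpa : p = a
  · rw [hpa, Equiv.swap_apply_left, h1]
  · by_cases hpb : p = b
    · rw [hpb, Equiv.swap_apply_right, h1]
    · rw [Equiv.swap_apply_of_ne_of_ne hpa hpb]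

theorem OrderDatum.transpose_form_of_ne_left {D : OrderDatum k Q} {a b p q : E ⊕ E}
    {h : Q.double.t a = Q.double.t b}
    (hab : ∀ r, r ≠ a → r ≠ b → D.form r a = D.form r b) (ha : p ≠ a) (hb : p ≠ b) :
    (D.transpose a b h).form p q = D.form p q := by
  rw [(D.transpose a b h).isTailForm.antisymm, transpose_form_of_ne_right hab ha hb,
    ← D.isTailForm.antisymm]

/-- Nothing lies between `b` and `a` in the list, so no other half-edge distinguishes them. -/
theorem OrderDatum.form_eq_of_adjacent [CharZero k] {D : OrderDatum k Q} {a b p : E ⊕ E} {s : I}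
    {pre l : List (E ⊕ E)} (hl : D.list s = pre ++ b :: a :: l) (ha : p ≠ a) (hb : p ≠ b) :
    D.form p a = D.form p b := by
  have hl' : D.list s = (pre ++ [b]) ++ a :: l := by simp [hl]
  have hbs : Q.double.t b = s := (D.mem_list s b).1 (by simp [hl])
  have has : Q.double.t a = s := (D.mem_list s a).1 (by simp [hl])
  by_cases hp : Q.double.t p = s
  · have hm := (D.mem_list s p).2 hp
    rw [hl] at hm
    simp only [List.mem_append, List.mem_cons, ha, hb, false_or] at hm
    rcases hm with hm | hm
    · rw [form_eq_one_of_mem_left hl hm, form_eq_one_of_mem_left hl' (by simp [hm])]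
    · rw [D.isTailForm.antisymm p a, D.isTailForm.antisymm p b,
        form_eq_one_of_mem_right hl' hm, form_eq_one_of_mem_right hl (by simp [hm])]
  · rw [D.isTailForm.eq_zero p a (by rwa [has]), D.isTailForm.eq_zero p b (by rwa [hbs])]

/-- In the new order a immediately precedes b. The gap after a is then the new position of b, and
the gap before a, treated in the next lemma, is the old position of b. -/
theorem OrderDatum.transpose_form_add_diagForm [CharZero k] {D : OrderDatum k Q} {a b p : E ⊕ E}
    {h : Q.double.t a = Q.double.t b}
    (hab : ∀ r, r ≠ a → r ≠ b → D.form r a = D.form r b) (hba : D.form b a = 1)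
    (hp : p ≠ b) : ((D.transpose a b h).form + diagForm : E ⊕ E → E ⊕ E → k) p a =
      (D.transpose a b h).form p b := by
  classical
  simp only [Pi.add_apply, diagForm]
  by_cases hpa : p = a
  · simp [hpa, transpose, D.isTailForm.self, hba]
  · simp [hpa, transpose, Equiv.swap_apply_of_ne_of_ne hpa hp, hab p hpa hp]

theorem OrderDatum.transpose_form_sub_diagForm [CharZero k] {D : OrderDatum k Q} {a b p : E ⊕ E}
    {h : Q.double.t a = Q.double.t b} (hba : D.form b a = 1)
    (hp : p ≠ b) : ((D.transpose a b h).form - diagForm : E ⊕ E → E ⊕ E → k) p a = D.form p b := by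
  classical
  simp only [Pi.sub_apply, diagForm]
  by_cases hpa : p = a
  · simp [hpa, transpose, D.isTailForm.self, D.isTailForm.antisymm a b, hba]
  · simp [hpa, transpose, Equiv.swap_apply_of_ne_of_ne hpa hp]

variable [Fintype I]

local notation "𝐞" => idem k Q
local notation "𝐱" => arr k Q
local notation "𝐭" => FinQuiver.t (FinQuiver.double Q)

/-- The values on arrows of the algebra map which replaces `b` by `u b` and `b^*` by `b^* u⁻¹`. -/
structure IsConjMap (b : E ⊕ E) (u : (AQ k Q)ˣ) (ψ : AQ k Q →ₐ[k] AQ k Q) : Prop where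
  idem : ∀ s, ψ (𝐞 s) = 𝐞 s
  arr : ψ (𝐱 b) = u.val * 𝐱 b
  arr_swap : ψ (𝐱 b.swap) = 𝐱 b.swap * (u⁻¹).val
  arr_of_ne : ∀ p, p ≠ b → p ≠ b.swap → ψ (𝐱 p) = 𝐱 p

/-- The substitution conjugates 1 + bb* by u; its companion below shows that 1 + b*b does not
change. -/
theorem one_add_conj (b : E ⊕ E) (u : (AQ k Q)ˣ) :
    1 + u.val * 𝐱 b * (𝐱 b.swap * (u⁻¹).val) = (u * zUnit k Q b * u⁻¹).val := by
  rw [Units.val_mul, Units.val_mul, coe_zUnit, mul_add, add_mul, mul_one, Units.mul_inv]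
  noncomm_ring

theorem one_add_conj_swap (b : E ⊕ E) (u : (AQ k Q)ˣ) :
    1 + 𝐱 b.swap * (u⁻¹).val * (u.val * 𝐱 b) = (zUnit k Q b.swap).val := by
  rw [mul_assoc, Units.inv_mul_cancel_left, coe_zUnit, Sum.swap_swap]

theorem exists_isConjMap {b : E ⊕ E} {u : (AQ k Q)ˣ} (hu : Commute (𝐞 (𝐭 b)) u.val) :
    ∃ ψ : AQ k Q →ₐ[k] AQ k Q, IsConjMap b u ψ := by
  classical
  let x : E ⊕ E → AQ k Q := fun p =>
    if p = b then u.val * 𝐱 b else if p = b.swap then 𝐱 b.swap * (u⁻¹).val else 𝐱 p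
  have hx : x b = u.val * 𝐱 b := if_pos rfl
  have hx' : x b.swap = 𝐱 b.swap * (u⁻¹).val := by simp only [x, if_neg (swap_ne b), if_true]
  have hx'' : ∀ p, p ≠ b → p ≠ b.swap → x p = 𝐱 p := fun p h h' => by
    simp only [x, if_neg h, if_neg h']
  have h1 : ∀ p, 𝐞 (𝐭 p) * x p * 𝐞 (𝐭 p.swap) = x p := by
    intro p
    by_cases hp : p = b
    · rw [hp, hx, ← mul_assoc, hu.eq, mul_assoc, mul_assoc, arr_mul_idem, idem_mul_arr]
    · by_cases hp' : p = b.swap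
      · rw [hp', hx', Sum.swap_swap, mul_assoc, mul_assoc, ← hu.units_inv_right.eq,
          ← mul_assoc (𝐱 b.swap), arr_swap_mul_idem, ← mul_assoc, idem_mul_arr]
      · rw [hx'' p hp hp', idem_mul_arr, arr_mul_idem]
  have h2 : ∀ p, IsUnit (1 + x p * x p.swap) := by
    intro p
    by_cases hp : p = b
    · rw [hp, hx, hx', one_add_conj]
      exact Units.isUnit _
    · by_cases hp' : p = b.swap
      · rw [hp', Sum.swap_swap, hx, hx', one_add_conj_swap]
        exact Units.isUnit _
      · rw [hx'' p hp hp', hx'' p.swap (fun h => hp' (by rw [← h, Sum.swap_swap]))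
          (fun h => hp (by rw [← Sum.swap_swap p, h, Sum.swap_swap])), ← coe_zUnit]
        exact Units.isUnit _
  obtain ⟨ψ, h3, h4⟩ := AQ.exists_lift (k := k) (Q := Q) 𝐞 x idem_mul_self
    (fun _ _ h => idem_mul_of_ne h) (sum_idem k Q) h1 h2
  exact ⟨ψ, h3, (h4 b).trans hx, (h4 b.swap).trans hx', fun p h h' => (h4 p).trans (hx'' p h h')⟩

namespace IsConjMap

variable {b : E ⊕ E} {u : (AQ k Q)ˣ} {ψ ψ' : AQ k Q →ₐ[k] AQ k Q}

theorem zUnit_self (h : IsConjMap b u ψ) :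
    ψ (zUnit k Q b).val = (u * zUnit k Q b * u⁻¹).val := by
  rw [coe_zUnit, map_add, map_one, map_mul, h.arr, h.arr_swap, one_add_conj]

theorem zUnit_of_ne (h : IsConjMap b u ψ) {p : E ⊕ E} (hp : p ≠ b) :
    ψ (zUnit k Q p).val = (zUnit k Q p).val := by
  by_cases hp' : p = b.swap
  · subst hp'
    refine Eq.trans ?_ (one_add_conj_swap b u)
    rw [coe_zUnit, map_add, map_one, map_mul, Sum.swap_swap, h.arr,
      h.arr_swap]
  · rw [coe_zUnit, map_add, map_one, map_mul, h.arr_of_ne p hp hp',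
      h.arr_of_ne _ (fun h => hp' (by rw [← h, Sum.swap_swap]))
      (fun h => hp (by rw [← Sum.swap_swap p, h, Sum.swap_swap]))]

theorem factor_of_ne (h : IsConjMap b u ψ) (D : OrderDatum k Q) {p : E ⊕ E} (hp : p ≠ b) :
    Units.map (ψ : AQ k Q →* AQ k Q) (D.factor p) = D.factor p :=
  D.map_factor (h.zUnit_of_ne hp)

theorem factor_self (h : IsConjMap b u ψ) (D : OrderDatum k Q) :
    Units.map (ψ : AQ k Q →* AQ k Q) (D.factor b) = u * D.factor b * u⁻¹ := by
  rw [D.map_factor h.zUnit_self, conj_zpow]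
  rfl

theorem comp_eq_id (h : IsConjMap b u ψ) (h' : IsConjMap b u⁻¹ ψ')
    (hu : Units.map (ψ' : AQ k Q →* AQ k Q) u = u) : ψ'.comp ψ = AlgHom.id k _ := by
  have h1 : ψ' u.val = u.val := congrArg Units.val hu
  have h2 : ψ' (u⁻¹).val = (u⁻¹).val := by
    have := congrArg Units.val (map_inv (Units.map (ψ' : AQ k Q →* AQ k Q)) u)
    rwa [hu] at this
  refine AQ.algHom_ext (fun s => by simp [h.idem, h'.idem]) (fun p => ?_)
  rw [AlgHom.comp_apply, AlgHom.id_apply]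
  by_cases hp : p = b
  · rw [hp, h.arr, map_mul, h'.arr, h1, Units.mul_inv_cancel_left]
  · by_cases hp' : p = b.swap
    · rw [hp', h.arr_swap, map_mul, h'.arr_swap, h2, inv_inv, Units.mul_inv_cancel_right]
    · rw [h.arr_of_ne p hp hp', h'.arr_of_ne p hp hp']

end IsConjMap

/-- Let X be the factor of a, G the old gauge terms and G' the new ones. By the position of the two
gaps around a, {{p, X}} = (X ⊗ 1) G'(p, b) - G(p, b) (1 ⊗ X). In the Leibniz rule for Xb the terms
with G'(p, b) cancel, so Xb in the new order behaves as b did in the old one. The same happens for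
b*X⁻¹. -/
theorem OrderDatum.transpose_map_arr_of_ne [CharZero k] {D : OrderDatum k Q} {a b : E ⊕ E}
    {ht : 𝐭 a = 𝐭 b} (hab : ∀ r, r ≠ a → r ≠ b → D.form r a = D.form r b) (hba : D.form b a = 1)
    {ψ : AQ k Q →ₐ[k] AQ k Q} (h : IsConjMap b (D.factor a) ψ)
    {p : E ⊕ E} (hp : p ≠ b) (hp' : p ≠ b.swap) (q : E ⊕ E) :
    (D.transpose a b ht).br (ψ (𝐱 p)) (ψ (𝐱 q)) =
      tensorSq ψ (arrowBracket Q D.form D.scalar p q) := by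
  classical
  set D' := D.transpose a b ht with hD'
  have hb := D'.isDoubleBracket_br
  have hF := D'.isFormBracket_br
  have hps : p.swap ≠ b := fun h => hp' (by rw [← h, Sum.swap_swap])
  have hps' : p.swap ≠ b.swap := fun h => hp (by rw [← Sum.swap_swap p, h, Sum.swap_swap])
  have hg : ∀ q, tensorSq ψ (gaugeTerm Q D.form p q) = gaugeTerm Q D.form p q := fun q => by
    simp only [gaugeTerm, map_smul, map_sub, tensorSq_tmul, h.idem, h.arr_of_ne p hp hp']
  have hX : D'.br (𝐱 p) (D.factor a).val =
      ((D.factor a).val ⊗ₜ[k] (1 : AQ k Q)) * gaugeTerm Q D'.form p b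
        - gaugeTerm Q D.form p b * ((1 : AQ k Q) ⊗ₜ[k] (D.factor a).val) := by
    have := D'.bracket_factor hF p a
    rw [gaugeTerm_congr (transpose_form_add_diagForm hab hba hp)
      (transpose_form_add_diagForm hab hba hps),
      gaugeTerm_congr (transpose_form_sub_diagForm hba hp)
      (transpose_form_sub_diagForm hba hps)] at this
    exact this
  have hform : ∀ p q : E ⊕ E, p ≠ b → q ≠ b → D'.form p q = D.form p q := by
    intro p q h1 h2
    by_cases hpa : p = a
    · by_cases hqa : q = a
      · rw [hpa, hqa, D'.isTailForm.self, D.isTailForm.self]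
      · exact transpose_form_of_ne_right hab hqa h2
    · exact transpose_form_of_ne_left hab hpa h1
  have hW : ∀ q, q ≠ b → gaugeTerm Q D'.form p q = gaugeTerm Q D.form p q := fun q hq =>
    gaugeTerm_congr (hform p q hp hq) (hform _ q hps hq)
  have h1 : (1 : AQ k Q) ⊗ₜ[k] (1 : AQ k Q) = (1 : AQ k Q ⊗[k] AQ k Q) := rfl
  have hl1 : ∀ x y : AQ k Q, (x * y) ⊗ₜ[k] (1 : AQ k Q) =
    (x ⊗ₜ[k] (1 : AQ k Q)) * (y ⊗ₜ[k] (1 : AQ k Q)) := fun x y => by simp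
  have hr1 : ∀ x y : AQ k Q, (1 : AQ k Q) ⊗ₜ[k] (x * y) =
    ((1 : AQ k Q) ⊗ₜ[k] x) * ((1 : AQ k Q) ⊗ₜ[k] y) := fun x y => by simp
  have hXl : (((D.factor a)⁻¹).val ⊗ₜ[k] (1 : AQ k Q)) *
      ((D.factor a).val ⊗ₜ[k] (1 : AQ k Q)) = 1 := by
    rw [← hl1, Units.inv_mul, h1]
  have hXr : ((1 : AQ k Q) ⊗ₜ[k] (D.factor a).val) *
      ((1 : AQ k Q) ⊗ₜ[k] ((D.factor a)⁻¹).val) = 1 := by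
    rw [← hr1, Units.mul_inv, h1]
  rw [arrowBracket, map_add, map_sub, map_mul, map_mul, tensorSq_tmul, tensorSq_tmul, hg, hg,
    map_one, h.arr_of_ne p hp hp']
  by_cases hq : q = b
  · subst hq
    rw [h.arr, hb.deriv, hX, hF.arr_arr, arrowBracket, hW _ (swap_ne q), if_neg hps.symm,
      if_neg hps.symm, map_zero, hl1, hr1]
    noncomm_ring
  · by_cases hq' : q = b.swap
    · subst hq'
      rw [h.arr_swap, hb.deriv, (hb.isDer_right _).map_inv (D.factor a).mul_inv
        (D.factor a).inv_mul, hX, hF.arr_arr, arrowBracket, hW _ (swap_ne b), if_neg hps'.symm,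
        if_neg hps'.symm, map_zero, Sum.swap_swap, hl1, hr1]
      simp only [Algebra.TensorProduct.includeLeft_apply,
        Algebra.TensorProduct.includeRight_apply, mul_sub, sub_mul, mul_assoc, hXr, mul_neg,
        add_zero]
      simp only [← mul_assoc, mul_one]
      simp only [mul_assoc _ _ ((D.factor a).val ⊗ₜ[k] (1 : AQ k Q)), hXl, mul_one]
      abel
    · have hqs : q.swap ≠ b := fun h => hq' (by rw [← h, Sum.swap_swap])
      rw [h.arr_of_ne q hq hq', hF.arr_arr, arrowBracket, hW _ hq, hW _ hqs]
      congr 1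
      by_cases hpq : q = p.swap
      · subst hpq
        have hs : D'.scalar p = D.scalar p := rfl
        rw [if_pos rfl, if_pos rfl, hs]
        simp only [pairTerm, map_smul, map_add, tensorSq_tmul, map_mul, h.idem,
          h.arr_of_ne p hp hp', h.arr_of_ne _ hq hq']
      · rw [if_neg hpq, if_neg hpq, map_zero]

/-- X is built from a and a*, which the map fixes, so brackets with X follow from those with arrows
other than b and b*. This supplies the hypothesis `h₃` of the `conj` lemmas without computing {{Xb,
X}}. -/
theorem OrderDatum.transpose_map_factor [CharZero k] {D : OrderDatum k Q} {a b : E ⊕ E}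
    {ht : 𝐭 a = 𝐭 b} (hab : ∀ r, r ≠ a → r ≠ b → D.form r a = D.form r b) (hba : D.form b a = 1)
    (hne : a ≠ b.swap) {ψ : AQ k Q →ₐ[k] AQ k Q} (h : IsConjMap b (D.factor a) ψ) (x : AQ k Q) :
    (D.transpose a b ht).br (ψ x) (D.factor a).val = tensorSq ψ (D.br x (D.factor a).val) := by
  set D' := D.transpose a b ht
  have hneab : a ≠ b := (ne_of_form hba).symm
  have h1 : ∀ p, p ≠ b → p ≠ b.swap → ∀ x,
      D'.br (ψ x) (ψ (𝐱 p)) = tensorSq ψ (D.br x (𝐱 p)) := by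
    intro p hp hp' x
    refine bracket_map_symm D.isDoubleBracket_br D'.isDoubleBracket_br (sub_eq_zero.1
      ((isDer_bracketDefect D.isDoubleBracket_br D'.isDoubleBracket_br (𝐱 p)).eq_zero
        (fun s => ?_) (fun q => ?_) x))
    · rw [bracketDefect_apply, h.idem, (D.isFormBracket_br.isBLinear s _).2,
        (D'.isFormBracket_br.isBLinear s _).2, map_zero, sub_zero]
    · rw [bracketDefect_apply, transpose_map_arr_of_ne hab hba h hp hp',
        D.isFormBracket_br.arr_arr, sub_self]
  have hd := isDer_bracketDefect (ψ := ψ) D.isDoubleBracket_br D'.isDoubleBracket_br x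
  have h2 : bracketDefect ψ D.br D'.br x (zUnit k Q a).val = 0 := by
    rw [coe_zUnit, map_add, hd.map_one, zero_add, hd]
    rw [bracketDefect_apply, bracketDefect_apply, h1 a hneab hne, h1 a.swap
      (fun h => hne (by rw [← h, Sum.swap_swap]))
      (fun h => hneab (by rw [← Sum.swap_swap a, h, Sum.swap_swap])), sub_self, sub_self]
    simp
  have h3 : bracketDefect ψ D.br D'.br x (D.factor a).val = 0 := by
    rcases Int.units_eq_one_or (D.sign a) with hs | hs
    · have : D.factor a = zUnit k Q a := by simp [factor, hs]
      rw [this, h2]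
    · have : D.factor a = (zUnit k Q a)⁻¹ := by simp [factor, hs]
      rw [this, hd.map_inv (zUnit k Q a).mul_inv (zUnit k Q a).inv_mul, h2]
      simp
  have h4 : ψ (D.factor a).val = (D.factor a).val := congrArg Units.val (h.factor_of_ne D hneab)
  rw [bracketDefect_apply, h4] at h3
  exact sub_eq_zero.1 h3

theorem OrderDatum.transpose_map_arr [CharZero k] {D : OrderDatum k Q} {a b : E ⊕ E}
    {ht : 𝐭 a = 𝐭 b} (hab : ∀ r, r ≠ a → r ≠ b → D.form r a = D.form r b) (hba : D.form b a = 1)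
    (hne : a ≠ b.swap) {ψ : AQ k Q →ₐ[k] AQ k Q} (h : IsConjMap b (D.factor a) ψ) (p q : E ⊕ E) :
    (D.transpose a b ht).br (ψ (𝐱 p)) (ψ (𝐱 q)) =
      tensorSq ψ (arrowBracket Q D.form D.scalar p q) := by
  classical
  have hneab : b ≠ a := ne_of_form hba
  have hF := (D.transpose a b ht).isFormBracket_br
  have hb := (D.transpose a b ht).isDoubleBracket_br
  have hform : D.form b.swap a = D.form b.swap b := hab _ hne.symm (swap_ne b)
  have hform' : D.form b b.swap = -D.form b.swap b := D.isTailForm.antisymm _ _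
  have hf1 : (D.transpose a b ht).form b a = -1 := by
    simp [transpose, D.isTailForm.antisymm a b, hba]
  have hf2 : (D.transpose a b ht).form b.swap a = D.form b.swap b := by
    rw [transpose_form_of_ne_left hab hne.symm (swap_ne b), hform]
  have hf3 : (D.transpose a b ht).form b.swap b = D.form b.swap b :=
    transpose_form_of_ne_left hab hne.symm (swap_ne b)
  have hf4 : (D.transpose a b ht).form b b.swap = -D.form b.swap b := by
    rw [transpose_form_of_ne_right hab hne.symm (swap_ne b), hform']
  have hs : (D.transpose a b ht).scalar = D.scalar := rfl
  -- Either b is a loop or the half-edges b and b* lie at different vertices, where the form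
  -- vanishes.
  have hθ : D.form b.swap b = 0 ∨ 𝐞 (𝐭 b) = 𝐞 (𝐭 b.swap) := by
    by_cases hbb : 𝐭 b.swap = 𝐭 b
    · exact Or.inr (by rw [hbb])
    · exact Or.inl (D.isTailForm.eq_zero _ _ hbb)
  have heX : Commute (𝐞 (𝐭 b)) (D.factor a).val := ht ▸ D.commute_idem_factor a
  have hx : (D.transpose a b ht).br (𝐱 b) (D.factor a).val = _ :=
    (D.transpose a b ht).bracket_factor hF b a
  have hx' : (D.transpose a b ht).br (𝐱 b.swap) (D.factor a).val = _ :=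
    (D.transpose a b ht).bracket_factor hF b.swap a
  have hy := transpose_map_factor (ht := ht) hab hba hne h (𝐱 b)
  have hy' := transpose_map_factor (ht := ht) hab hba hne h (𝐱 b.swap)
  have hfac : (D.transpose a b ht).factor a = D.factor a := rfl
  have hX : ψ (D.factor a).val = (D.factor a).val :=
    congrArg Units.val (h.factor_of_ne D hneab.symm)
  rw [D.bracket_factor D.isFormBracket_br] at hy hy'
  simp only [gaugeTerm, Pi.add_apply, Pi.sub_apply, diagForm, if_neg hneab, if_neg hne.symm,
    add_zero, sub_zero, hf1, hf2, hba, hform, Sum.swap_swap, map_sub, map_mul, map_smul,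
    tensorSq_tmul, h.arr, h.arr_swap, h.idem, map_one, hX, one_smul, neg_smul, sub_neg_eq_add, hfac]
    at hx hx' hy hy'
  have hxx : (D.transpose a b ht).br (𝐱 b) (𝐱 b) = ((1 / 2 : k) * D.form b.swap b) •
      (𝐞 (𝐭 b.swap) ⊗ₜ[k] (𝐱 b * 𝐱 b) - (𝐱 b * 𝐱 b) ⊗ₜ[k] 𝐞 (𝐭 b)) := by
    rw [hF.arr_arr, arrowBracket_eq (D.transpose a b ht).isTailForm, if_neg (swap_ne b).symm, hf4,
      hf3, (D.transpose a b ht).isTailForm.self, (D.transpose a b ht).isTailForm.self]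
    module
  have hss : (D.transpose a b ht).br (𝐱 b.swap) (𝐱 b.swap) = ((1 / 2 : k) * D.form b.swap b) •
      ((𝐱 b.swap * 𝐱 b.swap) ⊗ₜ[k] 𝐞 (𝐭 b.swap) - 𝐞 (𝐭 b) ⊗ₜ[k] (𝐱 b.swap * 𝐱 b.swap)) := by
    rw [hF.arr_arr, arrowBracket_eq (D.transpose a b ht).isTailForm, if_neg (swap_ne _).symm,
      Sum.swap_swap, hf4, hf3, (D.transpose a b ht).isTailForm.self,
      (D.transpose a b ht).isTailForm.self]
    module
  have hsx : (D.transpose a b ht).br (𝐱 b.swap) (𝐱 b) = ((1 / 2 : k) * D.form b.swap b) •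
      (𝐱 b ⊗ₜ[k] 𝐱 b.swap - 𝐱 b.swap ⊗ₜ[k] 𝐱 b) - D.scalar b • (𝐞 (𝐭 b) ⊗ₜ[k] 𝐞 (𝐭 b.swap)
      + (1 / 2 : k) • ((𝐱 b * 𝐱 b.swap) ⊗ₜ[k] 𝐞 (𝐭 b.swap))
      + (1 / 2 : k) • (𝐞 (𝐭 b) ⊗ₜ[k] (𝐱 b.swap * 𝐱 b))) := by
    rw [hF.arr_arr, arrowBracket_eq (D.transpose a b ht).isTailForm, if_pos (Sum.swap_swap b).symm,
      Sum.swap_swap, hf4, hf3, (D.transpose a b ht).isTailForm.self,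
      (D.transpose a b ht).isTailForm.self, hs, scalar_swap, pairTerm, Sum.swap_swap]
    module
  have hpair : (D.transpose a b ht).br (ψ (𝐱 b)) (ψ (𝐱 b.swap)) =
      tensorSq ψ (arrowBracket Q D.form D.scalar b b.swap) := by
    rw [h.arr, h.arr_swap, hb.conj_pair hθ (idem_mul_arr b) (arr_swap_mul_idem b) heX hx' hsx hy,
      arrowBracket_eq D.isTailForm, if_pos rfl, Sum.swap_swap, hform', D.isTailForm.self,
      D.isTailForm.self, pairTerm]
    simp only [map_add, map_sub, map_smul, map_mul, tensorSq_tmul, h.arr, h.arr_swap, h.idem,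
      mul_assoc, Units.inv_mul_cancel_left]
    module
  by_cases hp : p = b
  · subst hp
    by_cases hq : q = p
    · subst hq
      rw [h.arr, hb.conj_self hθ (idem_mul_arr q) heX hx hxx hy, arrowBracket_eq D.isTailForm,
        if_neg (swap_ne q).symm, hform', D.isTailForm.self, D.isTailForm.self]
      simp only [map_add, map_sub, map_smul, map_mul, tensorSq_tmul, h.arr, h.arr_swap, h.idem,
        map_zero]
      module
    · by_cases hq' : q = p.swap
      · subst hq'
        exact hpair
      · have h1 := transpose_map_arr_of_ne (ht := ht) hab hba h hq hq' p
        rw [← D.isFormBracket_br.arr_arr] at h1 ⊢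
        exact bracket_map_symm D.isDoubleBracket_br hb h1
  · by_cases hp' : p = b.swap
    · subst hp'
      by_cases hq : q = b
      · subst hq
        rw [← D.isFormBracket_br.arr_arr] at hpair ⊢
        exact bracket_map_symm D.isDoubleBracket_br hb hpair
      · by_cases hq' : q = b.swap
        · subst hq'
          rw [h.arr_swap, hb.conj_swap hθ (arr_swap_mul_idem b) heX hx' hss hy',
            arrowBracket_eq D.isTailForm, if_neg (swap_ne _).symm, Sum.swap_swap, hform',
            D.isTailForm.self, D.isTailForm.self]
          simp only [map_add, map_sub, map_smul, map_mul, tensorSq_tmul, h.arr, h.arr_swap, h.idem,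
            map_zero]
          module
        · have h1 := transpose_map_arr_of_ne (ht := ht) hab hba h hq hq' b.swap
          rw [← D.isFormBracket_br.arr_arr] at h1 ⊢
          exact bracket_map_symm D.isDoubleBracket_br hb h1
    · exact transpose_map_arr_of_ne hab hba h hp hp' q

end Transpose

/-! ### Independence of the orderings -/

section Orderings

variable {k : Type z} [Field k] [CharZero k] {I : Type u} {E : Type v} {Q : FinQuiver I E}

theorem map_swap_of_notMem {α : Type*} [DecidableEq α] {a b : α} {l : List α} (ha : a ∉ l)
    (hb : b ∉ l) : l.map (Equiv.swap a b) = l := by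
  conv_rhs => rw [← l.map_id]
  refine List.map_congr_left fun c hc => Equiv.swap_apply_of_ne_of_ne ?_ ?_
  · rintro rfl
    exact ha hc
  · rintro rfl
    exact hb hc

open Classical in
theorem OrderDatum.list_map_swap {D : OrderDatum k Q} {a b : E ⊕ E} {s : I}
    {pre l : List (E ⊕ E)} (hl : D.list s = pre ++ b :: a :: l) :
    (D.list s).map (Equiv.swap a b) = pre ++ a :: b :: l := by
  have h := D.nodup s
  rw [hl] at h ⊢
  simp only [List.nodup_append, List.nodup_cons, List.mem_cons, not_or] at h
  obtain ⟨-, ⟨⟨hba, hbl⟩, hal, -⟩, h⟩ := h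
  rw [List.map_append, List.map_cons, List.map_cons, Equiv.swap_apply_left, Equiv.swap_apply_right,
    map_swap_of_notMem hal hbl, map_swap_of_notMem (fun ha => h a ha a (by simp) rfl)
      (fun hb => h b hb b (by simp) rfl)]

open Classical in
theorem OrderDatum.map_swap_eq_update {D : OrderDatum k Q} {a b : E ⊕ E} {s : I}
    {pre l : List (E ⊕ E)} (hl : D.list s = pre ++ b :: a :: l) :
    (fun s' => (D.list s').map (Equiv.swap a b)) =
      Function.update D.list s (pre ++ a :: b :: l) := by
  funext s'
  by_cases hs : s' = s
  · rw [hs, list_map_swap hl, Function.update_self]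
  · have hb : Q.double.t b = s := (D.mem_list s b).1 (by simp [hl])
    have ha : Q.double.t a = s := (D.mem_list s a).1 (by simp [hl])
    rw [Function.update_of_ne hs]
    refine map_swap_of_notMem (fun h => hs ?_) (fun h => hs ?_)
    · rw [← (D.mem_list _ _).1 h, ha]
    · rw [← (D.mem_list _ _).1 h, hb]

/-- The lists determine the form: two half-edges with the same tail occur in the same list, the form
is 1 from the earlier to the later, and skew-symmetry gives the rest. -/
theorem OrderDatum.ext_of_list {D D' : OrderDatum k Q} (hl : D.list = D'.list)
    (hs : D.sign = D'.sign) : D = D' := by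
  refine OrderDatum.ext (funext fun p => funext fun q => ?_) hs hl
  by_cases h : Q.double.t p = Q.double.t q
  · have h1 := D.pairwise (Q.double.t q)
    have h2 := D'.pairwise (Q.double.t q)
    rw [← hl] at h2
    have : Std.Symm fun p q => D.form p q = D'.form p q :=
      ⟨fun p q hpq => by rw [D.isTailForm.antisymm, D'.isTailForm.antisymm, hpq]⟩
    exact List.Pairwise.forall_of_forall (R := fun p q => D.form p q = D'.form p q)
      (fun p _ => by rw [D.isTailForm.self, D'.isTailForm.self])
      ((h1.and h2).imp fun h => h.1.trans h.2.symm) ((D.mem_list _ _).2 h) ((D.mem_list _ _).2 rfl)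
  · rw [D.isTailForm.eq_zero p q h, D'.isTailForm.eq_zero p q h]

variable [Fintype I]

/-- For the moment map, with factors X_a and X_b: the map fixes X_a and sends X_b to X_a X_b X_a⁻¹,
hence X_b X_a to X_a X_b. The remaining factors are fixed. -/
theorem OrderDatum.equivalent_transpose {D : OrderDatum k Q} {a b : E ⊕ E} {s : I}
    {pre l : List (E ⊕ E)} (hl : D.list s = pre ++ b :: a :: l) (hne : a ≠ b.swap)
    (ht : Q.double.t a = Q.double.t b) : D.Equivalent (D.transpose a b ht) := by
  classical
  have hba : D.form b a = 1 := form_eq_one_of_mem_right hl (by simp)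
  have hneab : a ≠ b := (ne_of_form hba).symm
  have hab : ∀ r, r ≠ a → r ≠ b → D.form r a = D.form r b := fun r => form_eq_of_adjacent hl
  have heX : Commute (idem k Q (Q.double.t b)) (D.factor a).val := ht ▸ D.commute_idem_factor a
  obtain ⟨ψ, h⟩ := exists_isConjMap heX
  obtain ⟨ψ', h'⟩ := exists_isConjMap heX.units_inv_right
  have hu := h.factor_of_ne D hneab
  refine equivalent_of_arr ψ ψ' (h'.comp_eq_id (by rwa [inv_inv]) (by rw [map_inv, hu]))
    (h.comp_eq_id h' (h'.factor_of_ne D hneab)) h.idem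
    (transpose_map_arr hab hba hne h) (fun s' => ?_)
  by_cases hs : s' = s
  · subst hs
    have hnd := D.nodup s'
    rw [hl] at hnd
    simp only [List.nodup_append, List.nodup_cons, List.mem_cons, not_or] at hnd
    obtain ⟨-, ⟨⟨-, hbl⟩, -, -⟩, hpre⟩ := hnd
    have hm : ∀ l' : List (E ⊕ E), b ∉ l' →
        Units.map (ψ : AQ k Q →* AQ k Q) (l'.map D.factor).prod = (l'.map D.factor).prod := by
      intro l' hl'
      rw [map_list_prod, List.map_map]
      congr 1
      exact List.map_congr_left fun p hp => h.factor_of_ne D fun hpb => hl' (hpb ▸ hp)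
    have hprod : Units.map (ψ : AQ k Q →* AQ k Q) (D.factorProd s') =
        (D.transpose a b ht).factorProd s' := by
      have h1 : (D.transpose a b ht).list s' = pre ++ a :: b :: l := list_map_swap hl
      have h2 : (D.transpose a b ht).factor = D.factor := rfl
      rw [factorProd, factorProd, hl, h1, h2]
      simp only [List.map_append, List.map_cons, List.prod_append, List.prod_cons, map_mul,
        hm l hbl, hm pre (fun hb => hpre b hb b (by simp) rfl), hu, h.factor_self]
      group
    rw [moment, moment, map_mul, h.idem, ← hprod]
    rfl
  · refine map_moment h.idem id ?_ fun p hp => h.factor_of_ne D ?_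
    · rw [List.map_id]
      have := congrFun (map_swap_eq_update hl) s'
      rwa [Function.update_of_ne hs] at this
    · rintro rfl
      exact hs (((D.mem_list _ _).1 hp).symm.trans ((D.mem_list s p).1 (by simp [hl])))

open Classical in
/-- Neighbours in a list may be exchanged. -/
theorem OrderDatum.exists_equivalent_swap [Fintype E] {D : OrderDatum k Q} {a b : E ⊕ E} {s : I}
    {pre l : List (E ⊕ E)} (hl : D.list s = pre ++ b :: a :: l) : ∃ D' : OrderDatum k Q,
      D'.list = Function.update D.list s (pre ++ a :: b :: l) ∧ D'.sign = D.sign ∧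
        D.Equivalent D' := by
  have hb : Q.double.t b = s := (D.mem_list s b).1 (by simp [hl])
  have ha : Q.double.t a = s := (D.mem_list s a).1 (by simp [hl])
  have ht := ha.trans hb.symm
  rw [← map_swap_eq_update hl]
  by_cases hne : a = b.swap
  -- If a = b*, the factor of a involves b itself and conjugation is not available. The exchange is
  -- then a relabelling compatible with *, which also exchanges the two signs; these are restored
  -- afterwards.
  · have hs : ∀ p : E ⊕ E, Equiv.swap a b p.swap = (Equiv.swap a b p).swap := by
      intro p
      have hba : b = a.swap := by rw [hne, Sum.swap_swap]
      by_cases hpa : p = a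
      · rw [hpa, ← hba, Equiv.swap_apply_right, Equiv.swap_apply_left, hne]
      · by_cases hpb : p = b
        · rw [hpb, ← hne, Equiv.swap_apply_right, Equiv.swap_apply_left, hba]
        · rw [Equiv.swap_apply_of_ne_of_ne hpa hpb, Equiv.swap_apply_of_ne_of_ne]
          · exact fun h => hpb (by rw [hba, ← h, Sum.swap_swap])
          · exact fun h => hpa (by rw [hne, ← h, Sum.swap_swap])
    obtain ⟨D', -, h1, h2, h3⟩ := (D.relabel (Q' := Q) (Equiv.swap a b) hs
      (Equiv.apply_swap_eq_self ht)).exists_equivalent_sign D.sign D.sign_swap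
    exact ⟨D', h1, h2, (D.equivalent_relabel _ _ _).trans h3⟩
  · exact ⟨D.transpose a b ht, rfl, rfl, equivalent_transpose hl hne ht⟩

open Classical in
-- Permutations are generated by exchanges of neighbours. The prefix `pre` is carried along so that
-- an exchange inside a tail of the list can be performed in place.
theorem OrderDatum.exists_equivalent_perm [Fintype E] {s : I} {l₁ l₂ : List (E ⊕ E)}
    (h : l₁.Perm l₂) : ∀ (D : OrderDatum k Q) (pre : List (E ⊕ E)), D.list s = pre ++ l₁ →
      ∃ D' : OrderDatum k Q, D'.list = Function.update D.list s (pre ++ l₂) ∧ D'.sign = D.sign ∧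
        D.Equivalent D' := by
  induction h with
  | nil => exact fun D pre hl => ⟨D, by rw [← hl, Function.update_eq_self], rfl, .refl D⟩
  | cons x _ ih =>
    intro D pre hl
    obtain ⟨D', h⟩ := ih D (pre ++ [x]) (by simpa using hl)
    exact ⟨D', by simpa using h⟩
  | swap x y l => exact fun D pre hl => exists_equivalent_swap hl
  | trans _ _ ih₁ ih₂ =>
    intro D pre hl
    obtain ⟨D₁, h1, h2, h3⟩ := ih₁ D pre hl
    obtain ⟨D₂, h4, h5, h6⟩ := ih₂ D₁ pre (by rw [h1, Function.update_self])
    exact ⟨D₂, by rw [h4, h1, Function.update_idem], h5.trans h2, h3.trans h6⟩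

/-- The lists may be replaced by any other ones. -/
theorem OrderDatum.exists_equivalent_list [Fintype E] (D D₁ : OrderDatum k Q) :
    ∃ D' : OrderDatum k Q, D'.list = D₁.list ∧ D'.sign = D.sign ∧ D.Equivalent D' := by
  classical
  have key : ∀ S : Finset I, ∃ D' : OrderDatum k Q, (∀ s ∈ S, D'.list s = D₁.list s) ∧
      D'.sign = D.sign ∧ D.Equivalent D' := by
    intro S
    induction S using Finset.induction_on with
    | empty => exact ⟨D, by simp, rfl, .refl D⟩
    | insert s S hs ih =>
      obtain ⟨D', h1, h2, h3⟩ := ih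
      have hp : (D'.list s).Perm (D₁.list s) :=
        (List.perm_ext_iff_of_nodup (D'.nodup s) (D₁.nodup s)).2 fun p => by
          rw [D'.mem_list, D₁.mem_list]
      obtain ⟨D'', h4, h5, h6⟩ := exists_equivalent_perm hp D' [] rfl
      refine ⟨D'', fun s' hs' => ?_, h5.trans h2, h3.trans h6⟩
      rw [h4, List.nil_append]
      by_cases hss : s' = s
      · rw [hss, Function.update_self]
      · rw [Function.update_of_ne hss]
        exact h1 s' ((Finset.mem_insert.1 hs').resolve_left hss)
  obtain ⟨D', h1, h2⟩ := key Finset.univ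
  exact ⟨D', funext fun s => h1 s (Finset.mem_univ s), h2⟩

/-- Up to isomorphism, the structure does not depend on the datum. -/
theorem OrderDatum.equivalent [Fintype E] (D D' : OrderDatum k Q) : D.Equivalent D' := by
  obtain ⟨D₁, -, -, h1, h2⟩ := D.exists_equivalent_sign D'.sign D'.sign_swap
  obtain ⟨D₂, h3, h4, h5⟩ := D₁.exists_equivalent_list D'
  obtain rfl : D₂ = D' := ext_of_list h3 (h4.trans h1)
  exact h2.trans h5

end Orderings

/-! ### Independence of the orientation -/

section Orientation

variable {I : Type u} {E' : Type w} {Q' : FinQuiver I E'} {E : Type v} {Q : FinQuiver I E}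

/-- A bijection of arrows which preserves end points extends to the double quivers. -/
theorem FinQuiver.SameGraph.exists_equiv (h : Q.SameGraph Q') : ∃ φ : E ⊕ E ≃ E' ⊕ E',
    (∀ p, φ p.swap = (φ p).swap) ∧ ∀ p, Q'.double.t (φ p) = Q.double.t p := by
  classical
  obtain ⟨τ, hτ⟩ := h
  -- The involution r swaps p and p* for those arrows whose orientation τ does not preserve; after
  -- that, tails match.
  let r : E ⊕ E → E ⊕ E := fun p =>
    if Q'.t (τ (Sum.elim id id p)) = Q.t (Sum.elim id id p) ∧
      Q'.h (τ (Sum.elim id id p)) = Q.h (Sum.elim id id p) then p else p.swap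
  have hr : ∀ p, r (r p) = p := by
    intro p
    have : Sum.elim id id p.swap = (Sum.elim id id p : E) := by cases p <;> rfl
    simp only [r]
    split_ifs <;> simp_all
  have hrs : ∀ p, r p.swap = (r p).swap := by
    intro p
    have : Sum.elim id id p.swap = (Sum.elim id id p : E) := by cases p <;> rfl
    simp only [r, this]
    split_ifs <;> rfl
  obtain ⟨φ, hφ⟩ : ∃ φ : E ⊕ E ≃ E' ⊕ E', ∀ p, φ p = Sum.map τ τ (r p) :=
    ⟨(Function.Involutive.toPerm r hr).trans (Equiv.sumCongr τ τ), fun _ => rfl⟩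
  refine ⟨φ, fun p => ?_, fun p => ?_⟩
  · rw [hφ, hφ, hrs]
    cases r p <;> rfl
  · rw [hφ]
    have h1 := fun a => Sym2.eq_iff.1 (hτ a)
    rcases p with x | x <;> by_cases h2 : Q'.t (τ x) = Q.t x ∧ Q'.h (τ x) = Q.h x
    · rw [show r (Sum.inl x) = Sum.inl x from if_pos h2]
      exact h2.1
    · rw [show r (Sum.inl x) = Sum.inr x from if_neg h2]
      exact ((h1 x).resolve_left h2).2
    · rw [show r (Sum.inr x) = Sum.inr x from if_pos h2]
      exact h2.2
    · rw [show r (Sum.inr x) = Sum.inl x from if_neg h2]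
      exact ((h1 x).resolve_left h2).1

end Orientation

/-! ### Conclusion for Van den Bergh's structure -/

section Standard

variable {k : Type z} [Field k] [CharZero k] {I : Type u} [Fintype I] [DecidableEq I]
variable {E : Type v} {Q : FinQuiver I E} {o : Q.Ordering}

variable (Q o) in
theorem existsUnique_isVdBBracket : ∃! br, IsVdBBracket k Q o br := by
  obtain ⟨br, h⟩ := exists_isFormBracket (ordForm_isTailForm k o)
    (η := fun p => ((stdSign p : ℤ) : k)) (fun p => by simp [stdSign_swap])
  exact ⟨br, (isVdBBracket_iff k o br).2 h, fun br' h' =>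
    ((isVdBBracket_iff k o br').1 h').unique h⟩

variable [Fintype E] {br : AQ k Q →ₗ[k] AQ k Q →ₗ[k] AQ k Q ⊗[k] AQ k Q}

theorem IsVdBBracket.eq_br (h : IsVdBBracket k Q o br) : br = (stdDatum k o).br :=
  ((isVdBBracket_iff k o br).1 h).unique (stdDatum k o).isFormBracket_br

theorem IsVdBBracket.isQuasiHamiltonian (h : IsVdBBracket k Q o br) :
    IsQuasiHamiltonian (idem k Q) br (momentMap k Q o) where
  quasiPoisson := ((isVdBBracket_iff k o br).1 h).isDoubleQuasiPoisson (ordForm_isOrderForm k o)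
    (stdDatum k o).scalar_swap (stdDatum k o).scalar_mul_self
  moment := by
    rw [momentMap_eq]
    exact (stdDatum k o).isMultMomentMap ((isVdBBracket_iff k o br).1 h)

end Standard

end

end VdB

theorem mainTheorem2 {k : Type*} [Field k] [CharZero k]
    {I : Type*} [Fintype I] [DecidableEq I]
    {E₁ : Type*} [Fintype E₁] {E₂ : Type*} [Fintype E₂]
    (Q₁ : VdB.FinQuiver I E₁) (Q₂ : VdB.FinQuiver I E₂) (hQ : Q₁.SameGraph Q₂)
    (o₁ : Q₁.Ordering) (o₂ : Q₂.Ordering) :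
    (∃! br₁, VdB.IsVdBBracket k Q₁ o₁ br₁) ∧
    (∃! br₂, VdB.IsVdBBracket k Q₂ o₂ br₂) ∧
    ∀ br₁ br₂, VdB.IsVdBBracket k Q₁ o₁ br₁ → VdB.IsVdBBracket k Q₂ o₂ br₂ →
      VdB.IsQuasiHamiltonian (VdB.idem k Q₁) br₁ (VdB.momentMap k Q₁ o₁) ∧
      VdB.IsQuasiHamiltonian (VdB.idem k Q₂) br₂ (VdB.momentMap k Q₂ o₂) ∧
      ∃ ψ : VdB.AQ k Q₁ ≃ₐ[k] VdB.AQ k Q₂,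
        VdB.IsQHIso (VdB.idem k Q₁) br₁ (VdB.momentMap k Q₁ o₁)
          (VdB.idem k Q₂) br₂ (VdB.momentMap k Q₂ o₂) ψ := by
  refine ⟨VdB.existsUnique_isVdBBracket Q₁ o₁, VdB.existsUnique_isVdBBracket Q₂ o₂,
    fun br₁ br₂ h₁ h₂ => ⟨h₁.isQuasiHamiltonian, h₂.isQuasiHamiltonian, ?_⟩⟩
  obtain rfl := h₁.eq_br
  obtain rfl := h₂.eq_br
  obtain ⟨φ, hφ, ht⟩ := hQ.exists_equiv
  -- Transporting the first structure to A_{Q₂} gives a datum whose signs and orders need not be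
  -- those of Q₂ and `o₂`; any two data on the same quiver are equivalent.
  obtain ⟨ψ, h3, h4, h5⟩ := ((VdB.stdDatum k o₁).equivalent_relabel φ hφ ht).trans
    (VdB.OrderDatum.equivalent _ (VdB.stdDatum k o₂))
  refine ⟨ψ, h3, h4, ?_⟩
  rw [map_sum, VdB.momentMap_eq, VdB.momentMap_eq]
  exact Finset.sum_congr rfl fun s _ => h5 s
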